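/- All graphs are finite and simple, and embeddings of graphs into the real projective plane $\mathbb{R}P^2$ are piecewise linear. A graph is \emph{projective planar} if it embeds into $\mathbb{R}P^2$. A cycle of a graph embedded in $\mathbb{R}P^2$ is \emph{0-homologous} if it bounds a disk in $\mathbb{R}P^2$. A graph $G$ is \emph{separating projective planar} if it is projective planar and if for every embedding of $G$ into $\mathbb{R}P^2$ there are a 0-homologous cycle $C$ in $G$ and two vertices of $G$, not on $C$, that lie in different connected components of $\mathbb{R}P^2\setminus C$. A \emph{$\Delta$-Y exchange} on a triangle of $G$ with vertices $v_1,v_2,v_3$ deletes the three edges $v_1v_2$, $v_2v_3$, $v_1v_3$ and adds one new vertex $v_0$ together with the three edges $v_0v_1$, $v_0v_2$, $v_0v_3$. Let $G$ be a separating projective planar graph, and let $G'$ be obtained from $G$ by a $\Delta$-Y exchange. If $G'$ is projective planar, then $G'$ is separating projective planar. -/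

import Mathlib

open scoped LinearAlgebra.Projectivization

namespace ProjPlanar

noncomputable section

/-- Euclidean three-space. -/
abbrev E3 : Type := EuclideanSpace ℝ (Fin 3)

/-- The nonzero vectors of three-space. -/
abbrev NonzeroE3 : Type := {v : E3 // v ≠ 0}

/-- The real projective plane: the lines through the origin in three-space. -/
abbrev RP2 : Type := ℙ ℝ E3

/-- The point of the projective plane spanned by a nonzero vector. -/
abbrev pt (x : NonzeroE3) : RP2 := Projectivization.mk' ℝ x

/-- The quotient topology, coming from the nonzero vectors. -/
instance : TopologicalSpace RP2 :=
  TopologicalSpace.coinduced pt inferInstance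

/-- The image in the projective plane of the straight segment between `x` and `y` in
three-space. It is a geodesic segment if `x` and `y` are linearly independent. -/
def projSegment (x y : NonzeroE3) : Set RP2 :=
  {P | ∃ z : NonzeroE3, (z : E3) ∈ segment ℝ (x : E3) (y : E3) ∧ pt z = P}

/-- `A` is a piecewise linear arc in the projective plane with end points `P` and `Q`: it is
traced out by a simple polygonal chain of geodesic segments, two of which meet only if they are
consecutive, and then only in their common end point. -/
def IsPLArc (A : Set RP2) (P Q : RP2) : Prop :=
  ∃ (n : ℕ) (x : ℕ → NonzeroE3),
    0 < n ∧
    (∀ i < n, LinearIndependent ℝ ![(x i : E3), (x (i + 1) : E3)]) ∧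
    (∀ i j, i < j → j < n → ∀ R ∈ projSegment (x i) (x (i + 1)),
      R ∈ projSegment (x j) (x (j + 1)) → j = i + 1 ∧ R = pt (x j)) ∧
    pt (x 0) = P ∧ pt (x n) = Q ∧
    A = ⋃ i < n, projSegment (x i) (x (i + 1))

/-- A piecewise linear embedding of the graph `G` into the projective plane: vertices go to
distinct points, each edge goes to a piecewise linear arc joining its end vertices and passing
through no other vertex, and two different edges meet only in common end vertices. -/
structure PLEmbedding {V : Type*} (G : SimpleGraph V) where
  /-- The point at which a vertex is placed. -/
  point : V → RP2
  /-- The arc that represents an edge. -/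
  arc : G.edgeSet → Set RP2
  point_injective : Function.Injective point
  isPLArc : ∀ (u v : V) (h : G.Adj u v), IsPLArc (arc ⟨s(u, v), h⟩) (point u) (point v)
  mem_of_point_mem : ∀ (e : G.edgeSet) (w : V), point w ∈ arc e → w ∈ (e : Sym2 V)
  inter : ∀ e e' : G.edgeSet, e ≠ e' → ∀ P ∈ arc e, P ∈ arc e' →
    ∃ w : V, w ∈ (e : Sym2 V) ∧ w ∈ (e' : Sym2 V) ∧ P = point w

/-- The subset of the projective plane that is covered by the edges of a walk. -/
def PLEmbedding.trace {V : Type*} {G : SimpleGraph V} (f : PLEmbedding G) {u v : V}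
    (p : G.Walk u v) : Set RP2 :=
  ⋃ e : G.edgeSet, ⋃ _ : (e : Sym2 V) ∈ p.edges, f.arc e

/-- The closed unit disk in the Euclidean plane. -/
abbrev ClosedDisk : Type := Metric.closedBall (0 : EuclideanSpace ℝ (Fin 2)) 1

/-- `C` bounds a disk: there is an embedded closed disk in the projective plane whose boundary
circle is `C`. For the image of a cycle of an embedded graph this says that the cycle is
0-homologous. -/
def BoundsDisk (C : Set RP2) : Prop :=
  ∃ φ : ClosedDisk → RP2, Topology.IsEmbedding φ ∧
    φ '' {z | ‖(z : EuclideanSpace ℝ (Fin 2))‖ = 1} = C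

/-- An embedding is separating if some 0-homologous cycle `p` of the graph has two vertices of the
graph, neither of them on `p`, in different connected components of its complement. -/
def PLEmbedding.IsSeparating {V : Type*} {G : SimpleGraph V} (f : PLEmbedding G) : Prop :=
  ∃ (w : V) (p : G.Walk w w), p.IsCycle ∧ BoundsDisk (f.trace p) ∧
    ∃ u v : V, u ∉ p.support ∧ v ∉ p.support ∧
      connectedComponentIn (f.trace p)ᶜ (f.point u) ≠
        connectedComponentIn (f.trace p)ᶜ (f.point v)

/-- A graph is projective planar if it embeds into the projective plane. -/
def IsProjectivePlanar {V : Type*} (G : SimpleGraph V) : Prop :=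
  Nonempty (PLEmbedding G)

/-- A graph is separating projective planar if it is projective planar and all its embeddings
into the projective plane are separating. -/
def IsSeparatingProjectivePlanar {V : Type*} (G : SimpleGraph V) : Prop :=
  IsProjectivePlanar G ∧ ∀ f : PLEmbedding G, f.IsSeparating

/-- The graph obtained from `G` by the Δ-Y exchange on a triangle with vertices `a`, `b`, `c`: the
three edges of the triangle are deleted, and a new vertex, here `none`, is joined to `a`, `b`
and `c`. -/
def deltaY {V : Type*} (G : SimpleGraph V) (a b c : V) : SimpleGraph (Option V) :=
  (G.deleteEdges {s(a, b), s(b, c), s(a, c)}).map some ⊔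
    SimpleGraph.fromEdgeSet {s(none, some a), s(none, some b), s(none, some c)}

end

end ProjPlanar

/-!
Let `g` be a drawing of the exchanged graph. The three legs of the star at the new vertex are
replaced by a triangle that runs close to them: the side `AB` consists of two of the legs, `AC` runs
parallel to the leg of `a` and turns into the leg of `c` near the centre, and `BC` runs parallel to
the legs of `b` and `c`. This gives a drawing `f` of `G` (`exists_embedding`), and by hypothesis `f`
has a disk-bounding cycle that separates two vertices `u` and `v`. It has to be turned into such a
cycle for `g`.

Everything is polygonal, and two nearby arcs differ by a finite sequence of moves, each of which
pulls one side of a triangle across to the other two sides. Such a move is carried out by a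
homeomorphism of the projective plane supported in a thin neighbourhood of the triangle
(`exists_kite_homeomorph`, `Indep3.exists_move`), which therefore fixes any polygonal set that meets
the triangle only where this is permitted. `SlideData.step` and `Arc.exists_parallel` construct a
parallel copy of an arc one segment at a time, together with the moves between the two, and
`exists_replaces` combines parallel copies of the legs into the triangle.

The cycle of `f` is treated according to the sides of the triangle that it uses.
* If it uses none of them, it is a cycle of the exchanged graph with the same trace
  (`Agree.isSeparating_of_disjoint`).
* If it uses one or two of them, replacing these by the two legs with the same ends gives a cycle of
  the exchanged graph (`Agree.isSeparating_of_one`, `Agree.isSeparating_of_two`). The two traces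
  differ by moves that fix the rest of the cycle and the points of `u` and `v`, so that the new
  cycle bounds a disk and separates `u` from `v`, too.
* It cannot use all three. It would be the triangle itself, and moves that fix `u` and `v` bring the
  triangle into a closed geodesic triangle that contains neither of them. As the complement of
  a closed geodesic triangle is connected (`Indep3.isPreconnected_compl_tri`), the two vertices
  would not be separated.

Points of the projective plane are handled through vectors of three-space that span them, so that
positions relative to a triangle are expressed by linear coordinates (`Indep3`), and no metric on
the projective plane is needed.
-/

namespace ProjPlanar

section

open Set Filter Topology

/-! ### Points, segments and triangles in homogeneous coordinates -/

/-- The vector `v` is nonzero and spans the point `P`. -/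
def Reps (v : E3) (P : RP2) : Prop := ∃ h : v ≠ 0, Projectivization.mk ℝ v h = P

/-- The singleton of the point spanned by `x`; it is empty if `x = 0`. -/
def pnt (x : E3) : Set RP2 := {P | Reps x P}

/-- The projective image of the convex cone spanned by `x` and `y`. -/
def seg (x y : E3) : Set RP2 := {P | ∃ s t : ℝ, 0 ≤ s ∧ 0 ≤ t ∧ Reps (s • x + t • y) P}

/-- The projective image of the convex cone spanned by `x`, `y` and `z`: a closed triangle. -/
def tri (x y z : E3) : Set RP2 :=
  {P | ∃ s t u : ℝ, 0 ≤ s ∧ 0 ≤ t ∧ 0 ≤ u ∧ Reps (s • x + t • y + u • z) P}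

/-- Linear independence of two vectors, spelled out. -/
def Indep2 (x y : E3) : Prop := ∀ s t : ℝ, s • x + t • y = 0 → s = 0 ∧ t = 0

/-- Linear independence of three vectors, spelled out. -/
def Indep3 (x y z : E3) : Prop :=
  ∀ s t u : ℝ, s • x + t • y + u • z = 0 → s = 0 ∧ t = 0 ∧ u = 0

theorem Reps.ne_zero {v : E3} {P : RP2} (h : Reps v P) : v ≠ 0 := h.1

theorem exists_reps (P : RP2) : ∃ v, Reps v P := ⟨P.rep, P.rep_nonzero, P.mk_rep⟩

theorem reps_mk {v : E3} (h : v ≠ 0) : Reps v (Projectivization.mk ℝ v h) := ⟨h, rfl⟩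

theorem Reps.smul {v : E3} {P : RP2} (h : Reps v P) {c : ℝ} (hc : c ≠ 0) : Reps (c • v) P := by
  obtain ⟨h0, rfl⟩ := h
  exact ⟨smul_ne_zero hc h0, (Projectivization.mk_eq_mk_iff' ℝ _ _ _ _).2 ⟨c, rfl⟩⟩

theorem Reps.exists_smul {v w : E3} {P : RP2} (h : Reps v P) (h' : Reps w P) :
    ∃ c : ℝ, c ≠ 0 ∧ w = c • v := by
  obtain ⟨h0, rfl⟩ := h
  obtain ⟨h1, h2⟩ := h'
  obtain ⟨c, hc⟩ := (Projectivization.mk_eq_mk_iff' ℝ _ _ _ _).1 h2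
  refine ⟨c, ?_, hc.symm⟩
  rintro rfl
  exact h1 (by rw [← hc, zero_smul])

theorem Reps.unique {v : E3} {P Q : RP2} (h : Reps v P) (h' : Reps v Q) : P = Q := by
  obtain ⟨_, rfl⟩ := h
  obtain ⟨_, rfl⟩ := h'
  rfl

theorem Reps.pnt_eq {v : E3} {P : RP2} (h : Reps v P) : pnt v = {P} := by
  ext Q
  exact ⟨fun hQ => hQ.unique h, by rintro rfl; exact h⟩

theorem pnt_smul (x : E3) {c : ℝ} (hc : c ≠ 0) : pnt (c • x) = pnt x := by
  ext P
  refine ⟨fun h => ?_, fun h => h.smul hc⟩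
  have := Reps.smul h (inv_ne_zero hc)
  rwa [smul_smul, inv_mul_cancel₀ hc, one_smul] at this

theorem pnt_subset_seg_left (x y : E3) : pnt x ⊆ seg x y := fun P h =>
  ⟨1, 0, zero_le_one, le_rfl, by rw [one_smul, zero_smul, add_zero]; exact h⟩

theorem seg_symm (x y : E3) : seg x y = seg y x := by
  ext P
  constructor <;> rintro ⟨s, t, hs, ht, h⟩ <;> exact ⟨t, s, ht, hs, by rwa [add_comm]⟩

theorem pnt_subset_seg_right (x y : E3) : pnt y ⊆ seg x y := by
  rw [seg_symm]; exact pnt_subset_seg_left y x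

theorem seg_self (x : E3) : seg x x = pnt x := by
  refine Subset.antisymm ?_ (pnt_subset_seg_left x x)
  rintro P ⟨s, t, hs, ht, h⟩
  rw [← add_smul] at h
  have : s + t ≠ 0 := fun h0 => h.ne_zero (by rw [h0, zero_smul])
  rw [← pnt_smul x this]
  exact h

theorem tri_rotate (x y z : E3) : tri x y z = tri y z x := by
  ext P
  constructor
  · rintro ⟨s, t, u, hs, ht, hu, h⟩
    exact ⟨t, u, s, ht, hu, hs, by convert h using 1; abel⟩
  · rintro ⟨s, t, u, hs, ht, hu, h⟩
    exact ⟨u, s, t, hu, hs, ht, by convert h using 1; abel⟩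

theorem tri_swap (x y z : E3) : tri x y z = tri y x z := by
  ext P
  constructor <;> rintro ⟨s, t, u, hs, ht, hu, h⟩ <;>
    exact ⟨t, s, u, ht, hs, hu, by convert h using 1; abel⟩

theorem seg_subset_tri (x y z : E3) : seg x y ⊆ tri x y z := by
  rintro P ⟨s, t, hs, ht, h⟩
  exact ⟨s, t, 0, hs, ht, le_rfl, by rwa [zero_smul, add_zero]⟩

theorem seg_subset_tri_right (x y z : E3) : seg y z ⊆ tri x y z := by
  rw [tri_rotate]; exact seg_subset_tri y z x

theorem seg_subset_tri_outer (x y z : E3) : seg x z ⊆ tri x y z := by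
  rw [seg_symm, ← tri_rotate]; exact seg_subset_tri z x y

theorem seg_smul (x y : E3) {c : ℝ} (hc : c ≠ 0) : seg (c • x) (c • y) = seg x y := by
  ext P
  constructor
  · rintro ⟨s, t, hs, ht, h⟩
    refine ⟨s, t, hs, ht, ?_⟩
    have := h.smul (inv_ne_zero hc)
    convert this using 1
    rw [smul_comm s, smul_comm t, ← smul_add, smul_smul, inv_mul_cancel₀ hc, one_smul]
  · rintro ⟨s, t, hs, ht, h⟩
    refine ⟨s, t, hs, ht, ?_⟩
    have := h.smul hc
    convert this using 1
    rw [smul_comm s, smul_comm t, ← smul_add]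

theorem Indep2.symm {x y : E3} (h : Indep2 x y) : Indep2 y x := fun s t e =>
  (h t s (by rwa [add_comm])).symm

theorem Indep2.ne_zero {x y : E3} (h : Indep2 x y) : x ≠ 0 := fun e => by
  have := h 1 0 (by simp [e])
  simp at this

theorem Indep2.smul {x y : E3} (h : Indep2 x y) {c : ℝ} (hc : c ≠ 0) :
    Indep2 (c • x) (c • y) := fun s t e => by
  have := h (s * c) (t * c) (by rwa [← smul_smul, ← smul_smul])
  simpa [hc] using this

theorem indep2_iff {x y : E3} : Indep2 x y ↔ LinearIndependent ℝ ![x, y] :=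
  LinearIndependent.pair_iff.symm

theorem Indep2.disjoint {x y : E3} (h : Indep2 x y) : Disjoint (pnt x) (pnt y) := by
  rw [Set.disjoint_left]
  intro P hx hy
  obtain ⟨c, hc, e⟩ := Reps.exists_smul hx hy
  have := h c (-1) (by rw [e]; simp)
  exact hc this.1

theorem Indep3.rotate {x y z : E3} (h : Indep3 x y z) : Indep3 y z x := fun s t u e => by
  have := h u s t (by rw [← e]; abel)
  tauto

theorem Indep3.swap {x y z : E3} (h : Indep3 x y z) : Indep3 y x z := fun s t u e => by
  have := h t s u (by rw [← e]; abel)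
  tauto

theorem Indep3.indep2 {x y z : E3} (h : Indep3 x y z) : Indep2 x y := fun s t e => by
  have := h s t 0 (by rw [← e]; simp)
  tauto

/-- The coordinate functionals of a basis of three-space. -/
theorem Indep3.exists_coord {p q r : E3} (h : Indep3 p q r) :
    ∃ α β γ : E3 →ₗ[ℝ] ℝ, (∀ v, v = α v • p + β v • q + γ v • r) ∧
      (α p = 1 ∧ α q = 0 ∧ α r = 0) ∧ (β p = 0 ∧ β q = 1 ∧ β r = 0) ∧
      (γ p = 0 ∧ γ q = 0 ∧ γ r = 1) := by
  have hli : LinearIndependent ℝ ![p, q, r] := by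
    rw [Fintype.linearIndependent_iff]
    intro g hg
    simp only [Fin.sum_univ_three, Matrix.cons_val] at hg
    have := h _ _ _ hg
    intro i
    fin_cases i
    · exact this.1
    · exact this.2.1
    · exact this.2.2
  let b : Module.Basis (Fin 3) ℝ E3 := basisOfLinearIndependentOfCardEqFinrank hli (by simp)
  have hb : ∀ i, b i = ![p, q, r] i := fun i => by simp [b]
  have h0 : b 0 = p := hb 0
  have h1 : b 1 = q := hb 1
  have h2 : b 2 = r := hb 2
  refine ⟨b.coord 0, b.coord 1, b.coord 2, fun v => ?_, ?_, ?_, ?_⟩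
  · have := b.sum_repr v
    rw [Fin.sum_univ_three, h0, h1, h2] at this
    simpa using this.symm
  all_goals rw [← h0, ← h1, ← h2]; simp

/-- Two independent vectors and a third one form a basis, unless the third one lies in their
span. -/
theorem Indep2.indep3_or {x y : E3} (h : Indep2 x y) (z : E3) :
    Indep3 x y z ∨ ∃ a b : ℝ, z = a • x + b • y := by
  by_cases hz : ∃ a b : ℝ, z = a • x + b • y
  · exact Or.inr hz
  · refine Or.inl fun s t u e => ?_
    have hu : u = 0 := by
      by_contra hu
      refine hz ⟨-(u⁻¹ * s), -(u⁻¹ * t), ?_⟩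
      have : u⁻¹ • (s • x + t • y + u • z) = 0 := by rw [e, smul_zero]
      rw [smul_add, smul_add, smul_smul, smul_smul, smul_smul, inv_mul_cancel₀ hu, one_smul] at this
      rw [neg_smul, neg_smul]
      exact (eq_neg_of_add_eq_zero_right this).trans (by abel)
    subst hu
    have := h s t (by simpa using e)
    tauto

/-- In a basis, a point lies in the triangle of the basis vectors iff its coordinates can be made
nonnegative. -/
theorem mem_tri_iff {p q r : E3} {α β γ : E3 →ₗ[ℝ] ℝ}
    (hv : ∀ v, v = α v • p + β v • q + γ v • r)
    (hα : α p = 1 ∧ α q = 0 ∧ α r = 0) (hβ : β p = 0 ∧ β q = 1 ∧ β r = 0)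
    (hγ : γ p = 0 ∧ γ q = 0 ∧ γ r = 1) {P : RP2} :
    P ∈ tri p q r ↔ ∃ v, Reps v P ∧ 0 ≤ α v ∧ 0 ≤ β v ∧ 0 ≤ γ v := by
  constructor
  · rintro ⟨s, t, u, hs, ht, hu, h⟩
    refine ⟨_, h, ?_⟩
    simp [hα, hβ, hγ, hs, ht, hu]
  · rintro ⟨v, hP, h1, h2, h3⟩
    exact ⟨_, _, _, h1, h2, h3, by rwa [← hv]⟩

/-! ### Elementary homeomorphisms of the projective plane -/

theorem continuous_pt : Continuous pt := continuous_coinduced_rng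

/-- A homeomorphism of three-space that commutes with the nonzero scalars induces one of the
projective plane. -/
theorem exists_homeomorph_of_homogeneous (f g : E3 → E3) (hf : Continuous f) (hg : Continuous g)
    (hgf : ∀ x, g (f x) = x) (hfg : ∀ x, f (g x) = x)
    (hfs : ∀ (c : ℝ) x, c ≠ 0 → f (c • x) = c • f x)
    (hgs : ∀ (c : ℝ) x, c ≠ 0 → g (c • x) = c • g x) :
    ∃ H : RP2 ≃ₜ RP2, ∀ v P, Reps v P → Reps (f v) (H P) := by
  have key : ∀ (f g : E3 → E3), Continuous f → (∀ x, g (f x) = x) → (∀ x, f (g x) = x) →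
      (∀ (c : ℝ) x, c ≠ 0 → f (c • x) = c • f x) →
      ∃ F : RP2 → RP2, Continuous F ∧ ∀ v P, Reps v P → Reps (f v) (F P) := by
    intro f g hf hgf hfg hfs
    have hf0 : f 0 = 0 := by
      have h := hfs 2 0 two_ne_zero
      rw [smul_zero, two_smul] at h
      simpa using h
    have hne : ∀ x, x ≠ 0 → f x ≠ 0 := fun x hx h => hx <| by
      have h1 := hgf x
      rw [h] at h1
      have h2 := hgf 0
      rw [hf0] at h2
      rw [← h1, h2]
    let F : RP2 → RP2 := Projectivization.lift (fun v => pt ⟨f v, hne v v.2⟩) (by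
      rintro ⟨a, ha⟩ ⟨b, hb⟩ t (rfl : a = t • b)
      have ht : t ≠ 0 := by rintro rfl; simp at ha
      refine (Projectivization.mk_eq_mk_iff' ℝ _ _ (hne _ ha) (hne _ hb)).2 ⟨t, ?_⟩
      exact (hfs t b ht).symm)
    refine ⟨F, ?_, ?_⟩
    · refine continuous_coinduced_dom.2 ?_
      have : F ∘ pt = pt ∘ fun v : NonzeroE3 => ⟨f v, hne v v.2⟩ := rfl
      rw [this]
      exact continuous_pt.comp (Continuous.subtype_mk (hf.comp continuous_subtype_val) _)
    · rintro v P ⟨hv, rfl⟩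
      exact ⟨hne v hv, rfl⟩
  obtain ⟨F, hF, hF'⟩ := key f g hf hgf hfg hfs
  obtain ⟨G, hG, hG'⟩ := key g f hg hfg hgf hgs
  refine ⟨⟨⟨F, G, fun P => ?_, fun P => ?_⟩, hF, hG⟩, hF'⟩
  · obtain ⟨v, hv⟩ := exists_reps P
    exact Reps.unique (hgf v ▸ hG' _ _ (hF' _ _ hv)) hv
  · obtain ⟨v, hv⟩ := exists_reps P
    exact Reps.unique (hfg v ▸ hF' _ _ (hG' _ _ hv)) hv

/-- The piecewise linear bump function that moves the apex of a kite. -/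
noncomputable def bump (ε m c : ℝ) : ℝ := max 0 (min (m + ε * c) (m + c / ε))

theorem bump_nonneg (ε m c : ℝ) : 0 ≤ bump ε m c := le_max_left _ _

theorem bump_pos_iff {ε m c : ℝ} : 0 < bump ε m c ↔ 0 < m + ε * c ∧ 0 < m + c / ε := by
  simp [bump]

theorem bump_eq_zero {ε m c : ℝ} (h : ¬ 0 < bump ε m c) : bump ε m c = 0 :=
  le_antisymm (not_lt.1 h) (bump_nonneg _ _ _)

theorem bump_smul {ε m c k : ℝ} (hk : 0 ≤ k) : bump ε (k * m) (k * c) = k * bump ε m c := by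
  rw [bump, bump, mul_max_of_nonneg _ _ hk, mul_min_of_nonneg _ _ hk]
  ring_nf

theorem bump_pos_swap {ε m c : ℝ} (hε : 0 < ε) (h : 0 < bump ε m c) : 0 < bump ε c m := by
  rw [bump_pos_iff] at h ⊢
  have h1 : m + c / ε = (c + ε * m) / ε := by field_simp; ring
  have h2 : c + m / ε = (m + ε * c) / ε := by field_simp; ring
  rw [h1] at h
  rw [h2]
  exact ⟨(div_pos_iff_of_pos_right hε).1 h.2, div_pos h.1 hε⟩

/-- The maps `(m, c) ↦ (m - τ, c + τ)` and `(m, c) ↦ (m + σ, c - σ)` with `τ = bump ε m c` and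
`σ = bump ε c m` are inverse to each other. -/
theorem bump_move {ε m c : ℝ} (hε : 0 < ε) (hε1 : ε < 1) (h : 0 < bump ε m c) :
    bump ε (c + bump ε m c) (m - bump ε m c) = bump ε m c := by
  have hp := bump_pos_iff.1 h
  have hi : 1 < ε⁻¹ := (one_lt_inv₀ hε).2 hε1
  have hε' : ε * ε⁻¹ = 1 := mul_inv_cancel₀ hε.ne'
  rcases le_total 0 c with hc | hc
  · have e : bump ε m c = m + ε * c := by
      rw [bump, min_eq_left, max_eq_right hp.1.le]
      rw [div_eq_mul_inv]; nlinarith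
    rw [e, bump, min_eq_right, max_eq_right]
    · field_simp; ring
    · have : c + (m + ε * c) + (m - (m + ε * c)) / ε = m + ε * c := by field_simp; ring
      rw [this]; exact hp.1.le
    · have : c + (m + ε * c) + (m - (m + ε * c)) / ε = m + ε * c := by field_simp; ring
      rw [this]
      have : ε * (ε * c) ≤ c := by nlinarith [mul_nonneg hε.le hc]
      linarith
  · have e : bump ε m c = m + c / ε := by
      rw [bump, min_eq_right, max_eq_right hp.2.le]
      rw [div_eq_mul_inv]; nlinarith
    have e2 : ε * (m - (m + c / ε)) = - c := by field_simp; ring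
    rw [e, bump, e2, min_eq_left, max_eq_right]
    · ring
    · linarith [hp.2]
    · have : (m - (m + c / ε)) / ε = (-c) * (ε⁻¹ * ε⁻¹) := by field_simp; ring
      rw [this]
      have : 1 ≤ ε⁻¹ * ε⁻¹ := by nlinarith
      nlinarith

/-- A map that translates the points of two opposite regions, by a bump function, along `w` and
`-w`, is inverted by the map of the same kind for the bump function of the image. -/
theorem translate_inverse {E : Type*} [AddCommGroup E] [Module ℝ E] (τ σ : E → ℝ) (w : E)
    (hτ : ∀ x, 0 ≤ τ x) (hσ : ∀ x, 0 ≤ σ x) (h1 : ∀ x, 0 < τ x → σ (x + τ x • w) = τ x)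
    (h2 : ∀ x, 0 < τ x → ¬ 0 < τ (-x)) (h3 : ∀ x, 0 < σ x → ¬ 0 < σ (-x))
    (h4 : ∀ x, 0 < σ x → 0 < τ x) (x : E) :
    (x + (τ x - τ (-x)) • w) - (σ (x + (τ x - τ (-x)) • w) - σ (-(x + (τ x - τ (-x)) • w))) • w
      = x := by
  have z : ∀ {ρ : E → ℝ} {y : E}, (∀ x, 0 ≤ ρ x) → ¬ 0 < ρ y → ρ y = 0 :=
    fun h h' => le_antisymm (not_lt.1 h') (h _)
  by_cases hx : 0 < τ x
  · have e1 := z hτ (h2 x hx)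
    rw [e1, sub_zero, h1 x hx]
    have : ¬ 0 < σ (-(x + τ x • w)) := h3 _ (by rwa [h1 x hx])
    rw [z hσ this]
    simp
  · rw [z hτ hx]
    by_cases hx' : 0 < τ (-x)
    · have e : -(x + (0 - τ (-x)) • w) = -x + τ (-x) • w := by module
      have e' : x + (0 - τ (-x)) • w = -(-x + τ (-x) • w) := by module
      rw [e, h1 _ hx', e']
      have : ¬ 0 < σ (-(-x + τ (-x) • w)) := h3 _ (by rwa [h1 _ hx'])
      rw [z hσ this]
      module
    · rw [z hτ hx']
      have e1 : σ x = 0 := z hσ fun h => hx (h4 _ h)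
      have e2 : σ (-x) = 0 := z hσ fun h => hx' (h4 _ h)
      simp [e1, e2]

/-- The elementary move: a homeomorphism of the projective plane, supported in a thin kite around
the triangle `p q r`, that carries the side `p q` to the union of the other two sides. -/
theorem exists_kite_homeomorph {p q r : E3} {α β γ : E3 →ₗ[ℝ] ℝ}
    (hα : α p = 1 ∧ α q = 0 ∧ α r = 0) (hβ : β p = 0 ∧ β q = 1 ∧ β r = 0)
    (hγ : γ p = 0 ∧ γ q = 0 ∧ γ r = 1) {ε : ℝ} (hε : 0 < ε) (hε1 : ε < 1) :
    ∃ H : RP2 ≃ₜ RP2, H '' seg p q = seg p r ∪ seg r q ∧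
      ∀ P, (∀ v, Reps v P → ¬ (0 < α v + ε * γ v ∧ 0 < β v + ε * γ v ∧
        0 < ε * α v + γ v ∧ 0 < ε * β v + γ v)) → H P = P := by
  -- Points move along the lines through `r - p - q`, the direction from the side `p q` to `r`. The
  -- displacement is odd, so that it descends to the projective plane: `τ` is supported in the cone
  -- over the kite, and `x ↦ τ (-x)` in the opposite cone.
  set w : E3 := r - p - q with hw
  have hαw : α w = -1 := by simp [hw, hα]
  have hβw : β w = -1 := by simp [hw, hβ]
  have hγw : γ w = 1 := by simp [hw, hγ]
  set μ : E3 → ℝ := fun x => min (α x) (β x) with hμ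
  have hμw : ∀ x (k : ℝ), μ (x + k • w) = μ x - k := fun x k => by
    simp only [hμ, map_add, map_smul, hαw, hβw, smul_eq_mul, mul_neg, mul_one]
    rw [min_add_add_right]; ring
  have hγw' : ∀ x (k : ℝ), γ (x + k • w) = γ x + k := fun x k => by simp [hγw]
  have hμn : ∀ x, μ x + μ (-x) ≤ 0 := fun x => by
    have h1 := min_le_left (α x) (β x)
    have h2 := min_le_left (α (-x)) (β (-x))
    have h3 : α (-x) = - α x := map_neg α x
    simp only [hμ]
    linarith
  set τ : E3 → ℝ := fun x => bump ε (μ x) (γ x) with hτ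
  set σ : E3 → ℝ := fun x => bump ε (γ x) (μ x) with hσ
  have hτn : ∀ x, 0 < τ x → ¬ 0 < τ (-x) := fun x h h' => by
    have h1 := (bump_pos_iff.1 h).1
    have h2 := (bump_pos_iff.1 h').1
    have := hμn x
    rw [map_neg γ x] at h2
    linarith
  have hτσ : ∀ x, 0 < τ x → 0 < σ x := fun x h => bump_pos_swap hε h
  have hστ : ∀ x, 0 < σ x → 0 < τ x := fun x h => bump_pos_swap hε h
  have hσn : ∀ x, 0 < σ x → ¬ 0 < σ (-x) := fun x h h' => hτn x (hστ x h) (hστ _ h')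
  have hτ_cont : Continuous τ := by simp only [hτ, bump]; fun_prop
  have hσ_cont : Continuous σ := by simp only [hσ, bump]; fun_prop
  have hμs : ∀ (k : ℝ) x, 0 ≤ k → μ (k • x) = k * μ x := fun k x hk => by
    simp [hμ, mul_min_of_nonneg _ _ hk]
  have hτs : ∀ (k : ℝ) x, 0 ≤ k → τ (k • x) = k * τ x := fun k x hk => by
    simp [hτ, hμs k x hk, bump_smul hk]
  have hσs : ∀ (k : ℝ) x, 0 ≤ k → σ (k • x) = k * σ x := fun k x hk => by
    simp [hσ, hμs k x hk, bump_smul hk]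
  have odd : ∀ ρ : E3 → ℝ, (∀ (k : ℝ) x, 0 ≤ k → ρ (k • x) = k * ρ x) → ∀ (k : ℝ) x,
      ρ (k • x) - ρ (-(k • x)) = k * (ρ x - ρ (-x)) := fun ρ h k x => by
    rcases le_total 0 k with hk | hk
    · rw [← smul_neg, h k x hk, h k _ hk]; ring
    · have e : k • x = (-k) • (-x) := by module
      have e' : -(k • x) = (-k) • x := by module
      rw [e', e, h _ _ (neg_nonneg.2 hk), h _ _ (neg_nonneg.2 hk)]; ring
  set f : E3 → E3 := fun x => x + (τ x - τ (-x)) • w with hf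
  set g : E3 → E3 := fun x => x - (σ x - σ (-x)) • w with hg
  have hgf : ∀ x, g (f x) = x := fun x =>
    translate_inverse τ σ w (fun _ => bump_nonneg _ _ _) (fun _ => bump_nonneg _ _ _)
      (fun x h => by simp only [hσ, hμw, hγw']; exact bump_move hε hε1 h) hτn hσn hστ x
  have hfg : ∀ x, f (g x) = x := fun x => by
    have := translate_inverse σ τ (-w) (fun _ => bump_nonneg _ _ _) (fun _ => bump_nonneg _ _ _)
      (fun x h => by
        rw [smul_neg, ← neg_smul]
        simp only [hτ, hμw, hγw', sub_neg_eq_add, ← sub_eq_add_neg]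
        exact bump_move hε hε1 h) hσn hτn hτσ x
    simpa [hf, hg, sub_eq_add_neg] using this
  obtain ⟨H, hH⟩ := exists_homeomorph_of_homogeneous f g (by fun_prop) (by fun_prop) hgf hfg
    (fun c x _ => by simp only [hf]; rw [odd τ hτs c x]; module)
    (fun c x _ => by simp only [hg]; rw [odd σ hσs c x]; module)
  -- a point of the side `p q` moves by the smaller one of its coordinates, onto the other two sides
  have hside : ∀ a b : ℝ, 0 ≤ a → 0 ≤ b →
      f (a • p + b • q) = a • p + b • q + (min a b) • w := fun a b ha hb => by
    have e1 : τ (a • p + b • q) = min a b := by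
      simp [hτ, hμ, hα, hβ, hγ, bump, ha, hb]
    have e2 : τ (-(a • p + b • q)) = 0 := by
      apply bump_eq_zero
      rw [bump_pos_iff]
      rintro ⟨h, -⟩
      have := min_le_left (α (-(a • p + b • q))) (β (-(a • p + b • q)))
      simp [hμ, hα, hβ, hγ] at h
      linarith
    simp only [hf]
    rw [e1, e2, sub_zero]
  refine ⟨H, ?_, fun P hP => ?_⟩
  · apply Subset.antisymm
    · rintro _ ⟨P, ⟨a, b, ha, hb, hP⟩, rfl⟩
      have := hH _ _ hP
      rw [hside a b ha hb] at this
      rcases le_total a b with h | h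
      · right
        refine ⟨a, b - a, ha, sub_nonneg.2 h, ?_⟩
        convert this using 1
        rw [min_eq_left h, hw]; module
      · left
        refine ⟨a - b, b, sub_nonneg.2 h, hb, ?_⟩
        convert this using 1
        rw [min_eq_right h, hw]; module
    · have back : ∀ a b c : ℝ, 0 ≤ a → 0 ≤ b → 0 ≤ c → (a = 0 ∨ b = 0) → ∀ P : RP2,
          Reps (a • p + b • q + c • r) P → P ∈ H '' seg p q := by
        intro a b c ha hb hc hab P hP
        have e : f ((a + c) • p + (b + c) • q) = a • p + b • q + c • r := by
          rw [hside _ _ (add_nonneg ha hc) (add_nonneg hb hc)]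
          have : min (a + c) (b + c) = c := by
            rcases hab with rfl | rfl <;> simp [ha, hb]
          rw [this, hw]; module
        have hne : (a + c) • p + (b + c) • q ≠ 0 := by
          intro h0
          rw [h0] at e
          have : f 0 = 0 := by simpa using hside 0 0 le_rfl le_rfl
          exact hP.ne_zero (e ▸ this)
        refine ⟨_, ⟨_, _, add_nonneg ha hc, add_nonneg hb hc, reps_mk hne⟩, ?_⟩
        have := hH _ _ (reps_mk hne)
        rw [e] at this
        exact this.unique hP
      rintro P (⟨a, c, ha, hc, hP⟩ | ⟨c, b, hc, hb, hP⟩)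
      · exact back a 0 c ha le_rfl hc (Or.inr rfl) P (by convert hP using 1; module)
      · exact back 0 b c le_rfl hb hc (Or.inl rfl) P (by convert hP using 1; module)
  · obtain ⟨v, hvP⟩ := exists_reps P
    have key : ∀ v, Reps v P → τ v = 0 := fun v h => by
      refine bump_eq_zero fun h0 => hP v h ?_
      have h1 := bump_pos_iff.1 h0
      have h2 := bump_pos_iff.1 (bump_pos_swap hε h0)
      have := min_le_left (α v) (β v)
      have := min_le_right (α v) (β v)
      simp only [hμ] at h1 h2
      refine ⟨by linarith [h1.1], by linarith [h1.1], ?_, ?_⟩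
      · nlinarith [h2.1]
      · nlinarith [h2.1]
    have h1 := key v hvP
    have h2 := key (-v) (by simpa using hvP.smul (c := -1) (by norm_num))
    have := hH v P hvP
    simp only [hf, h1, h2, sub_self, zero_smul, add_zero] at this
    exact this.unique hvP

/-! ### Polygonal sets and thin neighbourhoods of triangles -/

/-- A polygonal set: a finite union of segments, which may degenerate to points. -/
inductive Poly : Set RP2 → Prop
  | empty : Poly ∅
  | side (x y : E3) (h : ∀ s t : ℝ, 0 ≤ s → 0 ≤ t → s • x + t • y = 0 → s = 0 ∧ t = 0) :
      Poly (seg x y)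
  | union (A B : Set RP2) : Poly A → Poly B → Poly (A ∪ B)

theorem Indep2.poly_seg {x y : E3} (h : Indep2 x y) : Poly (seg x y) :=
  Poly.side x y fun s t _ _ e => h s t e

theorem poly_pnt (x : E3) : Poly (pnt x) := by
  by_cases hx : x = 0
  · have : pnt x = ∅ := eq_empty_of_forall_notMem fun P h => h.ne_zero hx
    rw [this]; exact Poly.empty
  · rw [← seg_self]
    refine Poly.side x x fun s t hs ht e => ?_
    rw [← add_smul, smul_eq_zero] at e
    have := e.resolve_right hx
    constructor <;> linarith

theorem poly_biUnion {ι : Type*} {s : Set ι} (hs : s.Finite) {A : ι → Set RP2}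
    (h : ∀ i ∈ s, Poly (A i)) : Poly (⋃ i ∈ s, A i) := by
  induction s, hs using Set.Finite.induction_on with
  | empty => simpa using Poly.empty
  | @insert a s _ _ ih =>
    rw [biUnion_insert]
    exact Poly.union _ _ (h a (mem_insert a s)) (ih fun i hi => h i (mem_insert_of_mem a hi))

/-- Compactness of the unit interval for families that depend on a small positive parameter. -/
theorem eventually_forall_Icc {Q : ℝ → ℝ → Prop}
    (h : ∀ s ∈ Icc (0 : ℝ) 1, ∀ᶠ z : ℝ × ℝ in 𝓝 (0, s), 0 < z.1 → z.2 ∈ Icc (0 : ℝ) 1 → Q z.1 z.2) :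
    ∀ᶠ ε in 𝓝[>] (0 : ℝ), ∀ s ∈ Icc (0 : ℝ) 1, Q ε s := by
  have := isCompact_Icc.eventually_forall_of_forall_eventually
    (P := fun ε s => 0 < ε → s ∈ Icc (0 : ℝ) 1 → Q ε s) h
  rw [eventually_nhdsWithin_iff]
  filter_upwards [this] with ε h1 h2 s hs
  exact h1 s hs h2 hs

theorem eventually_mul_lt {a b : ℝ} (hb : b ≠ 0) : ∀ᶠ ε in 𝓝 (0 : ℝ), ε * |a| < |b| := by
  have : Tendsto (fun ε : ℝ => ε * |a|) (𝓝 0) (𝓝 (0 * |a|)) := tendsto_id.mul_const _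
  rw [zero_mul] at this
  exact this.eventually (gt_mem_nhds (abs_pos.2 hb))

theorem eventually_of_neg {F : ℝ × ℝ → ℝ} (hF : Continuous F) {z : ℝ × ℝ} (h : F z < 0) :
    ∀ᶠ y in 𝓝 z, F y < 0 :=
  hF.continuousAt.eventually (gt_mem_nhds h)

/-- The analysis near a parameter at which a segment passes through a tip of the kite. -/
theorem eventually_kite_tip {a0 a1 b0 b1 c0 c1 s : ℝ} (ha : 0 < a0 + s * a1)
    (hb : b0 + s * b1 = 0) (hc : c0 + s * c1 = 0)
    (H : ∀ s ∈ Icc (0 : ℝ) 1, 0 ≤ a0 + s * a1 → 0 ≤ b0 + s * b1 → 0 ≤ c0 + s * c1 →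
      c0 + s * c1 = 0 ∧ (a0 + s * a1 = 0 ∨ b0 + s * b1 = 0)) :
    ∀ᶠ z : ℝ × ℝ in 𝓝 (0, s), 0 < z.1 → z.2 ∈ Icc (0 : ℝ) 1 →
      ¬ (0 < b0 + z.2 * b1 + z.1 * (c0 + z.2 * c1) ∧
        0 < z.1 * (b0 + z.2 * b1) + (c0 + z.2 * c1)) := by
  have hfst : Tendsto (Prod.fst : ℝ × ℝ → ℝ) (𝓝 (0, s)) (𝓝 0) := continuous_fst.tendsto _
  have e1 : ∀ᶠ z : ℝ × ℝ in 𝓝 (0, s), b1 ≠ 0 → z.1 * |c1| < |b1| := by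
    by_cases h : b1 = 0
    · simp [h]
    · filter_upwards [hfst.eventually (eventually_mul_lt (a := c1) h)] with z hz _ using hz
  have e2 : ∀ᶠ z : ℝ × ℝ in 𝓝 (0, s), c1 ≠ 0 → z.1 * |b1| < |c1| := by
    by_cases h : c1 = 0
    · simp [h]
    · filter_upwards [hfst.eventually (eventually_mul_lt (a := b1) h)] with z hz _ using hz
  have e3 : ∀ᶠ z : ℝ × ℝ in 𝓝 (0, s), -(a0 + z.2 * a1) < 0 :=
    eventually_of_neg (by fun_prop) (neg_neg_of_pos ha)
  filter_upwards [e1, e2, e3] with z h1 h2 h3 hz hs ⟨h4, h5⟩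
  set ε := z.1
  set t := z.2 - s with ht
  have eb : b0 + z.2 * b1 = t * b1 := by rw [ht]; linear_combination hb
  have ec : c0 + z.2 * c1 = t * c1 := by rw [ht]; linear_combination hc
  have h6 := H z.2 hs (by linarith)
  rw [eb, ec] at h4 h5 h6
  have key : ∀ x y : ℝ, t * x < 0 → 0 < t * x + ε * (t * y) → |x| ≤ ε * |y| := by
    intro x y hx hy
    have htp : 0 < |t| := abs_pos.2 fun h => by simp [h] at hx
    have h7 : |t| * |x| = -(t * x) := by rw [← abs_mul, abs_of_neg hx]
    have h8 : t * y ≤ |t| * |y| := by rw [← abs_mul]; exact le_abs_self _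
    refine le_of_mul_le_mul_left ?_ htp
    nlinarith
  rcases lt_or_ge (t * b1) 0 with hb' | hb'
  · have hb1 : b1 ≠ 0 := by rintro rfl; simp at hb'
    exact absurd (key _ _ hb' h4) (not_le.2 (h1 hb1))
  · rcases lt_or_ge (t * c1) 0 with hc' | hc'
    · have hc1 : c1 ≠ 0 := by rintro rfl; simp at hc'
      exact absurd (key _ _ hc' (by linarith)) (not_le.2 (h2 hc1))
    · obtain ⟨h7, h8⟩ := h6 hb' hc'
      rcases h8 with h8 | h8
      · linarith
      · rw [h7, h8] at h4; simp at h4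

/-- A segment, given by its coordinates, that meets a triangle at most in the end points of one
side avoids all thin kites around the triangle with tips at these end points. -/
theorem eventually_kite {a0 a1 b0 b1 c0 c1 : ℝ}
    (hne : ∀ s ∈ Icc (0 : ℝ) 1, ¬ (a0 + s * a1 = 0 ∧ b0 + s * b1 = 0 ∧ c0 + s * c1 = 0))
    (H : ∀ s ∈ Icc (0 : ℝ) 1, 0 ≤ a0 + s * a1 → 0 ≤ b0 + s * b1 → 0 ≤ c0 + s * c1 →
      c0 + s * c1 = 0 ∧ (a0 + s * a1 = 0 ∨ b0 + s * b1 = 0)) :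
    ∀ᶠ ε in 𝓝[>] (0 : ℝ), ∀ s ∈ Icc (0 : ℝ) 1,
      ¬ (0 < a0 + s * a1 + ε * (c0 + s * c1) ∧ 0 < b0 + s * b1 + ε * (c0 + s * c1) ∧
        0 < ε * (a0 + s * a1) + (c0 + s * c1) ∧ 0 < ε * (b0 + s * b1) + (c0 + s * c1)) := by
  refine eventually_forall_Icc fun s hs => ?_
  rcases lt_or_ge (a0 + s * a1) 0 with ha | ha
  · have := eventually_of_neg (F := fun z => a0 + z.2 * a1 + z.1 * (c0 + z.2 * c1)) (by fun_prop)
      (z := (0, s)) (by simpa using ha)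
    filter_upwards [this] with z hz _ _ h
    exact lt_asymm hz h.1
  rcases lt_or_ge (b0 + s * b1) 0 with hb | hb
  · have := eventually_of_neg (F := fun z => b0 + z.2 * b1 + z.1 * (c0 + z.2 * c1)) (by fun_prop)
      (z := (0, s)) (by simpa using hb)
    filter_upwards [this] with z hz _ _ h
    exact lt_asymm hz h.2.1
  rcases lt_or_ge (c0 + s * c1) 0 with hc | hc
  · have := eventually_of_neg (F := fun z => z.1 * (a0 + z.2 * a1) + (c0 + z.2 * c1)) (by fun_prop)
      (z := (0, s)) (by simpa using hc)
    filter_upwards [this] with z hz _ _ h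
    exact lt_asymm hz h.2.2.1
  obtain ⟨hc0, h | h⟩ := H s hs ha hb hc
  · have hb' : 0 < b0 + s * b1 := lt_of_le_of_ne hb fun h' => hne s hs ⟨h, h'.symm, hc0⟩
    have := eventually_kite_tip (a0 := b0) (a1 := b1) hb' h hc0 fun s hs h1 h2 h3 =>
      ⟨(H s hs h2 h1 h3).1, (H s hs h2 h1 h3).2.symm⟩
    filter_upwards [this] with z hz h1 h2 h3
    exact hz h1 h2 ⟨h3.1, h3.2.2.1⟩
  · have ha' : 0 < a0 + s * a1 := lt_of_le_of_ne ha fun h' => hne s hs ⟨h'.symm, h, hc0⟩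
    have := eventually_kite_tip (a0 := a0) (a1 := a1) ha' h hc0 H
    filter_upwards [this] with z hz h1 h2 h3
    exact hz h1 h2 ⟨h3.2.1, h3.2.2.2⟩

/-- A segment, given by its coordinates, that meets a side of a triangle at most in one end point
also meets all thin triangles on this side at most there. -/
theorem eventually_thin {a0 a1 b0 b1 c0 c1 : ℝ}
    (H : ∀ s ∈ Icc (0 : ℝ) 1, 0 ≤ a0 + s * a1 → 0 ≤ b0 + s * b1 → c0 + s * c1 = 0 →
      b0 + s * b1 = 0) :
    ∀ᶠ δ in 𝓝[>] (0 : ℝ), ∀ s ∈ Icc (0 : ℝ) 1,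
      0 ≤ a0 + s * a1 → 0 ≤ c0 + s * c1 → c0 + s * c1 ≤ δ * (b0 + s * b1) →
        b0 + s * b1 = 0 ∧ c0 + s * c1 = 0 := by
  refine eventually_forall_Icc fun s hs => ?_
  rcases lt_or_ge (a0 + s * a1) 0 with ha | ha
  · have := eventually_of_neg (F := fun z => a0 + z.2 * a1) (by fun_prop) (z := (0, s)) ha
    filter_upwards [this] with z hz _ _ h
    exact absurd h (not_le.2 hz)
  rcases lt_or_ge (b0 + s * b1) 0 with hb | hb
  · have := eventually_of_neg (F := fun z => b0 + z.2 * b1) (by fun_prop) (z := (0, s)) hb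
    filter_upwards [this] with z hz h0 _ _ h1 h2
    nlinarith
  rcases lt_trichotomy (c0 + s * c1) 0 with hc | hc | hc
  · have := eventually_of_neg (F := fun z => c0 + z.2 * c1) (by fun_prop) (z := (0, s)) hc
    filter_upwards [this] with z hz _ _ _ h
    exact absurd h (not_le.2 hz)
  · have hb0 := H s hs ha hb hc
    have hfst : Tendsto (Prod.fst : ℝ × ℝ → ℝ) (𝓝 (0, s)) (𝓝 0) := continuous_fst.tendsto _
    have e1 : ∀ᶠ z : ℝ × ℝ in 𝓝 (0, s), c1 ≠ 0 → z.1 * |b1| < |c1| := by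
      by_cases h : c1 = 0
      · simp [h]
      · filter_upwards [hfst.eventually (eventually_mul_lt (a := b1) h)] with z hz _ using hz
    filter_upwards [e1] with z h1 hz hs' h2 h3 h4
    set δ := z.1
    set t := z.2 - s with ht
    have eb : b0 + z.2 * b1 = t * b1 := by rw [ht]; linear_combination hb0
    have ec : c0 + z.2 * c1 = t * c1 := by rw [ht]; linear_combination hc
    by_cases hc1 : c1 = 0
    · have hc2 : c0 + z.2 * c1 = 0 := by rw [ec, hc1, mul_zero]
      refine ⟨H z.2 hs' h2 ?_ hc2, hc2⟩
      rw [hc2] at h4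
      exact nonneg_of_mul_nonneg_right h4 hz
    · rw [eb, ec] at h4 ⊢
      rw [ec] at h3
      have h5 : |t| * |c1| = t * c1 := by rw [← abs_mul, abs_of_nonneg h3]
      have h6 : t * b1 ≤ |t| * |b1| := by rw [← abs_mul]; exact le_abs_self _
      have h8 := h1 hc1
      have ht0 : t = 0 := by
        by_contra h
        have := abs_pos.2 h
        nlinarith
      simp [ht0]
  · have := eventually_of_neg (F := fun z => z.1 * (b0 + z.2 * b1) - (c0 + z.2 * c1)) (by fun_prop)
      (z := (0, s)) (by simp only [zero_mul]; linarith)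
    filter_upwards [this] with z hz _ _ _ _ h
    linarith

/-- A spanning vector of a point of a segment can be normalised to a convex combination, up to the
sign and a positive factor. -/
theorem exists_convex_of_mem_seg {x y v : E3} {P : RP2} (hP : P ∈ seg x y) (hv : Reps v P) :
    ∃ s ∈ Icc (0 : ℝ) 1, ∃ k : ℝ, k ≠ 0 ∧ v = k • ((1 - s) • x + s • y) := by
  obtain ⟨a, b, ha, hb, h⟩ := hP
  obtain ⟨c, hc, rfl⟩ := h.exists_smul hv
  have hab : 0 < a + b := by
    rcases ha.lt_or_eq with h1 | rfl
    · linarith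
    rcases hb.lt_or_eq with h1 | rfl
    · linarith
    exact absurd (by simp) h.ne_zero
  refine ⟨b / (a + b), ⟨by positivity, ?_⟩, c * (a + b), mul_ne_zero hc hab.ne', ?_⟩
  · rw [div_le_one hab]; linarith
  · have h1 : 1 - b / (a + b) = a / (a + b) := by field_simp; ring
    rw [h1, mul_smul, smul_add (a + b), smul_smul (a + b), smul_smul (a + b),
      mul_div_cancel₀ _ hab.ne', mul_div_cancel₀ _ hab.ne']

/-- A polygonal set that meets a triangle at most in the end points of one side is disjoint from
the interior of all sufficiently thin kites with tips at these end points. -/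
theorem Poly.eventually_kite {F : Set RP2} (hF : Poly F) {p q r : E3} {α β γ : E3 →ₗ[ℝ] ℝ}
    (hv : ∀ v, v = α v • p + β v • q + γ v • r)
    (hα : α p = 1 ∧ α q = 0 ∧ α r = 0) (hβ : β p = 0 ∧ β q = 1 ∧ β r = 0)
    (hγ : γ p = 0 ∧ γ q = 0 ∧ γ r = 1) (hFT : F ∩ tri p q r ⊆ pnt p ∪ pnt q) :
    ∀ᶠ ε in 𝓝[>] (0 : ℝ), ∀ P ∈ F, ∀ v, Reps v P →
      ¬ (0 < α v + ε * γ v ∧ 0 < β v + ε * γ v ∧ 0 < ε * α v + γ v ∧ 0 < ε * β v + γ v) := by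
  induction hF with
  | empty => simp
  | union A B _ _ hA hB =>
    filter_upwards [hA fun P h => hFT ⟨Or.inl h.1, h.2⟩, hB fun P h => hFT ⟨Or.inr h.1, h.2⟩]
      with ε h1 h2 P hP
    exact hP.elim (h1 P) (h2 P)
  | side x y hxy =>
    have main : ∀ σ : ℝ, σ ≠ 0 → ∀ᶠ ε in 𝓝[>] (0 : ℝ), ∀ s ∈ Icc (0 : ℝ) 1,
      ¬ (0 < σ * α x + s * (σ * α y - σ * α x) + ε * (σ * γ x + s * (σ * γ y - σ * γ x)) ∧
        0 < σ * β x + s * (σ * β y - σ * β x) + ε * (σ * γ x + s * (σ * γ y - σ * γ x)) ∧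
        0 < ε * (σ * α x + s * (σ * α y - σ * α x)) + (σ * γ x + s * (σ * γ y - σ * γ x)) ∧
        0 < ε * (σ * β x + s * (σ * β y - σ * β x)) + (σ * γ x + s * (σ * γ y - σ * γ x))) := by
      intro σ hσ
      have hne : ∀ s ∈ Icc (0 : ℝ) 1, (1 - s) • x + s • y ≠ 0 := fun s hs h => by
        have := hxy _ _ (sub_nonneg.2 hs.2) hs.1 h
        linarith
      have ev : ∀ (φ : E3 →ₗ[ℝ] ℝ) (s : ℝ), σ * φ x + s * (σ * φ y - σ * φ x) =
          φ (σ • ((1 - s) • x + s • y)) := fun φ s => by simp; ring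
      refine ProjPlanar.eventually_kite (fun s hs h => ?_) (fun s hs h1 h2 h3 => ?_)
      · rw [ev, ev, ev] at h
        refine smul_ne_zero hσ (hne s hs) ?_
        rw [hv (σ • _), h.1, h.2.1, h.2.2]; simp
      · rw [ev] at h1 h2 h3
        rw [ev, ev, ev]
        have hr : Reps (σ • ((1 - s) • x + s • y)) (Projectivization.mk ℝ _ (hne s hs)) :=
          (reps_mk (hne s hs)).smul hσ
        have hmem := hFT ⟨⟨1 - s, s, sub_nonneg.2 hs.2, hs.1, reps_mk (hne s hs)⟩,
          (mem_tri_iff hv hα hβ hγ).2 ⟨_, hr, h1, h2, h3⟩⟩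
        rcases hmem with h | h
        · obtain ⟨c, _, e⟩ := h.exists_smul hr
          rw [e]; simp [hγ, hβ]
        · obtain ⟨c, _, e⟩ := h.exists_smul hr
          rw [e]; simp [hγ, hα]
    filter_upwards [main 1 one_ne_zero, main (-1) (by norm_num)] with ε h1 h2 P hP v hvP h
    obtain ⟨s, hs, k, hk, rfl⟩ := exists_convex_of_mem_seg hP hvP
    have ev : ∀ (σ : ℝ) (φ : E3 →ₗ[ℝ] ℝ), σ * φ x + s * (σ * φ y - σ * φ x) =
          σ * φ ((1 - s) • x + s • y) := fun σ φ => by simp; ring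
    have h1 := h1 s hs
    have h2 := h2 s hs
    rw [ev, ev, ev] at h1 h2
    simp only [map_smul, smul_eq_mul] at h
    generalize α ((1 - s) • x + s • y) = A at *
    generalize β ((1 - s) • x + s • y) = B at *
    generalize γ ((1 - s) • x + s • y) = C at *
    have pull : ∀ m u : ℝ, 0 < m → 0 < m * u → 0 < u := fun m u hm h =>
      (pos_iff_pos_of_mul_pos h).1 hm
    rcases lt_or_gt_of_ne hk with hk | hk
    · apply h2
      refine ⟨pull (-k) _ (by linarith) ?_, pull (-k) _ (by linarith) ?_,
        pull (-k) _ (by linarith) ?_, pull (-k) _ (by linarith) ?_⟩ <;> linarith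
    · apply h1
      refine ⟨pull k _ hk ?_, pull k _ hk ?_, pull k _ hk ?_, pull k _ hk ?_⟩ <;> linarith

/-- The elementary move across a triangle that meets the polygonal set `F` at most in the end
points of one side: a homeomorphism that fixes `F` and carries this side to the other two. -/
theorem Indep3.exists_move {p q r : E3} (h : Indep3 p q r) {F : Set RP2} (hF : Poly F)
    (hFT : F ∩ tri p q r ⊆ pnt p ∪ pnt q) :
    ∃ H : RP2 ≃ₜ RP2, H '' seg p q = seg p r ∪ seg r q ∧ ∀ P ∈ F, H P = P := by
  obtain ⟨α, β, γ, hv, hα, hβ, hγ⟩ := h.exists_coord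
  have h1 : ∀ᶠ ε in 𝓝[>] (0 : ℝ), 0 < ε ∧ ε < 1 := Ioo_mem_nhdsGT one_pos
  obtain ⟨ε, hε, h0, h1⟩ := ((hF.eventually_kite hv hα hβ hγ hFT).and h1).exists
  obtain ⟨H, hH, hfix⟩ := exists_kite_homeomorph hα hβ hγ h0 h1
  exact ⟨H, hH, fun P hP => hfix P (hε P hP)⟩

/-- A polygonal set that meets the segment `p x` at most in `p` meets thin triangles on this
segment at most in `p`. -/
theorem Poly.eventually_thin {F : Set RP2} (hF : Poly F) {p x w : E3} (h : Indep3 p x w)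
    (hFs : F ∩ seg p x ⊆ pnt p) :
    ∀ᶠ δ in 𝓝[>] (0 : ℝ), F ∩ tri p x (x + δ • w) ⊆ pnt p := by
  obtain ⟨α, β, γ, hv, hα, hβ, hγ⟩ := h.exists_coord
  have key : ∀ᶠ δ in 𝓝[>] (0 : ℝ), ∀ P ∈ F, ∀ v, Reps v P →
      0 ≤ α v → 0 ≤ γ v → γ v ≤ δ * β v → P ∈ pnt p := by
    induction hF with
    | empty => simp
    | union A B _ _ hA hB =>
      filter_upwards [hA fun P h => hFs ⟨Or.inl h.1, h.2⟩, hB fun P h => hFs ⟨Or.inr h.1, h.2⟩]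
        with ε h1 h2 P hP
      exact hP.elim (h1 P) (h2 P)
    | side y z hyz =>
      have hne : ∀ s ∈ Icc (0 : ℝ) 1, (1 - s) • y + s • z ≠ 0 := fun s hs h => by
        have := hyz _ _ (sub_nonneg.2 hs.2) hs.1 h
        linarith
      have main : ∀ σ : ℝ, σ ≠ 0 → ∀ᶠ δ in 𝓝[>] (0 : ℝ), ∀ s ∈ Icc (0 : ℝ) 1,
          0 ≤ σ * α y + s * (σ * α z - σ * α y) → 0 ≤ σ * γ y + s * (σ * γ z - σ * γ y) →
          σ * γ y + s * (σ * γ z - σ * γ y) ≤ δ * (σ * β y + s * (σ * β z - σ * β y)) →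
          σ * β y + s * (σ * β z - σ * β y) = 0 ∧ σ * γ y + s * (σ * γ z - σ * γ y) = 0 := by
        intro σ hσ
        have ev : ∀ (φ : E3 →ₗ[ℝ] ℝ) (s : ℝ), σ * φ y + s * (σ * φ z - σ * φ y) =
            φ (σ • ((1 - s) • y + s • z)) := fun φ s => by simp; ring
        refine ProjPlanar.eventually_thin (fun s hs h1 h2 h3 => ?_)
        rw [ev] at h1 h2 h3
        rw [ev]
        have hr : Reps (σ • ((1 - s) • y + s • z)) (Projectivization.mk ℝ _ (hne s hs)) :=
          (reps_mk (hne s hs)).smul hσ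
        have hmem := hFs ⟨⟨1 - s, s, sub_nonneg.2 hs.2, hs.1, reps_mk (hne s hs)⟩,
          ⟨_, _, h1, h2, by
            have := hv (σ • ((1 - s) • y + s • z))
            rw [h3, zero_smul, add_zero] at this
            rwa [← this]⟩⟩
        obtain ⟨c, _, e⟩ := Reps.exists_smul hmem hr
        rw [e]; simp [hβ]
      filter_upwards [main 1 one_ne_zero, main (-1) (by norm_num)] with δ h1 h2 P hP v hvP ha hc hcb
      obtain ⟨s, hs, k, hk, rfl⟩ := exists_convex_of_mem_seg hP hvP
      have ev : ∀ (σ : ℝ) (φ : E3 →ₗ[ℝ] ℝ), σ * φ y + s * (σ * φ z - σ * φ y) =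
          σ * φ ((1 - s) • y + s • z) := fun σ φ => by simp; ring
      have h1 := h1 s hs
      have h2 := h2 s hs
      rw [ev, ev, ev] at h1 h2
      simp only [map_smul, smul_eq_mul] at ha hc hcb
      have fin : β ((1 - s) • y + s • z) = 0 → γ ((1 - s) • y + s • z) = 0 → P ∈ pnt p := by
        intro hb0 hc0
        have e := hv ((1 - s) • y + s • z)
        rw [hb0, hc0, zero_smul, zero_smul, add_zero, add_zero] at e
        have h0 : α ((1 - s) • y + s • z) ≠ 0 := fun h0 => hne s hs (by rw [e, h0, zero_smul])
        have := hvP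
        rw [e, smul_smul] at this
        rw [← pnt_smul p (mul_ne_zero hk h0)]
        exact this
      generalize α ((1 - s) • y + s • z) = A at *
      generalize β ((1 - s) • y + s • z) = B at *
      generalize γ ((1 - s) • y + s • z) = C at *
      rcases lt_or_gt_of_ne hk with hk | hk
      · have := h2 (by nlinarith) (by nlinarith) (by nlinarith)
        exact fin (by linarith) (by linarith)
      · have := h1 (by nlinarith) (by nlinarith) (by nlinarith)
        exact fin (by linarith) (by linarith)
  filter_upwards [key, self_mem_nhdsWithin] with δ hδ (h0 : 0 < δ)
  rintro P ⟨hP, s, t, u, hs, ht, hu, hr⟩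
  refine hδ P hP _ hr ?_ ?_ ?_
  · simp [hα, hs]
  · simpa [hγ] using mul_nonneg hu h0.le
  · simp only [map_add, map_smul, smul_eq_mul, hβ, hγ]
    nlinarith [mul_nonneg h0.le ht]

/-- A segment that leaves `x` in a direction outside the sector from `p` to `w` meets thin
triangles in this sector only in `x`. -/
theorem eventually_thin_ray {p x w d : E3} (h : Indep3 p x w)
    (hd : ∀ a b c : ℝ, 0 ≤ a → 0 ≤ c → d ≠ a • p + b • x + c • w)
    (hs : seg x d ∩ seg p x ⊆ pnt x) :
    ∀ᶠ δ in 𝓝[>] (0 : ℝ), seg x d ∩ tri p x (x + δ • w) ⊆ pnt x := by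
  obtain ⟨α, β, γ, hv, hα, hβ, hγ⟩ := h.exists_coord
  have hd' : ¬ (0 ≤ α d ∧ 0 ≤ γ d) := fun h => hd _ _ _ h.1 h.2 (hv d)
  have e1 : ∀ᶠ δ in 𝓝[>] (0 : ℝ), γ d ≠ 0 → δ * |β d| < |γ d| := by
    by_cases h : γ d = 0
    · simp [h]
    · filter_upwards [nhdsWithin_le_nhds (eventually_mul_lt (a := β d) h)] with δ hδ _ using hδ
  filter_upwards [e1, self_mem_nhdsWithin] with δ hδ (h0 : 0 < δ)
  rintro P ⟨⟨s, t, hs0, ht0, hr⟩, a, b, c, ha, hb, hc, hr'⟩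
  obtain ⟨k, hk, e⟩ := hr.exists_smul hr'
  have ea := congrArg α e
  have eb := congrArg β e
  have ec := congrArg γ e
  simp [hα, hβ, hγ] at ea eb ec
  rcases ht0.lt_or_eq with ht | rfl
  · rcases lt_or_gt_of_ne hk with hk | hk
    · have hα0 : α d ≤ 0 := by
        by_contra h; push Not at h
        have := mul_pos ht h
        nlinarith
      have hγ0 : γ d ≤ 0 := by
        by_contra h; push Not at h
        have := mul_pos ht h
        have := mul_nonneg hc h0.le
        nlinarith
      have hβ0 : t * β d ≤ 0 := by nlinarith
      rcases hγ0.lt_or_eq with hγ1 | hγ1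
      · exfalso
        have h1 := hδ hγ1.ne
        have hβ1 : β d ≤ 0 := by nlinarith
        rw [abs_of_neg hγ1, abs_of_nonpos hβ1] at h1
        have h3 : k * (t * γ d) ≤ (k * t) * (δ * β d) := by
          have : δ * (k * s) ≤ 0 := by nlinarith [mul_nonneg h0.le hs0]
          nlinarith
        have h4 : k * t < 0 := mul_neg_of_neg_of_pos hk ht
        nlinarith
      · refine hs ⟨⟨s, t, hs0, ht0, hr⟩, a, b + c, ha, by linarith, ?_⟩
        have hc0 : c = 0 := by
          rw [hγ1, mul_zero, mul_zero] at ec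
          exact (mul_eq_zero.1 ec).resolve_right h0.ne'
        subst hc0
        convert hr' using 1
        module
    · exfalso
      refine hd' ⟨?_, ?_⟩
      · by_contra h; push Not at h
        have := mul_neg_of_pos_of_neg ht h
        nlinarith
      · by_contra h; push Not at h
        have := mul_neg_of_pos_of_neg ht h
        have := mul_nonneg hc h0.le
        nlinarith
  · rw [zero_smul, add_zero] at hr
    have : s ≠ 0 := fun h => hr.ne_zero (by rw [h, zero_smul])
    rw [← pnt_smul x this]
    exact hr

/-- Thin triangles at `x` in two adjacent sectors meet only in their common side. -/
theorem eventually_thin_inter {y x z w : E3} (h : Indep3 y x w) (h' : Indep3 z x w)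
    (hz : ∀ a b c : ℝ, 0 ≤ a → 0 ≤ c → z ≠ a • y + b • x + c • w)
    (hy : ∀ a b c : ℝ, 0 ≤ a → 0 ≤ c → y ≠ a • z + b • x + c • w)
    (hs : seg y x ∩ seg x z ⊆ pnt x) :
    ∀ᶠ δ in 𝓝[>] (0 : ℝ), tri y x (x + δ • w) ∩ tri z x (x + δ • w) ⊆ seg x (x + δ • w) := by
  obtain ⟨α, β, γ, hv, hα, hβ, hγ⟩ := h.exists_coord
  have e1 : ∀ᶠ δ in 𝓝[>] (0 : ℝ), γ z ≠ 0 → δ * |β z| < |γ z| := by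
    by_cases h : γ z = 0
    · simp [h]
    · filter_upwards [nhdsWithin_le_nhds (eventually_mul_lt (a := β z) h)] with δ hδ _ using hδ
  have hz' := hv z
  filter_upwards [e1, self_mem_nhdsWithin] with δ hδ (h0 : 0 < δ)
  rintro P ⟨⟨a, b, g, ha, hb, hg, hr⟩, c, e, f, hc, he, hf, hr'⟩
  obtain ⟨k, hk, eq⟩ := hr.exists_smul hr'
  have ea := congrArg α eq
  have eb := congrArg β eq
  have ec := congrArg γ eq
  simp [hα, hβ, hγ] at ea eb ec
  rcases hc.lt_or_eq with hc | rfl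
  · exfalso
    rcases lt_or_gt_of_ne hk with hk | hk
    · have hη : α z ≤ 0 := by
        by_contra h; push Not at h
        nlinarith [mul_pos hc h]
      have hω1 : c * γ z = (k * g - f) * δ := by linear_combination ec
      have hkg : k * g - f ≤ 0 := by nlinarith
      have hω : γ z ≤ 0 := by
        by_contra h; push Not at h
        nlinarith [mul_pos hc h]
      have hξ : c * β z ≤ k * g - f := by nlinarith
      rcases hω.lt_or_eq with hω2 | hω2
      · have h1 := hδ hω2.ne
        have h2 : c * (δ * β z) ≤ c * γ z := by nlinarith
        have h3 : δ * β z ≤ γ z := le_of_mul_le_mul_left h2 hc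
        rw [abs_of_neg hω2] at h1
        have h4 := neg_abs_le (β z)
        nlinarith
      · have hkg0 : k * g - f = 0 := by
          rw [hω2, mul_zero] at hω1
          exact (mul_eq_zero.1 hω1.symm).resolve_right h0.ne'
        have hβz : β z ≤ 0 := by nlinarith
        have hz0 : z ≠ 0 := by
          intro h
          have := h' 1 0 0 (by simp [h])
          simp at this
        rw [hω2, zero_smul, add_zero] at hz'
        have hmem := hs ⟨⟨-α z, -β z, by linarith, by linarith, by
          have := (reps_mk hz0).smul (c := -1) (by norm_num)
          convert this using 1
          conv_rhs => rw [hz']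
          module⟩, pnt_subset_seg_right x z (reps_mk hz0)⟩
        obtain ⟨m, hm, e⟩ := Reps.exists_smul hmem (reps_mk hz0)
        have := h' 1 (-m) 0 (by rw [e]; module)
        simp at this
    · have hη : 0 ≤ α z := by
        by_contra h; push Not at h
        nlinarith [mul_neg_of_pos_of_neg hc h]
      rcases le_or_gt 0 (γ z) with hω | hω
      · exact hz _ _ _ hη hω hz'
      · rcases hη.lt_or_eq with hη | hη
        · refine hy (α z)⁻¹ (-(α z)⁻¹ * β z) (-(α z)⁻¹ * γ z) (by positivity) ?_ ?_
          · have := inv_pos.2 hη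
            nlinarith
          · have key : ∀ a b c : ℝ, a ≠ 0 → z = a • y + b • x + c • w →
                y = a⁻¹ • z + (-a⁻¹ * b) • x + (-a⁻¹ * c) • w := fun a b c h0 e => by
              rw [e, smul_add, smul_add, smul_smul, inv_mul_cancel₀ h0]
              module
            exact key _ _ _ hη.ne' hz'
        · rw [← hη] at hz'
          have := h' 1 (-β z) (-γ z) (by rw [hz']; simp [hβ, hγ])
          simp at this
  · have ha0 : a = 0 := by
      rw [zero_mul] at ea
      exact (mul_eq_zero.1 ea.symm).resolve_left hk
    subst ha0
    exact ⟨b, g, hb, hg, by convert hr using 1; module⟩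

/-- Between two of three distinct directions `y`, `z`, `d` at `x`, on the side away from `d`, there
is a direction `w` that splits this side into two convex sectors. -/
theorem exists_between {x y z d : E3} (hy : Indep2 y x) (hz : Indep2 z x) (hd : Indep2 d x)
    (hyz : ∀ a b : ℝ, 0 ≤ a → z ≠ a • y + b • x)
    (hyd : ∀ a b : ℝ, 0 ≤ a → d ≠ a • y + b • x)
    (hzd : ∀ a b : ℝ, 0 ≤ a → d ≠ a • z + b • x) :
    ∃ w, Indep3 y x w ∧ Indep3 z x w ∧
      (∀ a b c : ℝ, 0 ≤ a → 0 ≤ c → d ≠ a • y + b • x + c • w) ∧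
      (∀ a b c : ℝ, 0 ≤ a → 0 ≤ c → d ≠ a • z + b • x + c • w) ∧
      (∀ a b c : ℝ, 0 ≤ a → 0 ≤ c → z ≠ a • y + b • x + c • w) ∧
      (∀ a b c : ℝ, 0 ≤ a → 0 ≤ c → y ≠ a • z + b • x + c • w) := by
  -- If the convex sector from `y` to `z` exists and avoids `d`, its bisector is taken; in all
  -- other cases the direction opposite to `d` lies between `y` and `z` on the right side.
  rcases hy.indep3_or z with h | ⟨a, b, rfl⟩
  · obtain ⟨α, β, γ, hv, hα, hβ, hγ⟩ := h.exists_coord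
    have hd' := hv d
    by_cases hc : 0 ≤ α d ∧ 0 ≤ γ d
    · have hα0 : 0 < α d := by
        refine lt_of_le_of_ne hc.1 fun h0 => hzd (γ d) (β d) hc.2 ?_
        rw [← h0] at hd'; conv_lhs => rw [hd']
        module
      have hγ0 : 0 < γ d := by
        refine lt_of_le_of_ne hc.2 fun h0 => hyd (α d) (β d) hc.1 ?_
        rw [← h0] at hd'; conv_lhs => rw [hd']
        module
      refine ⟨-d, fun s t u e => ?_, fun s t u e => ?_, fun a b c h1 h2 e => ?_,
        fun a b c h1 h2 e => ?_, fun a b c h1 h2 e => ?_, fun a b c h1 h2 e => ?_⟩ <;>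
      · have ea := congrArg α e
        have eb := congrArg β e
        have ec := congrArg γ e
        simp [hα, hβ, hγ] at ea eb ec
        first
        | (have hu : u = 0 := by
            first
            | exact ec.resolve_right hγ0.ne'
            | exact ea.resolve_right hα0.ne'
           subst hu
           simp at ea eb ec
           exact ⟨by assumption, by assumption, rfl⟩)
        | nlinarith
    · refine ⟨y + z, fun s t u e => ?_, fun s t u e => ?_, fun a b c h1 h2 e => hc ?_,
        fun a b c h1 h2 e => hc ?_, fun a b c h1 h2 e => ?_, fun a b c h1 h2 e => ?_⟩ <;>
      · have ea := congrArg α e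
        have eb := congrArg β e
        have ec := congrArg γ e
        simp [hα, hβ, hγ] at ea eb ec
        first
        | (refine ⟨?_, ?_, ?_⟩ <;> linarith)
        | (constructor <;> linarith)
        | linarith
  · have ha : a < 0 := by
      by_contra h
      exact hyz a b (not_lt.1 h) rfl
    have h : Indep3 y x d := by
      refine (hy.indep3_or d).resolve_right ?_
      rintro ⟨a', b', rfl⟩
      rcases le_or_gt 0 a' with h | h
      · exact hyd _ _ h rfl
      · refine hzd (a' / a) (b' - a' / a * b) (div_nonneg_of_nonpos h.le ha.le) ?_
        have : a' = a' / a * a := (div_mul_cancel₀ a' ha.ne).symm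
        conv_lhs => rw [this]
        module
    obtain ⟨α, β, γ, hv, hα, hβ, hγ⟩ := h.exists_coord
    refine ⟨-d, fun s t u e => ?_, fun s t u e => ?_, fun a b c h1 h2 e => ?_,
      fun a b c h1 h2 e => ?_, fun a b c h1 h2 e => ?_, fun a b c h1 h2 e => ?_⟩ <;>
    · have ea := congrArg α e
      have eb := congrArg β e
      have ec := congrArg γ e
      simp [hα, hβ, hγ] at ea eb ec
      first
      | (have hs : s = 0 := ea.resolve_right ha.ne
         subst hs
         simp at eb
         exact ⟨rfl, eb, ec⟩)
      | exact ⟨ea, eb, ec⟩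
      | (subst ec; nlinarith)
      | nlinarith

/-! ### Polygonal arcs and moves -/

/-- A simple polygonal chain of segments, with its two end vectors; it may consist of a single
point. -/
inductive Arc : Set RP2 → E3 → E3 → Prop
  | nil (x : E3) (hx : x ≠ 0) : Arc (pnt x) x x
  | cons (r p : E3) (A : Set RP2) (q : E3) (h : Indep2 r p) (hA : Arc A p q)
      (hi : seg r p ∩ A ⊆ pnt p) : Arc (seg r p ∪ A) r q

theorem Arc.left_subset {A : Set RP2} {x q : E3} (h : Arc A x q) : pnt x ⊆ A := by
  cases h with
  | nil => exact Subset.rfl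
  | cons _ p A _ => exact (pnt_subset_seg_left x p).trans subset_union_left

theorem Arc.right_subset {A : Set RP2} {x q : E3} (h : Arc A x q) : pnt q ⊆ A := by
  induction h with
  | nil => exact Subset.rfl
  | cons _ _ _ _ _ _ _ ih => exact ih.trans subset_union_right

theorem Arc.poly {A : Set RP2} {x q : E3} (h : Arc A x q) : Poly A := by
  induction h with
  | nil x => exact poly_pnt x
  | cons _ _ _ _ h _ _ ih => exact Poly.union _ _ h.poly_seg ih

/-- `Moves F S T`: some homeomorphism of the projective plane that fixes `F` pointwise carries `S`
onto `T`. -/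
def Moves (F S T : Set RP2) : Prop := ∃ H : RP2 ≃ₜ RP2, H '' S = T ∧ ∀ P ∈ F, H P = P

theorem Moves.refl (F S : Set RP2) : Moves F S S :=
  ⟨Homeomorph.refl _, by simp, fun _ _ => rfl⟩

theorem Moves.symm {F S T : Set RP2} (h : Moves F S T) : Moves F T S := by
  obtain ⟨H, rfl, hf⟩ := h
  refine ⟨H.symm, by simp [← image_comp], fun P hP => ?_⟩
  rw [Homeomorph.symm_apply_eq, hf P hP]

theorem Moves.trans {F S T U : Set RP2} (h : Moves F S T) (h' : Moves F T U) : Moves F S U := by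
  obtain ⟨H, rfl, hf⟩ := h
  obtain ⟨K, rfl, kf⟩ := h'
  refine ⟨H.trans K, (image_comp K H S), fun P hP => ?_⟩
  rw [Homeomorph.trans_apply, hf P hP, kf P hP]

/-- A part `C` of the fixed set may be added to both sides of a move. -/
theorem Moves.frame {F G C S T S' T' : Set RP2} (h : Moves G S T) (hG : F ∪ C ⊆ G)
    (hS : S' = S ∪ C) (hT : T' = T ∪ C) : Moves F S' T' := by
  obtain ⟨H, rfl, hf⟩ := h
  refine ⟨H, ?_, fun P hP => hf P (hG (Or.inl hP))⟩
  rw [hS, hT, image_union]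
  congr 1
  have : EqOn H id C := fun P hP => hf P (hG (Or.inr hP))
  rw [this.image_eq, image_id]

theorem Moves.mono {F G S T : Set RP2} (h : Moves G S T) (hG : F ⊆ G) : Moves F S T :=
  h.frame (C := ∅) (by simpa using hG) (by simp) (by simp)

theorem Indep3.moves {p q r : E3} (h : Indep3 p q r) {F : Set RP2} (hF : Poly F)
    (hFT : ∀ P ∈ F, P ∈ tri p q r → P ∈ pnt p ∨ P ∈ pnt q) :
    Moves F (seg p q) (seg p r ∪ seg r q) :=
  h.exists_move hF fun P hP => hFT P hP.1 hP.2

theorem Indep3.seg_inter {x y z : E3} (h : Indep3 x y z) : seg x y ∩ seg y z ⊆ pnt y := by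
  rintro P ⟨⟨s, t, _, _, hr⟩, a, b, _, _, hr'⟩
  obtain ⟨k, hk, e⟩ := hr.exists_smul hr'
  have h1 := h (k * s) (k * t - a) (-b) (by
    have e' : k • (s • x + t • y) - (a • y + b • z) = 0 := by rw [e, sub_self]
    rw [← e']; module)
  have hs : s = 0 := (mul_eq_zero.1 h1.1).resolve_left hk
  subst hs
  rw [zero_smul, zero_add] at hr
  have : t ≠ 0 := by rintro rfl; exact hr.ne_zero (zero_smul _ _)
  rw [← pnt_smul y this]
  exact hr

theorem Indep3.notMem_seg {x y z : E3} (h : Indep3 x y z) {P : RP2} (hz : P ∈ pnt z)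
    (hs : P ∈ seg x y) : False := by
  obtain ⟨s, t, _, _, hr⟩ := hs
  obtain ⟨k, hk, e⟩ := hr.exists_smul hz
  have := h (k * s) (k * t) (-1) (by rw [e]; module)
  simp at this

theorem Indep2.notMem {x y : E3} (h : Indep2 x y) {P : RP2} (hx : P ∈ pnt x) (hy : P ∈ pnt y) :
    False :=
  Set.disjoint_left.1 h.disjoint hx hy

/-- Segments at `x` that meet only in `x` have different directions. -/
theorem Indep2.ne_of_seg_inter {x y z : E3} (hz : Indep2 z x) (h : seg y x ∩ seg x z ⊆ pnt x)
    (a b : ℝ) (ha : 0 ≤ a) : z ≠ a • y + b • x := by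
  intro e
  have hne : z + |b| • x ≠ 0 := fun h0 => by
    have := hz 1 |b| (by rwa [one_smul])
    simp at this
  have := h ⟨⟨a, b + |b|, ha, by linarith [neg_abs_le b], by
    convert reps_mk hne using 1; rw [e]; module⟩, |b|, 1, abs_nonneg b, zero_le_one, by
    convert reps_mk hne using 1; rw [one_smul, add_comm]⟩
  obtain ⟨c, _, e'⟩ := Reps.exists_smul this (reps_mk hne)
  have := hz 1 (|b| - c) (by
    have : z + |b| • x - c • x = 0 := by rw [e', sub_self]
    rw [← this]; module)
  simp at this

/-! ### Sliding an arc -/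

/-- The situation in which the path that runs along the segment `y x` and then along the arc `A`
from `x` to `q` can be pushed off to one side: the set `F`, which has to be avoided, touches the
path at most in its end points, and a further segment `x d` attached at `x` determines the side. -/
structure SlideData (A : Set RP2) (x q y d : E3) (F : Set RP2) : Prop where
  indep_y : Indep2 y x
  inter_y : seg y x ∩ A ⊆ pnt x
  poly : Poly F
  F_y : F ∩ seg y x ⊆ pnt y ∪ pnt q
  F_A : F ∩ A ⊆ pnt q
  indep_d : Indep2 d x
  d_y : seg x d ∩ seg y x ⊆ pnt x
  d_A : seg x d ∩ A ⊆ pnt x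

/-- The arc `E` from `y` to `q` runs parallel to the segment `y x` followed by the arc `A`, on the
side away from `d`. The path can be pushed onto `E`, and `A ∪ E` can be collapsed onto `y x`; the
latter move sweeps over `q`, but can be chosen to fix any part of `F` and `x d` without `q`. -/
structure Parallel (A : Set RP2) (x q y d : E3) (F E : Set RP2) : Prop where
  arc : Arc E y q
  E_F : E ∩ F ⊆ pnt y ∪ pnt q
  E_d : E ∩ seg x d ⊆ pnt q
  E_A : E ∩ A ⊆ pnt q
  push : Moves F (seg y x ∪ A) E
  collapse : ∀ F₀, Poly F₀ → F₀ ⊆ F ∪ seg x d → F₀ ∩ pnt q ⊆ pnt x → Moves F₀ (A ∪ E) (seg y x)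

/-- The arc `seg y t ∪ E` from `y` to `q` runs parallel to the segment `y x` followed by the arc `A`
of positive length. The three arcs `seg y x`, `A` and `seg y t ∪ E` bound a disk, so that two of
them can be moved onto the third one, and all of them into a geodesic triangle. -/
structure StrictParallel (A : Set RP2) (x q y d : E3) (F : Set RP2) (t : E3) (E : Set RP2) :
    Prop where
  indep_t : Indep2 y t
  arc : Arc E t q
  inter_t : seg y t ∩ E ⊆ pnt t
  t_q : Disjoint (pnt t) (pnt q)
  E_F : (seg y t ∪ E) ∩ F ⊆ pnt y ∪ pnt q
  E_d : Disjoint (seg y t ∪ E) (seg x d)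
  E_A : (seg y t ∪ E) ∩ A ⊆ pnt q
  E_y : (seg y t ∪ E) ∩ seg y x ⊆ pnt y
  push : Moves F (seg y x ∪ A) (seg y t ∪ E)
  collapse : ∀ F₀, Poly F₀ → F₀ ⊆ F ∪ seg x d → F₀ ∩ pnt q ⊆ pnt x →
    Moves F₀ (A ∪ (seg y t ∪ E)) (seg y x)
  pull : ∀ F₀, Poly F₀ → F₀ ⊆ F ∪ seg x d → Disjoint F₀ (pnt y) →
    Moves F₀ (seg y x ∪ (seg y t ∪ E)) A
  shrink : ∀ F₀, Poly F₀ → F₀ ⊆ F → Disjoint F₀ (pnt y) → Disjoint F₀ (pnt q) →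
    ∃ a b c : E3, Indep3 a b c ∧ Disjoint F₀ (tri a b c) ∧
      ∃ T ⊆ tri a b c, Moves F₀ (seg y x ∪ A ∪ (seg y t ∪ E)) T

theorem StrictParallel.parallel {A : Set RP2} {x q y d : E3} {F : Set RP2} {t : E3} {E : Set RP2}
    (h : StrictParallel A x q y d F t E) : Parallel A x q y d F (seg y t ∪ E) where
  arc := Arc.cons _ _ _ _ h.indep_t h.arc h.inter_t
  E_F := h.E_F
  E_d := fun _ hP => absurd hP.2 (Set.disjoint_left.1 h.E_d hP.1)
  E_A := h.E_A
  push := h.push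
  collapse := h.collapse

/-- If the arc `A` is a point, the segment `y x` itself serves as its parallel. -/
theorem SlideData.parallel_nil {x y d : E3} {F : Set RP2} (hx : x ≠ 0)
    (h : SlideData (pnt x) x x y d F) : Parallel (pnt x) x x y d F (seg y x) := by
  have e : seg y x ∪ pnt x = seg y x := union_eq_left.2 (pnt_subset_seg_right y x)
  refine ⟨?_, ?_, ?_, inter_subset_right, ?_, fun F₀ _ _ _ => ?_⟩
  · have := Arc.cons y x _ _ h.indep_y (Arc.nil x hx) inter_subset_right
    rwa [e] at this
  · rw [inter_comm]; exact h.F_y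
  · rw [inter_comm]; exact h.d_y
  · rw [e]; exact Moves.refl _ _
  · rw [union_comm, e]; exact Moves.refl _ _

/-- The main step: the pushed off path turns around `x` inside two thin triangles `y x t` and
`z x t`, and runs parallel to the rest of the arc from `t` on. -/
theorem SlideData.step {x z q y d : E3} {A F : Set RP2} (hxz : Indep2 x z) (hA : Arc A z q)
    (hi : seg x z ∩ A ⊆ pnt z) (h : SlideData (seg x z ∪ A) x q y d F)
    (ih : ∀ {y d F}, SlideData A z q y d F → ∃ E, Parallel A z q y d F E) :
    ∃ t E, StrictParallel (seg x z ∪ A) x q y d F t E := by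
  have hyx := h.indep_y
  have hdx := h.indep_d
  have qA : ∀ P ∈ pnt q, P ∈ A := fun P hP => hA.right_subset hP
  have xA : ∀ P ∈ pnt x, P ∉ A := fun P hP hPA =>
    hxz.notMem hP (hi ⟨pnt_subset_seg_left x z hP, hPA⟩)
  have iyz : seg y x ∩ seg x z ⊆ pnt x := fun P hP => h.inter_y ⟨hP.1, Or.inl hP.2⟩
  have yA : ∀ P ∈ seg y x, P ∉ A := fun P hP hPA => xA P (h.inter_y ⟨hP, Or.inr hPA⟩) hPA
  -- the direction of the turn at `x`
  obtain ⟨w, hyw, hzw, hdyw, hdzw, hzyw, hyzw⟩ := exists_between hyx hxz.symm hdx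
    (hxz.symm.ne_of_seg_inter iyz)
    (hdx.ne_of_seg_inter (by rw [inter_comm]; exact h.d_y))
    (hdx.ne_of_seg_inter (by
      rw [seg_symm z x, inter_comm]; exact fun P hP => h.d_A ⟨hP.1, Or.inl hP.2⟩))
  have FT1 : F ∩ seg y x ⊆ pnt y := fun P hP =>
    (h.F_y hP).resolve_right fun hq => yA P hP.2 (qA P hq)
  have FT2 : F ∩ seg z x ⊆ pnt z := fun P hP => by
    rw [seg_symm] at hP
    exact hi ⟨hP.2, qA P (h.F_A ⟨hP.1, Or.inl hP.2⟩)⟩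
  have ev := (((h.poly.eventually_thin hyw FT1).and (h.poly.eventually_thin hzw FT2)).and
    ((hA.poly.eventually_thin hyw fun P hP => absurd hP.1 (yA P hP.2)).and
      (hA.poly.eventually_thin hzw fun P hP => by
        rw [inter_comm, seg_symm] at hP; exact hi hP))).and
    (((eventually_thin_ray hyw hdyw h.d_y).and
      (eventually_thin_ray hzw hdzw fun P hP => h.d_A ⟨hP.1, Or.inl (by
        rw [seg_symm]; exact hP.2)⟩)).and
      ((eventually_thin_inter hyw hzw hzyw hyzw iyz).and
        (self_mem_nhdsWithin : ∀ᶠ δ in 𝓝[>] (0 : ℝ), 0 < δ)))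
  obtain ⟨δ, ⟨⟨F1, F2⟩, A1, A2⟩, ⟨d1, d2⟩, T12, hδ⟩ := ev.exists
  have lift3 : ∀ {u : E3}, Indep3 u x w → Indep3 u x (x + δ • w) := fun hu a b c e => by
    have := hu a (b + c) (c * δ) (by rw [← e]; module)
    have hc : c = 0 := (mul_eq_zero.1 this.2.2).resolve_right hδ.ne'
    subst hc
    simpa using this
  have iy := lift3 hyw
  have iz := lift3 hzw
  set t : E3 := x + δ • w with ht
  clear_value t
  clear FT1 FT2 hdyw hdzw hzyw hyzw hyw hzw lift3 ht
  -- the sides of the two triangles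
  have s1 : seg y x ⊆ tri y x t := seg_subset_tri y x t
  have s2 : seg y t ⊆ tri y x t := seg_subset_tri_outer y x t
  have s3 : seg x t ⊆ tri y x t := seg_subset_tri_right y x t
  have r1 : seg x z ⊆ tri z x t := by rw [seg_symm]; exact seg_subset_tri z x t
  have r2 : seg t z ⊆ tri z x t := by rw [seg_symm]; exact seg_subset_tri_outer z x t
  have tT1 : ∀ P ∈ pnt t, P ∈ tri y x t := fun P hP => s2 (pnt_subset_seg_right y t hP)
  have iyxt : Indep3 y t x := iy.rotate.rotate.swap
  have ixtz : Indep3 x t z := iz.rotate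
  have iytz : Indep2 t z := ixtz.rotate.indep2
  have iyt : Indep2 y t := iyxt.indep2
  have hF1 : ∀ P ∈ F, P ∈ tri y x t → P ∈ pnt y := fun P h1 h2 => F1 ⟨h1, h2⟩
  have hF2 : ∀ P ∈ F, P ∈ tri z x t → P ∈ pnt z := fun P h1 h2 => F2 ⟨h1, h2⟩
  have hF2q : ∀ P ∈ F, P ∈ tri z x t → P ∈ pnt q := fun P h1 h2 =>
    h.F_A ⟨h1, Or.inl (pnt_subset_seg_right x z (hF2 P h1 h2))⟩
  have hA1 : ∀ P ∈ A, P ∉ tri y x t := fun P h1 h2 =>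
    yA P (pnt_subset_seg_left y x (A1 ⟨h1, h2⟩)) h1
  have hA2 : ∀ P ∈ A, P ∈ tri z x t → P ∈ pnt z := fun P h1 h2 => A2 ⟨h1, h2⟩
  have hd1 : ∀ P ∈ seg x d, P ∈ tri y x t → P ∈ pnt x := fun P h1 h2 => d1 ⟨h1, h2⟩
  have hd2 : ∀ P ∈ seg x d, P ∈ tri z x t → P ∈ pnt x := fun P h1 h2 => d2 ⟨h1, h2⟩
  have yt2 : ∀ P ∈ seg y t, P ∈ tri z x t → P ∈ pnt t := fun P h1 h2 =>
    iyxt.seg_inter ⟨h1, by rw [seg_symm]; exact T12 ⟨s2 h1, h2⟩⟩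
  have yx2 : ∀ P ∈ seg y x, P ∈ tri z x t → P ∈ pnt x := fun P h1 h2 =>
    iy.seg_inter ⟨h1, T12 ⟨s1 h1, h2⟩⟩
  have xz1 : ∀ P ∈ seg x z, P ∈ tri y x t → P ∈ pnt x := fun P h1 h2 =>
    iz.seg_inter ⟨by rwa [seg_symm], T12 ⟨h2, r1 h1⟩⟩
  have tz1 : ∀ P ∈ seg t z, P ∈ tri y x t → P ∈ pnt t := fun P h1 h2 =>
    ixtz.seg_inter ⟨T12 ⟨h2, r2 h1⟩, h1⟩
  -- the rest of the path
  have data : SlideData A z q t x (F ∪ (seg y t ∪ (seg x d ∪ seg y x))) := by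
    refine ⟨iytz, fun P hP => hA2 P hP.2 (r2 hP.1), Poly.union _ _ h.poly (Poly.union _ _
      iyt.poly_seg (Poly.union _ _ hdx.symm.poly_seg hyx.poly_seg)), ?_, ?_, hxz, ?_, ?_⟩
    · rintro P ⟨h1 | h1 | h1 | h1, h2⟩
      · exact Or.inr (hF2q P h1 (r2 h2))
      · exact Or.inl (yt2 P h1 (r2 h2))
      · exact (ixtz.rotate.notMem_seg (hd2 P h1 (r2 h2)) h2).elim
      · exact (ixtz.rotate.notMem_seg (yx2 P h1 (r2 h2)) h2).elim
    · rintro P ⟨h1 | h1 | h1 | h1, h2⟩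
      · exact h.F_A ⟨h1, Or.inr h2⟩
      · exact (hA1 P h2 (s2 h1)).elim
      · exact (xA P (h.d_A ⟨h1, Or.inr h2⟩) h2).elim
      · exact (hA1 P h2 (s1 h1)).elim
    · intro P hP
      rw [inter_comm] at hP
      exact iz.rotate.rotate.seg_inter hP
    · intro P hP
      rw [seg_symm] at hP
      exact hi hP
  obtain ⟨E, hE⟩ := ih data
  have tq : Disjoint (pnt t) (pnt q) := Set.disjoint_left.2 fun P h1 h2 =>
    hA1 P (qA P h2) (tT1 P h1)
  have qT1 : ∀ P ∈ pnt q, P ∉ tri y x t := fun P hP => hA1 P (qA P hP)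
  have tF : ∀ P ∈ pnt t, P ∉ F := fun P h1 h2 => iyt.notMem (hF1 P h2 (tT1 P h1)) h1
  have hEyt : seg y t ∩ E ⊆ pnt t := fun P hP =>
    (hE.E_F ⟨hP.2, Or.inr (Or.inl hP.1)⟩).resolve_right fun hq => qT1 P hq (s2 hP.1)
  -- the elementary moves across the two triangles
  have M1 : ∀ {G}, Poly G → (∀ P ∈ G, P ∈ tri y x t → P ∈ pnt y ∨ P ∈ pnt x) →
      Moves G (seg y x) (seg y t ∪ seg x t) := fun hG hT => by
    rw [seg_symm x t]; exact iy.moves hG hT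
  have M1' : ∀ {G}, Poly G → (∀ P ∈ G, P ∈ tri y x t → P ∈ pnt x ∨ P ∈ pnt t) →
      Moves G (seg x t) (seg y x ∪ seg y t) := fun hG hT => by
    rw [tri_rotate] at hT
    rw [seg_symm y x]; exact iy.rotate.moves hG hT
  have M2 : ∀ {G}, Poly G → (∀ P ∈ G, P ∈ tri z x t → P ∈ pnt t ∨ P ∈ pnt z) →
      Moves G (seg t z) (seg x t ∪ seg x z) := fun hG hT => by
    rw [← tri_rotate] at hT
    rw [seg_symm x t]; exact iz.rotate.rotate.moves hG hT
  have M2' : ∀ {G}, Poly G → (∀ P ∈ G, P ∈ tri z x t → P ∈ pnt x ∨ P ∈ pnt t) →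
      Moves G (seg x t) (seg x z ∪ seg t z) := fun hG hT => by
    rw [tri_rotate] at hT
    rw [seg_symm t z]; exact ixtz.moves hG hT
  have M2'' : ∀ {G}, Poly G → (∀ P ∈ G, P ∈ tri z x t → P ∈ pnt x ∨ P ∈ pnt z) →
      Moves G (seg x z) (seg x t ∪ seg t z) := fun hG hT => by
    rw [tri_swap] at hT
    exact iz.swap.moves hG hT
  have collapse' : ∀ F₀, Poly F₀ → F₀ ⊆ F ∪ seg x d → F₀ ∩ pnt q ⊆ pnt x → ∀ B, Poly B →
      B ⊆ seg y x → Moves (F₀ ∪ (seg x z ∪ (seg y t ∪ B))) (A ∪ E) (seg t z) := by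
    intro F₀ hF₀ hsub hq B hB hBs
    refine hE.collapse _ (Poly.union _ _ hF₀ (Poly.union _ _ hxz.poly_seg
      (Poly.union _ _ iyt.poly_seg hB))) ?_ ?_
    · rw [seg_symm z x]
      rintro P (h1 | h1 | h1 | h1)
      · rcases hsub h1 with h1 | h1
        · exact Or.inl (Or.inl h1)
        · exact Or.inl (Or.inr (Or.inr (Or.inl h1)))
      · exact Or.inr h1
      · exact Or.inl (Or.inr (Or.inl h1))
      · exact Or.inl (Or.inr (Or.inr (Or.inr (hBs h1))))
    · rintro P ⟨h1 | h1 | h1 | h1, h2⟩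
      · exact (xA P (hq ⟨h1, h2⟩) (qA P h2)).elim
      · exact hi ⟨h1, qA P h2⟩
      · exact (qT1 P h2 (s2 h1)).elim
      · exact (qT1 P h2 (s1 (hBs h1))).elim
  have square : ∀ F₀, Poly F₀ → F₀ ⊆ F ∪ seg x d → F₀ ∩ pnt q ⊆ pnt x → ∀ B, Poly B →
      B ⊆ seg y x → Moves (F₀ ∪ (seg y t ∪ B)) (seg t z ∪ seg x z) (seg x t) := by
    intro F₀ hF₀ hsub hq B hB hBs
    rw [union_comm (seg t z)]
    refine (M2' (Poly.union _ _ hF₀ (Poly.union _ _ iyt.poly_seg hB)) ?_).symm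
    rintro P (h1 | h1 | h1) h2
    · rcases hsub h1 with h3 | h3
      · have hPq := hF2q P h3 h2
        exact (xA P (hq ⟨h1, hPq⟩) (qA P hPq)).elim
      · exact Or.inl (hd2 P h3 h2)
    · exact Or.inr (yt2 P h1 h2)
    · exact Or.inl (yx2 P (hBs h1) h2)
  refine ⟨t, E, iyt, hE.arc, hEyt, tq, ?_, ?_, ?_, ?_, ?_, ?_, ?_, ?_⟩
  · rintro P ⟨h1 | h1, h2⟩
    · exact Or.inl (hF1 P h2 (s2 h1))
    · rcases hE.E_F ⟨h1, Or.inl h2⟩ with h3 | h3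
      · exact (tF P h3 h2).elim
      · exact Or.inr h3
  · rw [Set.disjoint_left]
    rintro P (h1 | h1) h2
    · exact iyxt.notMem_seg (hd1 P h2 (s2 h1)) h1
    · rcases hE.E_F ⟨h1, Or.inr (Or.inr (Or.inl h2))⟩ with h3 | h3
      · exact ixtz.indep2.notMem (hd1 P h2 (tT1 P h3)) h3
      · exact xA P (h.d_A ⟨h2, Or.inr (qA P h3)⟩) (qA P h3)
  · rintro P ⟨h1 | h1, h2 | h2⟩
    · exact (iyxt.notMem_seg (xz1 P h2 (s2 h1)) h1).elim
    · exact (hA1 P h2 (s2 h1)).elim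
    · exact hE.E_d ⟨h1, by rwa [seg_symm]⟩
    · exact hE.E_A ⟨h1, h2⟩
  · rintro P ⟨h1 | h1, h2⟩
    · have : Indep3 t y x := iyxt.swap
      exact this.seg_inter ⟨by rwa [seg_symm], h2⟩
    · rcases hE.E_F ⟨h1, Or.inr (Or.inr (Or.inr h2))⟩ with h3 | h3
      · exact (iy.notMem_seg h3 h2).elim
      · exact (qT1 P h3 (s1 h2)).elim
  · have k1 : Moves F (seg y x ∪ (seg x z ∪ A)) (seg y t ∪ seg x t ∪ (seg x z ∪ A)) := by
      refine (M1 (Poly.union F _ h.poly (Poly.union _ _ hxz.poly_seg hA.poly)) ?_).frame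
        Subset.rfl rfl rfl
      rintro P (h1 | h1 | h1) h2
      · exact Or.inl (hF1 P h1 h2)
      · exact Or.inr (xz1 P h1 h2)
      · exact (hA1 P h1 h2).elim
    have k2 : Moves F (seg y t ∪ seg x t ∪ (seg x z ∪ A)) (seg t z ∪ (seg y t ∪ A)) := by
      refine (M2 (Poly.union F _ h.poly (Poly.union _ _ iyt.poly_seg hA.poly)) ?_).symm.frame
        Subset.rfl (by ext P; simp only [mem_union]; tauto) rfl
      rintro P (h1 | h1 | h1) h2
      · exact Or.inr (hF2 P h1 h2)
      · exact Or.inl (yt2 P h1 h2)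
      · exact Or.inr (hA2 P h1 h2)
    have k3 : Moves F (seg t z ∪ (seg y t ∪ A)) (seg y t ∪ E) :=
      hE.push.frame (C := seg y t) (by intro P; simp only [mem_union]; tauto)
        (by ext P; simp only [mem_union]; tauto) (union_comm _ _)
    exact k1.trans (k2.trans k3)
  · intro F₀ hF₀ hsub hq
    have k1 : Moves F₀ (seg x z ∪ A ∪ (seg y t ∪ E)) (seg t z ∪ (seg x z ∪ seg y t)) := by
      refine (collapse' F₀ hF₀ hsub hq ∅ Poly.empty (empty_subset _)).frame
        (C := seg x z ∪ seg y t) (by intro P; simp only [mem_union]; tauto)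
        (by ext P; simp only [mem_union]; tauto) rfl
    have k2 : Moves F₀ (seg t z ∪ (seg x z ∪ seg y t)) (seg x t ∪ seg y t) :=
      (square F₀ hF₀ hsub hq ∅ Poly.empty (empty_subset _)).frame (C := seg y t)
        (by intro P; simp only [mem_union]; tauto)
        (by ext P; simp only [mem_union]; tauto) rfl
    have k3 : Moves F₀ (seg x t ∪ seg y t) (seg y x) := by
      rw [union_comm]
      refine (M1 hF₀ fun P h1 h2 => ?_).symm
      rcases hsub h1 with h3 | h3
      · exact Or.inl (hF1 P h3 h2)
      · exact Or.inr (hd1 P h3 h2)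
    exact k1.trans (k2.trans k3)
  · intro F₀ hF₀ hsub hy
    have hF0T1 : ∀ P ∈ F₀, P ∈ tri y x t → P ∈ pnt x := fun P h1 h2 => by
      rcases hsub h1 with h3 | h3
      · exact (Set.disjoint_left.1 hy h1 (hF1 P h3 h2)).elim
      · exact hd1 P h3 h2
    have k1 : Moves F₀ (seg y x ∪ (seg y t ∪ E)) (seg t z ∪ A ∪ (seg y x ∪ seg y t)) :=
      (hE.push.symm).frame (C := seg y x ∪ seg y t)
        (by
          rintro P (h1 | h1 | h1)
          · rcases hsub h1 with h1 | h1
            · exact Or.inl h1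
            · exact Or.inr (Or.inr (Or.inl h1))
          · exact Or.inr (Or.inr (Or.inr h1))
          · exact Or.inr (Or.inl h1))
        (by ext P; simp only [mem_union]; tauto) rfl
    have k2 : Moves F₀ (seg t z ∪ A ∪ (seg y x ∪ seg y t)) (seg x t ∪ (seg t z ∪ A)) := by
      refine (M1' (Poly.union _ _ hF₀ (Poly.union _ _ iytz.poly_seg hA.poly)) ?_).symm.frame
        Subset.rfl (union_comm _ _) rfl
      rintro P (h1 | h1 | h1) h2
      · exact Or.inl (hF0T1 P h1 h2)
      · exact Or.inr (tz1 P h1 h2)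
      · exact (hA1 P h1 h2).elim
    have k3 : Moves F₀ (seg x t ∪ (seg t z ∪ A)) (seg x z ∪ A) := by
      refine (M2'' (Poly.union _ _ hF₀ hA.poly) ?_).symm.frame
        Subset.rfl (union_assoc _ _ _).symm rfl
      rintro P (h1 | h1) h2
      · rcases hsub h1 with h3 | h3
        · exact Or.inr (hF2 P h3 h2)
        · exact Or.inl (hd2 P h3 h2)
      · exact Or.inr (hA2 P h1 h2)
    exact k1.trans (k2.trans k3)
  · intro F₀ hF₀ hsub hy hq
    have hsub' := hsub.trans (subset_union_left (t := seg x d))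
    have hq' : F₀ ∩ pnt q ⊆ pnt x := fun P hP => (Set.disjoint_left.1 hq hP.1 hP.2).elim
    refine ⟨y, x, t, iy, Set.disjoint_left.2 fun P h1 h2 =>
      Set.disjoint_left.1 hy h1 (hF1 P (hsub h1) h2), seg x t ∪ (seg y t ∪ seg y x),
      union_subset s3 (union_subset s2 s1), ?_⟩
    have k1 : Moves F₀ (seg y x ∪ (seg x z ∪ A) ∪ (seg y t ∪ E))
        (seg t z ∪ (seg x z ∪ seg y t ∪ seg y x)) :=
      (collapse' F₀ hF₀ hsub' hq' (seg y x) hyx.poly_seg Subset.rfl).frame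
        (C := seg x z ∪ seg y t ∪ seg y x) (by intro P; simp only [mem_union]; tauto)
        (by ext P; simp only [mem_union]; tauto) rfl
    have k2 : Moves F₀ (seg t z ∪ (seg x z ∪ seg y t ∪ seg y x))
        (seg x t ∪ (seg y t ∪ seg y x)) :=
      (square F₀ hF₀ hsub' hq' (seg y x) hyx.poly_seg Subset.rfl).frame (C := seg y t ∪ seg y x)
        (by intro P; simp only [mem_union]; tauto)
        (by ext P; simp only [mem_union]; tauto) rfl
    exact k1.trans k2

/-- By induction on the number of segments, a path can be pushed off to one side. -/
theorem Arc.exists_parallel {A : Set RP2} {x q : E3} (hA : Arc A x q) :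
    ∀ {y d F}, SlideData A x q y d F → ∃ E, Parallel A x q y d F E := by
  induction hA with
  | nil x hx => exact fun h => ⟨_, h.parallel_nil hx⟩
  | cons x z A q hxz hA hi ih =>
    intro y d F h
    obtain ⟨t, E, hE⟩ := h.step hxz hA hi ih
    exact ⟨_, hE.parallel⟩

/-! ### Operations on arcs -/

theorem Arc.smul {A : Set RP2} {x q : E3} (h : Arc A x q) {c : ℝ} (hc : c ≠ 0) :
    Arc A (c • x) (c • q) := by
  induction h with
  | nil x hx => rw [← pnt_smul x hc]; exact Arc.nil _ (smul_ne_zero hc hx)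
  | cons r p A q h _ hi ih =>
    rw [← seg_smul r p hc] at hi ⊢
    exact Arc.cons _ _ _ _ (h.smul hc) ih (by rwa [pnt_smul p hc])

theorem Arc.append {A B : Set RP2} {x q r : E3} (hA : Arc A x q) (hB : Arc B q r)
    (h : A ∩ B ⊆ pnt q) : Arc (A ∪ B) x r := by
  induction hA with
  | nil x hx => rwa [union_eq_right.2 hB.left_subset]
  | cons x z A q hxz hA hi ih =>
    rw [union_assoc]
    refine Arc.cons _ _ _ _ hxz (ih hB fun P hP => h ⟨Or.inr hP.1, hP.2⟩) ?_
    rintro P ⟨h1, h2 | h2⟩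
    · exact hi ⟨h1, h2⟩
    · exact hi ⟨h1, hA.right_subset (h ⟨Or.inl h1, h2⟩)⟩

theorem Indep2.arc_seg {x y : E3} (h : Indep2 x y) : Arc (seg x y) x y := by
  have := Arc.cons x y _ _ h (Arc.nil y h.symm.ne_zero) inter_subset_right
  rwa [union_eq_left.2 (pnt_subset_seg_right x y)] at this

theorem Arc.reverse {A : Set RP2} {x q : E3} (h : Arc A x q) : Arc A q x := by
  induction h with
  | nil x hx => exact Arc.nil x hx
  | cons x z A q hxz hA hi ih =>
    rw [union_comm, seg_symm]
    exact ih.append hxz.symm.arc_seg (by rwa [inter_comm, seg_symm])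

theorem Arc.exists_cons {A : Set RP2} {x q : E3} (h : Arc A x q)
    (hxq : Disjoint (pnt x) (pnt q)) :
    ∃ z B, A = seg x z ∪ B ∧ Indep2 x z ∧ Arc B z q ∧ seg x z ∩ B ⊆ pnt z := by
  cases h with
  | nil _ hx => exact (Set.disjoint_left.1 hxq (reps_mk hx) (reps_mk hx)).elim
  | cons _ z B _ hxz hB hi => exact ⟨z, B, rfl, hxz, hB, hi⟩

theorem seg_add (x y : E3) : seg x y = seg x (x + y) ∪ seg (x + y) y := by
  ext P
  constructor
  · rintro ⟨s, t, hs, ht, h⟩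
    rcases le_total s t with hst | hst
    · exact Or.inr ⟨s, t - s, hs, by linarith, by convert h using 1; module⟩
    · exact Or.inl ⟨s - t, t, by linarith, ht, by convert h using 1; module⟩
  · rintro (⟨s, t, hs, ht, h⟩ | ⟨s, t, hs, ht, h⟩)
    · exact ⟨s + t, t, by linarith, ht, by convert h using 1; module⟩
    · exact ⟨s, s + t, hs, by linarith, by convert h using 1; module⟩

/-- The first segment of an arc can be chosen not to be the whole arc. -/
theorem Arc.exists_cons_proper {A : Set RP2} {x q : E3} (h : Arc A x q)
    (hxq : Disjoint (pnt x) (pnt q)) :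
    ∃ z B, A = seg x z ∪ B ∧ Indep2 x z ∧ Arc B z q ∧ seg x z ∩ B ⊆ pnt z ∧
      Disjoint (pnt z) (pnt q) := by
  obtain ⟨z, B, rfl, hxz, hB, hi⟩ := h.exists_cons hxq
  have h1 : Indep2 x (x + z) := fun s t e => by
    have := hxz (s + t) t (by rw [← e]; module)
    constructor <;> linarith [this.1, this.2]
  have h2 : Indep2 (x + z) z := fun s t e => by
    have := hxz s (s + t) (by rw [← e]; module)
    constructor <;> linarith [this.1, this.2]
  have hmz : seg (x + z) z ∩ B ⊆ pnt z := fun P hP => hi ⟨by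
    rw [seg_add]; exact Or.inr hP.1, hP.2⟩
  refine ⟨x + z, seg (x + z) z ∪ B, by rw [← union_assoc, ← seg_add], h1,
    Arc.cons _ _ _ _ h2 hB hmz, ?_, ?_⟩
  · rintro P ⟨h3, h4 | h4⟩
    · obtain ⟨s, t, _, _, hr⟩ := h3
      obtain ⟨a, b, _, _, hr'⟩ := h4
      obtain ⟨k, hk, e⟩ := hr.exists_smul hr'
      have h5 := hxz (a - k * (s + t)) (a + b - k * t) (by
        have : a • (x + z) + b • z - k • (s • x + t • (x + z)) = 0 := by rw [e, sub_self]
        rw [← this]; module)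
      have h7 : b = -(k * s) := by linarith [h5.1, h5.2]
      have hks : k * s = 0 ∨ b = 0 := by
        rcases lt_or_gt_of_ne hk with h8 | h8
        · have : a ≤ 0 := by nlinarith [h5.1]
          have : k * t = b := by linarith [h5.2]
          right; nlinarith
        · left; nlinarith
      have hs0 : s = 0 := by
        rcases hks with h8 | h8
        · exact (mul_eq_zero.1 h8).resolve_left hk
        · rw [h8] at h7
          exact (mul_eq_zero.1 (by linarith : k * s = 0)).resolve_left hk
      rw [hs0, zero_smul, zero_add] at hr
      have ht0 : t ≠ 0 := by rintro rfl; exact hr.ne_zero (zero_smul _ _)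
      rw [← pnt_smul _ ht0]
      exact hr
    · have h5 : P ∈ seg x z := by rw [seg_add]; exact Or.inl h3
      obtain ⟨s, t, _, _, hr⟩ := h3
      obtain ⟨k, hk, e⟩ := hr.exists_smul (hi ⟨h5, h4⟩ : Reps z P)
      have h6 := hxz (k * (s + t)) (k * t - 1) (by
        have : k • (s • x + t • (x + z)) - z = 0 := by rw [← e, sub_self]
        rw [← this]; module)
      have h7 : s + t = 0 := (mul_eq_zero.1 h6.1).resolve_left hk
      have : t = 0 := by linarith
      rw [this] at h6
      simp at h6
  · rw [Set.disjoint_left]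
    intro P h3 h4
    have h5 := hi ⟨by rw [seg_add]; exact Or.inl (pnt_subset_seg_right _ _ h3), hB.right_subset h4⟩
    exact h2.notMem h3 h5

/-- If the arc does not degenerate to a point, the parallel path starts with a segment `y t` of its
own. -/
theorem SlideData.exists_strictParallel {A : Set RP2} {x q y d : E3} {F : Set RP2}
    (h : SlideData A x q y d F) (hA : Arc A x q) (hxq : Disjoint (pnt x) (pnt q)) :
    ∃ t E, StrictParallel A x q y d F t E := by
  obtain ⟨z, B, rfl, hxz, hB, hi⟩ := hA.exists_cons hxq
  exact h.step hxz hB hi hB.exists_parallel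

theorem projSegment_eq_seg (x y : NonzeroE3) :
    projSegment x y = seg (x : E3) y := by
  ext P
  constructor
  · rintro ⟨z, ⟨a, b, ha, hb, _, e⟩, rfl⟩
    exact ⟨a, b, ha, hb, by rw [e]; exact ⟨z.2, rfl⟩⟩
  · intro hP
    obtain ⟨v, hv⟩ := exists_reps P
    obtain ⟨s, hs, k, hk, rfl⟩ := exists_convex_of_mem_seg hP hv
    have hne : (1 - s) • (x : E3) + s • (y : E3) ≠ 0 := fun h0 => hv.ne_zero (by rw [h0, smul_zero])
    exact ⟨⟨_, hne⟩, ⟨1 - s, s, sub_nonneg.2 hs.2, hs.1, by ring, rfl⟩,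
      ((reps_mk hne).smul hk).unique hv⟩

/-- A sequence of vectors whose consecutive segments form a simple chain. -/
def IsChain (n : ℕ) (x : ℕ → NonzeroE3) : Prop :=
  (∀ i < n, Indep2 (x i : E3) (x (i + 1))) ∧
    ∀ i j, i < j → j < n → ∀ R ∈ seg (x i : E3) (x (i + 1)),
      R ∈ seg (x j : E3) (x (j + 1)) → j = i + 1 ∧ R ∈ pnt (x j : E3)

theorem isPLArc_iff {A : Set RP2} {P Q : RP2} :
    IsPLArc A P Q ↔ ∃ (n : ℕ) (x : ℕ → NonzeroE3), 0 < n ∧ IsChain n x ∧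
      Reps (x 0 : E3) P ∧ Reps (x n : E3) Q ∧ A = ⋃ i < n, seg (x i : E3) (x (i + 1)) := by
  have hpt : ∀ (v : NonzeroE3) P, pt v = P ↔ Reps (v : E3) P := fun v P =>
    ⟨fun h => ⟨v.2, h⟩, fun h => h.2⟩
  refine exists_congr fun n => exists_congr fun x => and_congr_right fun hn => ?_
  have hpnt : ∀ (v : NonzeroE3) P, P = pt v ↔ P ∈ pnt (v : E3) := fun v P => by
    rw [eq_comm, hpt]; rfl
  simp only [IsChain, indep2_iff, and_assoc, hpt, hpnt, projSegment_eq_seg]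

theorem IsChain.arc {n : ℕ} {x : ℕ → NonzeroE3} (h : IsChain n x) :
    Arc ((⋃ i < n, seg (x i : E3) (x (i + 1))) ∪ pnt (x 0 : E3)) (x 0) (x n) := by
  induction n generalizing x with
  | zero => simpa using Arc.nil _ (x 0).2
  | succ n ih =>
    have h' : IsChain n fun i => x (i + 1) := ⟨fun i hi => h.1 (i + 1) (by omega),
      fun i j hij hj R h1 h2 => by
        have := h.2 (i + 1) (j + 1) (by omega) (by omega) R h1 h2
        exact ⟨by omega, this.2⟩⟩
    have key := ih h'
    have e : (⋃ i < n + 1, seg (x i : E3) (x (i + 1))) ∪ pnt (x 0 : E3) =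
        seg (x 0 : E3) (x 1) ∪
          ((⋃ i < n, seg (x (i + 1) : E3) (x (i + 1 + 1))) ∪ pnt (x 1 : E3)) := by
      rw [biUnion_lt_succ' (fun i => seg (x i : E3) (x (i + 1)))]
      ext P
      have h0 := @pnt_subset_seg_left (x 0) (x 1) P
      have h1 := @pnt_subset_seg_right (x 0) (x 1) P
      simp only [mem_union, zero_add] at *
      tauto
    rw [e]
    refine Arc.cons _ _ _ _ (h.1 0 (by omega)) key ?_
    rintro P ⟨h1, h2 | h2⟩
    · simp only [mem_iUnion] at h2
      obtain ⟨i, hi, h2⟩ := h2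
      have := h.2 0 (i + 1) (by omega) (by omega) P h1 h2
      have hi0 : i = 0 := by omega
      subst hi0
      exact this.2
    · exact h2

/-- The vectors of a chain can be rescaled simultaneously, so that the first one is prescribed. -/
theorem exists_arc_of_isPLArc {A : Set RP2} {P Q : RP2} (h : IsPLArc A P Q) {x : E3}
    (hx : Reps x P) : ∃ q, Reps q Q ∧ Arc A x q := by
  obtain ⟨n, y, hn, hc, hP, hQ, rfl⟩ := isPLArc_iff.1 h
  obtain ⟨c, hc0, rfl⟩ := hP.exists_smul hx
  refine ⟨c • (y n : E3), hQ.smul hc0, ?_⟩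
  have := hc.arc.smul hc0
  rwa [union_eq_left.2] at this
  exact (pnt_subset_seg_left _ _).trans
    (subset_biUnion_of_mem (u := fun i => seg (y i : E3) (y (i + 1))) hn)

/-- An arc is a chain of segments. The term `pnt x` matters only if there are no segments. -/
theorem Arc.exists_isChain {A : Set RP2} {x q : E3} (h : Arc A x q) :
    ∃ (n : ℕ) (s : ℕ → NonzeroE3), IsChain n s ∧ (s 0 : E3) = x ∧ (s n : E3) = q ∧
      A = (⋃ i < n, seg (s i : E3) (s (i + 1))) ∪ pnt x := by
  induction h with
  | nil x hx => exact ⟨0, fun _ => ⟨x, hx⟩, ⟨by simp, by simp⟩, rfl, rfl, by simp⟩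
  | cons r p A q h hA hi ih =>
    obtain ⟨n, s, hs, rfl, rfl, rfl⟩ := ih
    refine ⟨n + 1, fun i => Nat.casesOn i ⟨r, h.ne_zero⟩ s, ⟨?_, ?_⟩, rfl, rfl, ?_⟩
    · rintro (_ | i) hin
      · exact h
      · exact hs.1 i (by omega)
    · rintro i (_ | j) hij hj R h1 h2
      · omega
      have hjn : j < n := by omega
      rcases i with _ | i
      · have hRp : R ∈ pnt (s 0 : E3) := hi ⟨h1, Or.inl (mem_biUnion (show j < n from hjn) h2)⟩
        have hj0 : j = 0 := by
          by_contra hne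
          have := hs.2 0 j (by omega) hjn R (pnt_subset_seg_left _ _ hRp) h2
          obtain ⟨e, h3⟩ := this
          have h4 := hs.1 0 (by omega)
          rw [e] at h3
          exact h4.notMem hRp h3
        subst hj0
        exact ⟨rfl, hRp⟩
      · have := hs.2 i j (by omega) hjn R h1 h2
        exact ⟨by omega, this.2⟩
    · rw [biUnion_lt_succ' (fun i => seg
        ((Nat.casesOn i ⟨r, h.ne_zero⟩ s : NonzeroE3) : E3) (s i))]
      ext P
      have h0 := @pnt_subset_seg_left r (s 0) P
      have h1 := @pnt_subset_seg_right r (s 0) P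
      simp only [mem_union] at *
      tauto

theorem Arc.isPLArc {A : Set RP2} {x q : E3} {P Q : RP2} (h : Arc A x q) (hP : Reps x P)
    (hQ : Reps q Q) (hPQ : P ≠ Q) : IsPLArc A P Q := by
  obtain ⟨n, s, hs, rfl, rfl, rfl⟩ := h.exists_isChain
  have hn : 0 < n := by
    rcases n.eq_zero_or_pos with rfl | h
    · exact absurd (hP.unique hQ) hPQ
    · exact h
  refine isPLArc_iff.2 ⟨n, s, hn, hs, hP, hQ, union_eq_left.2 ?_⟩
  exact (pnt_subset_seg_left _ _).trans
    (subset_biUnion_of_mem (u := fun i => seg (s i : E3) (s (i + 1))) hn)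

/-! ### Replacing a star by a triangle -/

/-- The arcs `AB`, `BC` and `AC` form a triangle that can replace the star with the legs `La`, `Lb`
and `Lc` in a drawing whose remaining part is `R`. A path along one or two sides of the triangle can
be moved to the path along the two legs with the same end points, and the whole triangle can be
moved into a geodesic triangle away from the part of `R` that it does not touch. -/
structure Replaces (R : Set RP2) (a b c : E3) (La Lb Lc AB BC AC : Set RP2) : Prop where
  arc_ab : Arc AB a b
  arc_bc : Arc BC b c
  arc_ac : Arc AC a c
  ab_R : AB ∩ R ⊆ pnt a ∪ pnt b
  bc_R : BC ∩ R ⊆ pnt b ∪ pnt c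
  ac_R : AC ∩ R ⊆ pnt a ∪ pnt c
  ab_bc : AB ∩ BC ⊆ pnt b
  ab_ac : AB ∩ AC ⊆ pnt a
  ac_bc : AC ∩ BC ⊆ pnt c
  move_ab : Moves R AB (La ∪ Lb)
  move_bc : Moves R BC (Lb ∪ Lc)
  move_ac : Moves R AC (La ∪ Lc)
  move_ab_ac : ∀ F, Poly F → F ⊆ R → Disjoint F (pnt a) → Moves F (AB ∪ AC) (Lb ∪ Lc)
  move_ab_bc : ∀ F, Poly F → F ⊆ R → Disjoint F (pnt b) → Moves F (AB ∪ BC) (La ∪ Lc)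
  move_ac_bc : ∀ F, Poly F → F ⊆ R → Disjoint F (pnt c) → Moves F (AC ∪ BC) (La ∪ Lb)
  shrink : ∀ F, Poly F → F ⊆ R → Disjoint F (pnt a) → Disjoint F (pnt b) → Disjoint F (pnt c) →
    ∃ p q r : E3, Indep3 p q r ∧ Disjoint F (tri p q r) ∧
      ∃ T ⊆ tri p q r, Moves F (AB ∪ BC ∪ AC) T

set_option maxHeartbeats 1000000 in
/-- The triangle that replaces the star: `AB` runs along two legs of the star, `AC` leaves the third
leg near the centre and then runs parallel to the leg of `a`, and `BC` runs parallel to the legs of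
`b` and `c`. -/
theorem exists_replaces {R La Lb Lc : Set RP2} {o a b c : E3} (hR : Poly R)
    (hLa : Arc La o a) (hLb : Arc Lb o b) (hLc : Arc Lc o c)
    (oa : Disjoint (pnt o) (pnt a)) (ob : Disjoint (pnt o) (pnt b)) (oc : Disjoint (pnt o) (pnt c))
    (hab : La ∩ Lb ⊆ pnt o) (hac : La ∩ Lc ⊆ pnt o) (hbc : Lb ∩ Lc ⊆ pnt o)
    (hRa : R ∩ La ⊆ pnt a) (hRb : R ∩ Lb ⊆ pnt b) (hRc : R ∩ Lc ⊆ pnt c) :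
    ∃ AB BC AC, Replaces R a b c La Lb Lc AB BC AC := by
  obtain ⟨a1, A1, eLa, oa1, hA1, ia1⟩ := hLa.exists_cons oa
  obtain ⟨b1, B1, eLb, ob1, hB1, ib1⟩ := hLb.exists_cons ob
  obtain ⟨c1, C1, eLc, oc1, hC1, ic1, c1c⟩ := hLc.exists_cons_proper oc
  rw [Set.disjoint_left] at oa ob oc c1c
  have sa : ∀ {P}, P ∈ seg o a1 → P ∈ La := fun h => by rw [eLa]; exact Or.inl h
  have sA : ∀ {P}, P ∈ A1 → P ∈ La := fun h => by rw [eLa]; exact Or.inr h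
  have sb : ∀ {P}, P ∈ seg o b1 → P ∈ Lb := fun h => by rw [eLb]; exact Or.inl h
  have sB : ∀ {P}, P ∈ B1 → P ∈ Lb := fun h => by rw [eLb]; exact Or.inr h
  have sc : ∀ {P}, P ∈ seg c1 o → P ∈ Lc := fun h => by rw [eLc, seg_symm o]; exact Or.inl h
  have sC : ∀ {P}, P ∈ C1 → P ∈ Lc := fun h => by rw [eLc]; exact Or.inr h
  have qa : ∀ {P}, P ∈ pnt a → P ∈ La := fun h => hLa.right_subset h
  have qb : ∀ {P}, P ∈ pnt b → P ∈ Lb := fun h => hLb.right_subset h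
  have qc : ∀ {P}, P ∈ pnt c → P ∈ C1 := fun h => hC1.right_subset h
  have pc1 : ∀ {P}, P ∈ pnt c1 → P ∈ C1 := fun h => hC1.left_subset h
  have oA1 : ∀ {P}, P ∈ pnt o → P ∉ A1 := fun h h' =>
    oa1.notMem h (ia1 ⟨pnt_subset_seg_left _ _ h, h'⟩)
  have oB1 : ∀ {P}, P ∈ pnt o → P ∉ B1 := fun h h' =>
    ob1.notMem h (ib1 ⟨pnt_subset_seg_left _ _ h, h'⟩)
  have oC1 : ∀ {P}, P ∈ pnt o → P ∉ C1 := fun h h' =>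
    oc1.notMem h (ic1 ⟨pnt_subset_seg_left _ _ h, h'⟩)
  have ic1' : ∀ {P}, P ∈ seg c1 o → P ∈ C1 → P ∈ pnt c1 := fun h h' =>
    ic1 ⟨by rwa [seg_symm], h'⟩
  have AC1 : ∀ {P}, P ∈ La → P ∉ C1 := fun h h' => oC1 (hac ⟨h, sC h'⟩) h'
  have BC1 : ∀ {P}, P ∈ Lb → P ∉ C1 := fun h h' => oC1 (hbc ⟨h, sC h'⟩) h'
  have Rs : ∀ {P}, P ∈ R → P ∉ seg c1 o := fun h h' => by
    have h1 := hRc ⟨h, sc h'⟩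
    exact c1c (ic1' h' (qc h1)) h1
  have Rc1 : ∀ {P}, P ∈ R → P ∉ pnt c1 := fun h h' => Rs h (pnt_subset_seg_left _ _ h')
  -- the first parallel arc, along the leg of `b`
  have data2 : SlideData Lb o b c1 a1 (R ∪ (A1 ∪ C1)) := by
    refine ⟨oc1.symm, fun P hP => hbc ⟨hP.2, sc hP.1⟩,
      Poly.union _ _ hR (Poly.union _ _ hA1.poly hC1.poly), ?_, ?_, oa1.symm,
      fun P hP => hac ⟨sa hP.1, sc hP.2⟩, fun P hP => hab ⟨sa hP.1, hP.2⟩⟩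
    · rintro P ⟨h1 | h1 | h1, h2⟩
      · exact (Rs h1 h2).elim
      · exact (oA1 (hac ⟨sA h1, sc h2⟩) h1).elim
      · exact Or.inl (ic1' h2 h1)
    · rintro P ⟨h1 | h1 | h1, h2⟩
      · exact hRb ⟨h1, h2⟩
      · exact (oA1 (hab ⟨sA h1, h2⟩) h1).elim
      · exact (BC1 h2 h1).elim
  obtain ⟨t2, E2, h2⟩ := data2.exists_strictParallel hLb (Set.disjoint_left.2 ob)
  have t2b := Set.disjoint_left.1 h2.t_q
  set E' := seg c1 t2 ∪ E2 with hE'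
  have E'R : ∀ {P}, P ∈ E' → P ∈ R → P ∈ pnt b := fun h h' =>
    (h2.E_F ⟨h, Or.inl h'⟩).resolve_left (Rc1 h')
  have E'La : ∀ {P}, P ∈ E' → P ∉ La := fun {P} h h' => by
    have h0 := h'
    rw [eLa] at h0
    rcases h0 with h0 | h0
    · exact Set.disjoint_left.1 h2.E_d h h0
    · rcases h2.E_F ⟨h, Or.inr (Or.inl h0)⟩ with h1 | h1
      · exact AC1 h' (pc1 h1)
      · exact ob (hab ⟨h', qb h1⟩) h1
  have E'C1 : ∀ {P}, P ∈ E' → P ∈ C1 → P ∈ pnt c1 := fun h h' =>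
    (h2.E_F ⟨h, Or.inr (Or.inr h')⟩).resolve_right fun h1 => BC1 (qb h1) h'
  have E'Lb : ∀ {P}, P ∈ E' → P ∈ Lb → P ∈ pnt b := fun h h' => h2.E_A ⟨h, h'⟩
  have E's : ∀ {P}, P ∈ E' → P ∈ seg c1 o → P ∈ pnt c1 := fun h h' => h2.E_y ⟨h, h'⟩
  have c1E2 : ∀ {P}, P ∈ pnt c1 → P ∉ E2 := fun h h' =>
    h2.indep_t.notMem h (h2.inter_t ⟨pnt_subset_seg_left _ _ h, h'⟩)
  have sE2 : ∀ {P}, P ∈ E2 → P ∈ E' := fun h => Or.inr h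
  have sE' : ∀ {P}, P ∈ seg t2 c1 → P ∈ E' := fun h => Or.inl (by rwa [seg_symm])
  have bE2 : ∀ {P}, P ∈ pnt b → P ∈ E2 := fun h => h2.arc.right_subset h
  have bs : ∀ {P}, P ∈ pnt b → P ∉ seg t2 c1 := fun h h' =>
    t2b (h2.inter_t ⟨by rwa [seg_symm], bE2 h⟩) h
  have t2E' : ∀ {P}, P ∈ pnt t2 → P ∈ E' := fun h => sE' (pnt_subset_seg_left _ _ h)
  -- its continuation, along the leg of `c`
  have data3 : SlideData C1 c1 c t2 o (R ∪ (La ∪ (Lb ∪ E2))) := by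
    refine ⟨h2.indep_t.symm, fun P hP => E'C1 (sE' hP.1) hP.2,
      Poly.union _ _ hR (Poly.union _ _ hLa.poly (Poly.union _ _ hLb.poly h2.arc.poly)), ?_, ?_,
      oc1, fun P hP => E's (sE' hP.2) hP.1, fun P hP => ic1' hP.1 hP.2⟩
    · rintro P ⟨h1 | h1 | h1 | h1, h3⟩
      · exact (bs (E'R (sE' h3) h1) h3).elim
      · exact (E'La (sE' h3) h1).elim
      · exact (bs (E'Lb (sE' h3) h1) h3).elim
      · exact Or.inl (h2.inter_t ⟨by rwa [seg_symm], h1⟩)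
    · rintro P ⟨h1 | h1 | h1 | h1, h3⟩
      · exact hRc ⟨h1, sC h3⟩
      · exact (AC1 h1 h3).elim
      · exact (BC1 h1 h3).elim
      · exact (c1E2 (E'C1 (sE2 h1) h3) h1).elim
  obtain ⟨t3, E3, h3⟩ := data3.exists_strictParallel hC1 (Set.disjoint_left.2 c1c)
  set E'' := seg t2 t3 ∪ E3 with hE''
  have E''R : ∀ {P}, P ∈ E'' → P ∈ R → P ∈ pnt c := fun h h' =>
    (h3.E_F ⟨h, Or.inl h'⟩).resolve_left fun h1 => t2b h1 (E'R (t2E' h1) h')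
  have E''La : ∀ {P}, P ∈ E'' → P ∉ La := fun h h' =>
    (h3.E_F ⟨h, Or.inr (Or.inl h')⟩).elim (fun h1 => E'La (t2E' h1) h') fun h1 => AC1 h' (qc h1)
  have E''Lb : ∀ {P}, P ∈ E'' → P ∉ Lb := fun h h' =>
    (h3.E_F ⟨h, Or.inr (Or.inr (Or.inl h'))⟩).elim (fun h1 => t2b h1 (E'Lb (t2E' h1) h'))
      fun h1 => BC1 h' (qc h1)
  have E''C1 : ∀ {P}, P ∈ E'' → P ∈ C1 → P ∈ pnt c := fun h h' => h3.E_A ⟨h, h'⟩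
  have E''s : ∀ {P}, P ∈ E'' → P ∉ seg c1 o := fun h h' => Set.disjoint_left.1 h3.E_d h h'
  have arcBC : Arc (E2 ∪ E'') b c := by
    refine h2.arc.reverse.append h3.parallel.arc fun P hP => ?_
    refine (h3.E_F ⟨hP.2, Or.inr (Or.inr (Or.inr hP.1))⟩).resolve_right fun h1 => ?_
    exact c1c (E'C1 (sE2 hP.1) (qc h1)) h1
  have BC_R : ∀ {P}, P ∈ E2 ∪ E'' → P ∈ R → P ∈ pnt b ∨ P ∈ pnt c := fun h h' =>
    h.imp (fun h => E'R (sE2 h) h') fun h => E''R h h'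
  have BC_La : ∀ {P}, P ∈ E2 ∪ E'' → P ∉ La := fun h h' =>
    h.elim (fun h => E'La (sE2 h) h') fun h => E''La h h'
  have BC_Lb : ∀ {P}, P ∈ E2 ∪ E'' → P ∈ Lb → P ∈ pnt b := fun h h' =>
    h.elim (fun h => E'Lb (sE2 h) h') fun h => (E''Lb h h').elim
  have BC_C1 : ∀ {P}, P ∈ E2 ∪ E'' → P ∈ C1 → P ∈ pnt c := fun h h' =>
    h.elim (fun h => (c1E2 (E'C1 (sE2 h) h') h).elim) fun h => E''C1 h h'
  have BC_s : ∀ {P}, P ∈ E2 ∪ E'' → P ∉ seg c1 o := fun h h' =>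
    h.elim (fun h => (c1E2 (E's (sE2 h) h') h).elim) fun h => E''s h h'
  -- the second parallel arc, along the leg of `a`
  have data1 : SlideData La o a c1 b1 (R ∪ (B1 ∪ (C1 ∪ (E2 ∪ E'')))) := by
    refine ⟨oc1.symm, fun P hP => hac ⟨hP.2, sc hP.1⟩,
      Poly.union _ _ hR (Poly.union _ _ hB1.poly (Poly.union _ _ hC1.poly arcBC.poly)), ?_, ?_,
      ob1.symm, fun P hP => hbc ⟨sb hP.1, sc hP.2⟩, fun P hP => hab ⟨hP.2, sb hP.1⟩⟩
    · rintro P ⟨h1 | h1 | h1 | h1, h4⟩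
      · exact (Rs h1 h4).elim
      · exact (oB1 (hbc ⟨sB h1, sc h4⟩) h1).elim
      · exact Or.inl (ic1' h4 h1)
      · exact (BC_s h1 h4).elim
    · rintro P ⟨h1 | h1 | h1 | h1, h4⟩
      · exact hRa ⟨h1, h4⟩
      · exact (oB1 (hab ⟨h4, sB h1⟩) h1).elim
      · exact (AC1 h4 h1).elim
      · exact (BC_La h1 h4).elim
  obtain ⟨t1, E1, h1⟩ := data1.exists_strictParallel hLa (Set.disjoint_left.2 oa)
  set E := seg c1 t1 ∪ E1 with hE
  have E_R : ∀ {P}, P ∈ E → P ∈ R → P ∈ pnt a := fun h h' =>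
    (h1.E_F ⟨h, Or.inl h'⟩).resolve_left (Rc1 h')
  have E_La : ∀ {P}, P ∈ E → P ∈ La → P ∈ pnt a := fun h h' => h1.E_A ⟨h, h'⟩
  have E_Lb : ∀ {P}, P ∈ E → P ∉ Lb := fun {P} h h' => by
    have h0 := h'
    rw [eLb] at h0
    rcases h0 with h0 | h0
    · exact Set.disjoint_left.1 h1.E_d h h0
    · rcases h1.E_F ⟨h, Or.inr (Or.inl h0)⟩ with h4 | h4
      · exact BC1 h' (pc1 h4)
      · exact oa (hab ⟨qa h4, h'⟩) h4
  have E_C1 : ∀ {P}, P ∈ E → P ∈ C1 → P ∈ pnt c1 := fun h h' =>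
    (h1.E_F ⟨h, Or.inr (Or.inr (Or.inl h'))⟩).resolve_right fun h4 => AC1 (qa h4) h'
  have E_BC : ∀ {P}, P ∈ E → P ∉ E2 ∪ E'' := fun h h' =>
    (h1.E_F ⟨h, Or.inr (Or.inr (Or.inr h'))⟩).elim (fun h4 => c1c h4 (BC_C1 h' (pc1 h4)))
      fun h4 => BC_La h' (qa h4)
  have arcAC : Arc (C1 ∪ E) a c :=
    (hC1.reverse.append h1.parallel.arc fun P hP => E_C1 hP.2 hP.1).reverse
  have arcAB : Arc (La ∪ Lb) a b := hLa.reverse.append hLb hab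
  -- undoing the two parts of `BC` one after the other
  have undo3 : Moves (R ∪ (La ∪ Lb)) (E2 ∪ E'') (E' ∪ C1) :=
    (h3.push.symm).frame (C := E2)
      (by clear * -; intro P; simp only [mem_union]; tauto) (union_comm _ _)
      (by rw [hE', seg_symm t2]; clear * -; ext P; simp only [mem_union]; tauto)
  have undo2 : Moves R (E' ∪ C1) (Lb ∪ Lc) :=
    (h2.push.symm).frame (C := C1) (by clear * -; intro P; simp only [mem_union]; tauto) rfl
      (by rw [eLc, seg_symm o]; clear * -; ext P; simp only [mem_union]; tauto)
  have undo1 : Moves (R ∪ (E2 ∪ E'')) (C1 ∪ E) (La ∪ Lc) :=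
    (h1.push.symm).frame (C := C1)
      (by clear * -; intro P; simp only [mem_union]; tauto) (union_comm _ _)
      (by rw [eLc, seg_symm o]; clear * -; ext P; simp only [mem_union]; tauto)
  have pLb : Lb ⊆ B1 ∪ seg o b1 := by rw [eLb, union_comm]
  have pLa : La ⊆ A1 ∪ seg o a1 := by rw [eLa, union_comm]
  -- the leg of `a` and its parallel, collapsed onto the first segment of the leg of `c`
  have col1 : ∀ F B, Poly F → Poly B → F ⊆ R → B ⊆ E2 ∪ E'' → Disjoint F (pnt a) →
      Moves (F ∪ (Lb ∪ (C1 ∪ B))) (La ∪ E) (seg c1 o) := by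
    intro F B hF hB hFR hBs hFa
    refine h1.collapse _ (Poly.union _ _ hF (Poly.union _ _ hLb.poly
      (Poly.union _ _ hC1.poly hB))) ?_ ?_
    · rintro P (h4 | h4 | h4 | h4)
      · exact Or.inl (Or.inl (hFR h4))
      · rcases pLb h4 with h5 | h5
        · exact Or.inl (Or.inr (Or.inl h5))
        · exact Or.inr h5
      · exact Or.inl (Or.inr (Or.inr (Or.inl h4)))
      · exact Or.inl (Or.inr (Or.inr (Or.inr (hBs h4))))
    · rintro P ⟨h4 | h4 | h4 | h4, h5⟩
      · exact (Set.disjoint_left.1 hFa h4 h5).elim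
      · exact hab ⟨qa h5, h4⟩
      · exact (AC1 (qa h5) h4).elim
      · exact (BC_La (hBs h4) (qa h5)).elim
  -- the same for the end of the leg of `c`
  have col3 : ∀ F B, Poly F → Poly B → F ⊆ R → B ⊆ La ∪ Lb → Disjoint F (pnt c) →
      Moves (F ∪ (B ∪ (E2 ∪ seg c1 o))) (C1 ∪ E'') (seg t2 c1) := by
    intro F B hF hB hFR hBs hFc
    refine h3.collapse _ (Poly.union _ _ hF (Poly.union _ _ hB
      (Poly.union _ _ h2.arc.poly oc1.symm.poly_seg))) ?_ ?_
    · rintro P (h4 | h4 | h4 | h4)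
      · exact Or.inl (Or.inl (hFR h4))
      · rcases hBs h4 with h5 | h5
        · exact Or.inl (Or.inr (Or.inl h5))
        · exact Or.inl (Or.inr (Or.inr (Or.inl h5)))
      · exact Or.inl (Or.inr (Or.inr (Or.inr h4)))
      · exact Or.inr h4
    · rintro P ⟨h4 | h4 | h4 | h4, h5⟩
      · exact (Set.disjoint_left.1 hFc h4 h5).elim
      · exact ((hBs h4).elim (fun h6 => AC1 h6 (qc h5)) fun h6 => BC1 h6 (qc h5)).elim
      · exact E'C1 (sE2 h4) (qc h5)
      · exact ic1' h4 (qc h5)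
  refine ⟨La ∪ Lb, E2 ∪ E'', C1 ∪ E, arcAB, arcBC, arcAC, ?_, fun P hP => BC_R hP.1 hP.2, ?_, ?_,
    ?_, ?_, Moves.refl _ _, (undo3.mono subset_union_left).trans undo2,
    undo1.mono subset_union_left, ?_, ?_, ?_, ?_⟩
  · rintro P ⟨h4 | h4, h5⟩
    · exact Or.inl (hRa ⟨h5, h4⟩)
    · exact Or.inr (hRb ⟨h5, h4⟩)
  · rintro P ⟨h4 | h4, h5⟩
    · exact Or.inr (hRc ⟨h5, sC h4⟩)
    · exact Or.inl (E_R h4 h5)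
  · rintro P ⟨h4 | h4, h5⟩
    · exact (BC_La h5 h4).elim
    · exact BC_Lb h5 h4
  · rintro P ⟨h4 | h4, h5 | h5⟩
    · exact (AC1 h4 h5).elim
    · exact E_La h5 h4
    · exact (BC1 h4 h5).elim
    · exact (E_Lb h5 h4).elim
  · rintro P ⟨h4 | h4, h5⟩
    · exact BC_C1 h5 h4
    · exact (E_BC h4 h5).elim
  · intro F hF hFR hFa
    exact (col1 F ∅ hF Poly.empty hFR (empty_subset _) hFa).frame (C := Lb ∪ C1)
      (by clear * -; intro P; simp only [mem_union]; tauto)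
      (by clear * -; ext P; simp only [mem_union]; tauto)
      (by rw [eLc, seg_symm o]; clear * -; ext P; simp only [mem_union]; tauto)
  · intro F hF hFR hFb
    have k1 : Moves F (La ∪ Lb ∪ (E2 ∪ E'')) (E' ∪ C1 ∪ (La ∪ Lb)) :=
      undo3.frame (union_subset_union_left _ hFR) (union_comm _ _) rfl
    refine k1.trans ((h2.collapse (F ∪ (La ∪ C1)) (Poly.union _ _ hF (Poly.union _ _ hLa.poly
      hC1.poly)) ?_ ?_).frame (C := La ∪ C1) Subset.rfl
      (by rw [hE']; clear * -; ext P; simp only [mem_union]; tauto)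
      (by rw [eLc, seg_symm o]; clear * -; ext P; simp only [mem_union]; tauto))
    · rintro P (h4 | h4 | h4)
      · exact Or.inl (Or.inl (hFR h4))
      · rcases pLa h4 with h5 | h5
        · exact Or.inl (Or.inr (Or.inl h5))
        · exact Or.inr h5
      · exact Or.inl (Or.inr (Or.inr h4))
    · rintro P ⟨h4 | h4 | h4, h5⟩
      · exact (Set.disjoint_left.1 hFb h4 h5).elim
      · exact hab ⟨h4, qb h5⟩
      · exact (BC1 (qb h5) h4).elim
  · intro F hF hFR hFc
    have k1 : Moves F (C1 ∪ E ∪ (E2 ∪ E'')) (La ∪ Lc ∪ (E2 ∪ E'')) :=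
      undo1.frame (union_subset_union_left _ hFR) rfl rfl
    have k2 : Moves F (La ∪ Lc ∪ (E2 ∪ E'')) (seg t2 c1 ∪ (La ∪ (E2 ∪ seg c1 o))) :=
      (col3 F La hF hLa.poly hFR subset_union_left hFc).frame Subset.rfl
        (by rw [eLc, seg_symm o]; clear * -; ext P; simp only [mem_union]; tauto) rfl
    refine k1.trans (k2.trans ((h2.pull (F ∪ La) (Poly.union _ _ hF hLa.poly) ?_ ?_).frame
      (C := La) Subset.rfl (by rw [seg_symm c1 t2]; clear * -; ext P; simp only [mem_union]; tauto)
      (union_comm _ _)))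
    · rintro P (h4 | h4)
      · exact Or.inl (Or.inl (hFR h4))
      · rcases pLa h4 with h5 | h5
        · exact Or.inl (Or.inr (Or.inl h5))
        · exact Or.inr h5
    · rw [Set.disjoint_left]
      rintro P (h4 | h4) h5
      · exact Rc1 (hFR h4) h5
      · exact AC1 h4 (pc1 h5)
  · intro F hF hFR hFa hFb hFc
    obtain ⟨p, q, r, hpqr, hFT, T, hT, hm⟩ := h2.shrink F hF (hFR.trans subset_union_left)
      (Set.disjoint_left.2 fun P h4 h5 => Rc1 (hFR h4) h5) hFb
    refine ⟨p, q, r, hpqr, hFT, T, hT, ?_⟩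
    have k1 : Moves F (La ∪ Lb ∪ (E2 ∪ E'') ∪ (C1 ∪ E)) (seg c1 o ∪ (Lb ∪ (C1 ∪ (E2 ∪ E'')))) :=
      (col1 F _ hF arcBC.poly hFR Subset.rfl hFa).frame Subset.rfl
        (by clear * -; ext P; simp only [mem_union]; tauto) rfl
    have k2 : Moves F (seg c1 o ∪ (Lb ∪ (C1 ∪ (E2 ∪ E'')))) (seg t2 c1 ∪ (Lb ∪ (E2 ∪ seg c1 o))) :=
      (col3 F Lb hF hLb.poly hFR subset_union_right hFc).frame Subset.rfl
        (by clear * -; ext P; simp only [mem_union]; tauto) rfl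
    refine k1.trans (k2.trans ?_)
    convert hm using 1
    rw [seg_symm t2]; clear * -; ext P; simp only [mem_union]; tauto

/-! ### Complements of triangles -/

theorem exists_opposite_signs {x y z : ℝ} (h : ¬ (0 ≤ x ∧ 0 ≤ y ∧ 0 ≤ z))
    (h' : ¬ (0 ≤ -x ∧ 0 ≤ -y ∧ 0 ≤ -z)) :
    (0 < x ∧ y < 0) ∨ (0 < y ∧ x < 0) ∨ (0 < x ∧ z < 0) ∨ (0 < z ∧ x < 0) ∨
      (0 < y ∧ z < 0) ∨ (0 < z ∧ y < 0) := by
  grind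

/-- The complement of a triangle in the projective plane is connected. -/
theorem Indep3.isPreconnected_compl_tri {p q r : E3} (h : Indep3 p q r) :
    IsPreconnected (tri p q r)ᶜ := by
  obtain ⟨α, β, γ, hv, hα, hβ, hγ⟩ := h.exists_coord
  -- the points at which two given coordinates have opposite signs
  let U : (E3 →ₗ[ℝ] ℝ) → (E3 →ₗ[ℝ] ℝ) → Set RP2 := fun φ ψ =>
    {P | ∃ v, Reps v P ∧ 0 < φ v ∧ ψ v < 0}
  have hU : ∀ φ ψ, IsPreconnected (U φ ψ) := by
    intro φ ψ
    have hc : Convex ℝ {v : E3 | 0 < φ v ∧ ψ v < 0} := by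
      rintro v ⟨h1, h2⟩ w ⟨h3, h4⟩ a b ha hb hab
      simp only [mem_ofPred_eq, map_add, map_smul, smul_eq_mul]
      rcases ha.lt_or_eq with ha | rfl
      · constructor <;> nlinarith [mul_pos ha h1, mul_neg_of_pos_of_neg ha h2]
      · have : b = 1 := by linarith
        subst this
        constructor <;> linarith
    have hs : IsPreconnected {v : NonzeroE3 | 0 < φ v ∧ ψ v < 0} := by
      rw [← (Topology.IsInducing.subtypeVal :
        Topology.IsInducing ((↑) : NonzeroE3 → E3)).isPreconnected_image]
      convert hc.isPreconnected using 1
      ext v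
      constructor
      · rintro ⟨v, hv, rfl⟩; exact hv
      · intro hv
        exact ⟨⟨v, fun h0 => by simp [h0] at hv⟩, hv, rfl⟩
    convert hs.image pt continuous_pt.continuousOn using 1
    ext P
    constructor
    · rintro ⟨v, ⟨h0, rfl⟩, h1⟩; exact ⟨⟨v, h0⟩, h1, rfl⟩
    · rintro ⟨v, h1, rfl⟩; exact ⟨v, ⟨v.2, rfl⟩, h1⟩
  have swap : ∀ φ ψ P, P ∈ U φ ψ → P ∈ U ψ φ := by
    rintro φ ψ P ⟨v, hP, h1, h2⟩
    exact ⟨(-1 : ℝ) • v, hP.smul (by norm_num), by simpa using h2, by simpa using h1⟩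
  have e : (tri p q r)ᶜ = U α β ∪ U α γ ∪ U β γ := by
    ext P
    rw [mem_compl_iff, mem_tri_iff hv hα hβ hγ]
    constructor
    · intro hP
      obtain ⟨v, hvP⟩ := exists_reps P
      have h4 : ¬ (0 ≤ α v ∧ 0 ≤ β v ∧ 0 ≤ γ v) := fun h => hP ⟨v, hvP, h⟩
      have h5 : ¬ (0 ≤ -α v ∧ 0 ≤ -β v ∧ 0 ≤ -γ v) := fun h =>
        hP ⟨-v, by simpa using hvP.smul (c := -1) (by norm_num), by simpa only [map_neg] using h⟩
      rcases exists_opposite_signs h4 h5 with h | h | h | h | h | h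
      · exact Or.inl (Or.inl ⟨v, hvP, h⟩)
      · exact Or.inl (Or.inl (swap _ _ P ⟨v, hvP, h⟩))
      · exact Or.inl (Or.inr ⟨v, hvP, h⟩)
      · exact Or.inl (Or.inr (swap _ _ P ⟨v, hvP, h⟩))
      · exact Or.inr ⟨v, hvP, h⟩
      · exact Or.inr (swap _ _ P ⟨v, hvP, h⟩)
    · rintro hP ⟨w, hw, h1, h2, h3⟩
      have key : ∀ φ ψ, 0 ≤ φ w → 0 ≤ ψ w → P ∉ U φ ψ := by
        rintro φ ψ hφ hψ ⟨v, hvP, h4, h5⟩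
        obtain ⟨k, hk, rfl⟩ := hvP.exists_smul hw
        simp only [map_smul, smul_eq_mul] at hφ hψ
        rcases lt_or_gt_of_ne hk with h | h <;> nlinarith
      rcases hP with (hP | hP) | hP
      · exact key _ _ h1 h2 hP
      · exact key _ _ h1 h3 hP
      · exact key _ _ h2 h3 hP
  have mem : ∀ a b c : ℝ, (a ≠ 0) → ∃ P, Reps (a • p + b • q + c • r) P := fun a b c ha => by
    refine ⟨Projectivization.mk ℝ _ ?_, reps_mk ?_⟩ <;>
      exact fun h0 => ha (h a b c h0).1
  rw [e]
  obtain ⟨P, hP⟩ := mem 1 (-1) (-1) one_ne_zero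
  obtain ⟨Q, hQ⟩ := mem (-1) (-1) 1 (by norm_num)
  refine ((hU α β).union P ?_ ?_ (hU α γ)).union Q (Or.inr (swap _ _ _ ?_)) (swap _ _ _ ?_) (hU β γ)
  · exact ⟨_, hP, by simp [hα], by simp [hβ]⟩
  · exact ⟨_, hP, by simp [hα], by simp [hγ]⟩
  · exact ⟨_, hQ, by simp [hγ], by simp [hα]⟩
  · exact ⟨_, hQ, by simp [hγ], by simp [hβ]⟩

end

open Set

/-! ### Cycles through given edges -/

section Walks

variable {V : Type*} {G : SimpleGraph V}

/-- A path that contains an edge at its first vertex starts with this edge. -/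
theorem exists_eq_cons_of_mem_edges {x y z : V} {r : G.Walk x z} (hr : r.IsPath)
    (h : s(x, y) ∈ r.edges) : ∃ (hxy : G.Adj x y) (r' : G.Walk y z), r = .cons hxy r' := by
  cases r with
  | nil => simp at h
  | @cons _ v _ hxv r' =>
    rw [SimpleGraph.Walk.edges_cons, List.mem_cons] at h
    rcases h with h | h
    · obtain rfl : y = v := by
        rcases Sym2.eq_iff.1 h with h | h
        · exact h.2
        · exact h.2.trans h.1
      exact ⟨hxv, r', rfl⟩
    · exact absurd (r'.fst_mem_support_of_mem_edges h)
        (SimpleGraph.Walk.cons_isPath_iff _ _ |>.1 hr).2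

/-- A cycle through the edge `s(x, y)` consists of this edge and a path. -/
theorem exists_path_of_mem_cycle {w x y : V} {p : G.Walk w w} (hp : p.IsCycle)
    (h : s(x, y) ∈ p.edges) :
    ∃ q : G.Walk y x, q.IsPath ∧ s(x, y) ∉ q.edges ∧
      (∀ e, e ∈ p.edges ↔ e = s(x, y) ∨ e ∈ q.edges) ∧ ∀ u, u ∈ q.support → u ∈ p.support := by
  classical
  have hx := p.fst_mem_support_of_mem_edges h
  have hc := hp.rotate hx
  have he : ∀ e, e ∈ (p.rotate x hx).edges ↔ e ∈ p.edges := fun e => (p.rotate_edges x hx).mem_iff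
  have hs : ∀ u, u ∈ (p.rotate x hx).support → u ∈ p.support := fun u =>
    (p.mem_support_rotate_iff x hx).1
  rw [← he] at h
  simp only [← he]
  revert h hc hs
  generalize p.rotate x hx = c
  intro h hc hs
  cases c with
  | nil => simp at h
  | @cons _ v _ hxv q =>
    obtain ⟨hq, hvq⟩ := (SimpleGraph.Walk.cons_isCycle_iff _ _).1 hc
    simp only [SimpleGraph.Walk.edges_cons, List.mem_cons, SimpleGraph.Walk.support_cons] at h hs ⊢
    by_cases hvy : v = y
    · subst hvy
      exact ⟨q, hq, hvq, fun e => Iff.rfl, fun u hu => hs u (Or.inr hu)⟩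
    · have h' : s(x, y) ∈ q.edges := h.resolve_left fun h => hvy (by
        rcases Sym2.eq_iff.1 h with h | h
        · exact h.2.symm
        · exact h.1.symm.trans h.2.symm)
      obtain ⟨hxy, r, hr⟩ := exists_eq_cons_of_mem_edges hq.reverse
        (by rwa [SimpleGraph.Walk.edges_reverse, List.mem_reverse])
      have hq' := hq.reverse
      rw [hr, SimpleGraph.Walk.cons_isPath_iff] at hq'
      have hqe : ∀ e, e ∈ q.edges ↔ e = s(x, y) ∨ e ∈ r.edges := fun e => by
        rw [← List.mem_reverse, ← SimpleGraph.Walk.edges_reverse, hr]; simp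
      have hqs : ∀ u, u ∈ r.support → u ∈ q.support := fun u hu => by
        rw [← List.mem_reverse, ← SimpleGraph.Walk.support_reverse, hr]; simp [hu]
      refine ⟨r.concat hxv.symm, hq'.1.concat hq'.2 hxv.symm, ?_, fun e => ?_, fun u hu => ?_⟩
      · rw [SimpleGraph.Walk.edges_concat, List.concat_eq_append, List.mem_append]
        rintro (h1 | h1)
        · exact hq'.2 (r.fst_mem_support_of_mem_edges h1)
        · rw [List.mem_singleton] at h1
          rcases Sym2.eq_iff.1 h1 with h2 | h2
          · exact hxv.ne h2.1
          · exact hvy h2.2.symm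
      · rw [hqe, SimpleGraph.Walk.edges_concat, List.concat_eq_append, List.mem_append,
          List.mem_singleton, Sym2.eq_swap (a := v)]
        tauto
      · rw [SimpleGraph.Walk.support_concat, List.mem_append, List.mem_singleton] at hu
        rcases hu with hu | rfl
        · exact hs u (Or.inr (hqs u hu))
        · exact hs _ (Or.inl rfl)

/-- A cycle through the edges `s(x, y)` and `s(y, z)` consists of these edges and a path that avoids
`y`. -/
theorem exists_path_of_mem_cycle₂ {w x y z : V} {p : G.Walk w w} (hp : p.IsCycle) (hxz : x ≠ z)
    (h : s(x, y) ∈ p.edges) (h' : s(y, z) ∈ p.edges) :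
    ∃ q : G.Walk z x, q.IsPath ∧ y ∉ q.support ∧
      (∀ e, e ∈ p.edges ↔ e = s(x, y) ∨ e = s(y, z) ∨ e ∈ q.edges) ∧
      ∀ u, u = y ∨ u ∈ q.support → u ∈ p.support := by
  obtain ⟨q, hq, hxy, he, hs⟩ := exists_path_of_mem_cycle hp h
  have h1 : s(y, z) ∈ q.edges := ((he _).1 h').resolve_left fun h => hxz (by
    rcases Sym2.eq_iff.1 h with h | h
    · exact h.1.symm.trans h.2.symm
    · exact h.2.symm)
  obtain ⟨hyz, r, rfl⟩ := exists_eq_cons_of_mem_edges hq h1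
  rw [SimpleGraph.Walk.cons_isPath_iff] at hq
  refine ⟨r, hq.1, hq.2, fun e => by rw [he]; simp, fun u hu => hs u ?_⟩
  rw [SimpleGraph.Walk.support_cons, List.mem_cons]
  exact hu

/-- A cycle that contains the three edges of a triangle contains no other edge. -/
theorem mem_edges_of_triangle {w x y z : V} {p : G.Walk w w} (hp : p.IsCycle) (hxz : x ≠ z)
    (h : s(x, y) ∈ p.edges) (h' : s(y, z) ∈ p.edges) (h'' : s(x, z) ∈ p.edges) (hxy : x ≠ y)
    (hyz : y ≠ z) {e : Sym2 V} (he : e ∈ p.edges) : e = s(x, y) ∨ e = s(y, z) ∨ e = s(x, z) := by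
  obtain ⟨q, hq, hy, hpe, -⟩ := exists_path_of_mem_cycle₂ hp hxz h h'
  have h1 : s(z, x) ∈ q.edges := by
    rw [Sym2.eq_swap]
    rcases (hpe _).1 h'' with h2 | h2 | h2
    · exfalso
      rcases Sym2.eq_iff.1 h2 with h3 | h3
      · exact hyz h3.2.symm
      · exact hxy h3.1
    · exfalso
      rcases Sym2.eq_iff.1 h2 with h3 | h3
      · exact hxy h3.1
      · exact hxz h3.1
    · exact h2
  obtain ⟨hzx, r, rfl⟩ := exists_eq_cons_of_mem_edges hq h1
  have hr := ((SimpleGraph.Walk.cons_isPath_iff _ _).1 hq).1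
  rw [SimpleGraph.Walk.isPath_iff_nil, ← SimpleGraph.Walk.eq_nil_iff_nil] at hr
  subst hr
  rcases (hpe e).1 he with h2 | h2 | h2
  · exact Or.inl h2
  · exact Or.inr (Or.inl h2)
  · right; right
    simpa [Sym2.eq_swap] using h2

end Walks

/-! ### Drawings -/

namespace PLEmbedding

variable {V : Type*} {G : SimpleGraph V} (f : PLEmbedding G)

/-- The arc that represents a pair of vertices; it is empty if the pair is not an edge. -/
def arcAt (e : Sym2 V) : Set RP2 := ⋃ h : e ∈ G.edgeSet, f.arc ⟨e, h⟩

theorem arcAt_eq {e : Sym2 V} (h : e ∈ G.edgeSet) : f.arcAt e = f.arc ⟨e, h⟩ := by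
  simp [arcAt, h]

theorem mem_arcAt {e : Sym2 V} {P : RP2} :
    P ∈ f.arcAt e ↔ ∃ h : e ∈ G.edgeSet, P ∈ f.arc ⟨e, h⟩ := by
  simp [arcAt]

theorem mem_of_point_mem_arcAt {e : Sym2 V} {w : V} (h : f.point w ∈ f.arcAt e) : w ∈ e := by
  obtain ⟨he, h⟩ := f.mem_arcAt.1 h
  exact f.mem_of_point_mem ⟨e, he⟩ w h

theorem exists_of_mem_arcAt {e e' : Sym2 V} (hne : e ≠ e') {P : RP2} (h : P ∈ f.arcAt e)
    (h' : P ∈ f.arcAt e') : ∃ w : V, w ∈ e ∧ w ∈ e' ∧ P = f.point w := by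
  obtain ⟨he, h⟩ := f.mem_arcAt.1 h
  obtain ⟨he', h'⟩ := f.mem_arcAt.1 h'
  exact f.inter ⟨e, he⟩ ⟨e', he'⟩ (fun h => hne (congrArg Subtype.val h)) P h h'

theorem mem_trace {u v : V} {p : G.Walk u v} {P : RP2} :
    P ∈ f.trace p ↔ ∃ e ∈ p.edges, P ∈ f.arcAt e := by
  simp only [trace, mem_iUnion, mem_arcAt]
  constructor
  · rintro ⟨e, he, hP⟩; exact ⟨e, he, e.2, hP⟩
  · rintro ⟨e, he, he', hP⟩; exact ⟨⟨e, he'⟩, he, hP⟩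

theorem exists_arc {u v : V} (h : G.Adj u v) {x : E3} (hx : Reps x (f.point u)) :
    ∃ q, Reps q (f.point v) ∧ Arc (f.arcAt s(u, v)) x q := by
  rw [f.arcAt_eq h]
  exact exists_arc_of_isPLArc (f.isPLArc u v h) hx

theorem poly_arcAt (e : Sym2 V) : Poly (f.arcAt e) := by
  by_cases h : e ∈ G.edgeSet
  · induction e using Sym2.ind with
    | _ u v =>
      obtain ⟨x, hx⟩ := exists_reps (f.point u)
      obtain ⟨q, _, hA⟩ := f.exists_arc h hx
      exact hA.poly
  · simpa [arcAt, h] using Poly.empty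

theorem point_notMem_trace {u v w : V} {p : G.Walk u v} (h : w ∉ p.support) :
    f.point w ∉ f.trace p := by
  rw [mem_trace]
  rintro ⟨e, he, hP⟩
  have hw := f.mem_of_point_mem_arcAt hP
  exact h (SimpleGraph.Walk.mem_support_of_mem_edges he hw)

end PLEmbedding

theorem BoundsDisk.of_moves {F S T : Set RP2} (h : Moves F S T) (hS : BoundsDisk S) :
    BoundsDisk T := by
  obtain ⟨H, rfl, -⟩ := h
  obtain ⟨φ, hφ, rfl⟩ := hS
  exact ⟨H ∘ φ, H.isEmbedding.comp hφ, image_comp _ _ _⟩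

/-- Moves preserve the separation of points in the fixed set. -/
theorem Moves.connectedComponentIn_ne {F S T : Set RP2} (h : Moves F S T) {P Q : RP2} (hP : P ∈ F)
    (hQ : Q ∈ F) (hPS : P ∉ S) (hQS : Q ∉ S)
    (hne : connectedComponentIn Sᶜ P ≠ connectedComponentIn Sᶜ Q) :
    connectedComponentIn Tᶜ P ≠ connectedComponentIn Tᶜ Q := by
  obtain ⟨H, rfl, hF⟩ := h
  intro e
  apply hne
  have hc : (H '' S)ᶜ = H '' Sᶜ := (image_compl_eq H.bijective).symm
  have key : ∀ R, R ∈ F → R ∉ S →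
      H '' connectedComponentIn Sᶜ R = connectedComponentIn (H '' S)ᶜ R :=
    fun R hR hRS => by
      rw [H.image_connectedComponentIn hRS, hF R hR, hc]
  rw [← key P hP hPS, ← key Q hQ hQS] at e
  exact H.injective.image_injective e

/-! ### Cycles of the graph before and after the exchange -/

theorem poly_singleton (P : RP2) : Poly {P} := by
  obtain ⟨v, hv⟩ := exists_reps P
  rw [← hv.pnt_eq]
  exact poly_pnt v

section Exchange

variable {V : Type*} {G : SimpleGraph V}

theorem PLEmbedding.poly_trace (f : PLEmbedding G) {x y : V} (q : G.Walk x y) :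
    Poly (f.trace q) := by
  have : f.trace q = ⋃ e ∈ {e | e ∈ q.edges}, f.arcAt e := by
    ext P; simp [PLEmbedding.mem_trace]
  rw [this]
  exact poly_biUnion (List.finite_toSet _) fun e _ => f.poly_arcAt e

theorem deltaY_adj_some {a b c u v : V} (h : G.Adj u v)
    (hT : s(u, v) ∉ ({s(a, b), s(b, c), s(a, c)} : Set (Sym2 V))) :
    (deltaY G a b c).Adj (some u) (some v) := by
  refine Or.inl ⟨by simpa using h.ne, u, v, ?_, rfl, rfl⟩
  exact SimpleGraph.deleteEdges_adj.2 ⟨h, hT⟩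

theorem deltaY_adj_none {a b c x : V} (h : x = a ∨ x = b ∨ x = c) :
    (deltaY G a b c).Adj none (some x) := by
  refine Or.inr ((SimpleGraph.fromEdgeSet_adj _).2 ⟨?_, by simp⟩)
  rcases h with rfl | rfl | rfl <;> simp

/-- A walk that avoids the deleted edges is a walk of the new graph. -/
theorem exists_lift_walk {G' : SimpleGraph (Option V)} {T : Set (Sym2 V)}
    (hG' : ∀ u v, G.Adj u v → s(u, v) ∉ T → G'.Adj (some u) (some v)) {x y : V} (q : G.Walk x y)
    (hq : ∀ e ∈ q.edges, e ∉ T) :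
    ∃ q' : G'.Walk (some x) (some y), q'.edges = q.edges.map (Sym2.map some) ∧
      q'.support = q.support.map some := by
  induction q with
  | nil => exact ⟨.nil, rfl, rfl⟩
  | cons h q ih =>
    obtain ⟨q', h1, h2⟩ := ih fun e he => hq e (by simp [he])
    exact ⟨.cons (hG' _ _ h (hq _ (by simp))) q', by simp [h1], by simp [h2]⟩

/-- Two drawings, of a graph on `V` and of a graph on `Option V`, that agree outside the set `T` of
edges of the first graph. The set `R` contains the common part. -/
structure Agree {G' : SimpleGraph (Option V)} (f : PLEmbedding G) (g : PLEmbedding G')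
    (T : Set (Sym2 V)) (R : Set RP2) : Prop where
  adj : ∀ u v, G.Adj u v → s(u, v) ∉ T → G'.Adj (some u) (some v)
  point : ∀ v, f.point v = g.point (some v)
  arcAt : ∀ e ∈ G.edgeSet, e ∉ T → f.arcAt e = g.arcAt (e.map some)
  arcAt_subset : ∀ e ∉ T, g.arcAt (e.map some) ⊆ R
  point_mem : ∀ v, g.point (some v) ∈ R

namespace Agree

variable {G' : SimpleGraph (Option V)} {f : PLEmbedding G} {g : PLEmbedding G'}
  {T : Set (Sym2 V)} {R : Set RP2}

/-- A move from the trace of a separating cycle to that of another cycle. -/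
theorem isSeparating_of_moves (A : Agree f g T R) {w : V} {p : G.Walk w w}
    (hd : BoundsDisk (f.trace p)) {u v : V} (hu : u ∉ p.support) (hv : v ∉ p.support)
    (hne : connectedComponentIn (f.trace p)ᶜ (f.point u) ≠
      connectedComponentIn (f.trace p)ᶜ (f.point v))
    {w' : Option V} {p' : G'.Walk w' w'} (hp' : p'.IsCycle) (hu' : some u ∉ p'.support)
    (hv' : some v ∉ p'.support) {F : Set RP2} (hm : Moves F (f.trace p) (g.trace p'))
    (huF : g.point (some u) ∈ F) (hvF : g.point (some v) ∈ F) : g.IsSeparating := by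
  refine ⟨w', p', hp', hd.of_moves hm, some u, some v, hu', hv', ?_⟩
  have h1 := f.point_notMem_trace hu
  have h2 := f.point_notMem_trace hv
  rw [A.point] at h1 h2 hne
  rw [A.point] at hne
  exact hm.connectedComponentIn_ne huF hvF h1 h2 hne

theorem trace_lift (A : Agree f g T R) {x y : V} {q : G.Walk x y} (hq : ∀ e ∈ q.edges, e ∉ T)
    {q' : G'.Walk (some x) (some y)} (hq' : q'.edges = q.edges.map (Sym2.map some)) :
    g.trace q' = f.trace q := by
  ext P
  rw [PLEmbedding.mem_trace, PLEmbedding.mem_trace, hq']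
  simp only [List.mem_map, exists_exists_and_eq_and]
  exact exists_congr fun e => and_congr_right fun he => by
    rw [A.arcAt e (q.edges_subset_edgeSet he) (hq e he)]

theorem trace_subset (A : Agree f g T R) {x y : V} {q : G.Walk x y} (hq : ∀ e ∈ q.edges, e ∉ T) :
    f.trace q ⊆ R := by
  intro P hP
  obtain ⟨e, he, hP⟩ := f.mem_trace.1 hP
  rw [A.arcAt e (q.edges_subset_edgeSet he) (hq e he)] at hP
  exact A.arcAt_subset e (hq e he) hP

/-- A separating cycle that avoids the edges of `T` survives. -/
theorem isSeparating_of_disjoint (A : Agree f g T R) {w : V} {p : G.Walk w w} (hp : p.IsCycle)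
    (hd : BoundsDisk (f.trace p)) {u v : V} (hu : u ∉ p.support) (hv : v ∉ p.support)
    (hne : connectedComponentIn (f.trace p)ᶜ (f.point u) ≠
      connectedComponentIn (f.trace p)ᶜ (f.point v)) (hT : ∀ e ∈ p.edges, e ∉ T) :
    g.IsSeparating := by
  obtain ⟨p', he, hs⟩ := exists_lift_walk A.adj p hT
  have hp' : p'.IsCycle := by
    rw [SimpleGraph.Walk.isCycle_def, SimpleGraph.Walk.isTrail_def] at hp ⊢
    rw [he, hs, ← List.map_tail]
    refine ⟨hp.1.map (Sym2.map.injective (Option.some_injective V)), ?_,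
      hp.2.2.map (Option.some_injective V)⟩
    rintro rfl
    refine hp.2.1 (SimpleGraph.Walk.eq_nil_iff_nil.2 (SimpleGraph.Walk.edges_eq_nil.1 ?_))
    simpa using he.symm
  refine A.isSeparating_of_moves hd hu hv hne hp' (by simpa [hs] using hu) (by simpa [hs] using hv)
    (F := univ) ?_ trivial trivial
  rw [A.trace_lift hT he]
  exact Moves.refl _ _

/-- The cycle of the new graph that consists of a path and of the two edges that join its end points
to the new vertex. -/
theorem exists_cycle (A : Agree f g T R) {x y : V} (hxy : x ≠ y)
    (hx : G'.Adj none (some x)) (hy : G'.Adj none (some y)) {q : G.Walk y x} (hq : q.IsPath)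
    (hT : ∀ e ∈ q.edges, e ∉ T) :
    ∃ p' : G'.Walk (some x) (some x), p'.IsCycle ∧
      (∀ u, some u ∈ p'.support → u ∈ q.support) ∧
      g.trace p' = g.arcAt s(none, some x) ∪ g.arcAt s(none, some y) ∪ f.trace q := by
  obtain ⟨q', he, hs⟩ := exists_lift_walk A.adj q hT
  have hn : none ∉ q'.support := by simp [hs]
  have hq' : q'.IsPath := by
    rw [SimpleGraph.Walk.isPath_def, hs]
    exact hq.support_nodup.map (Option.some_injective V)
  refine ⟨.cons hx.symm (.cons hy q'), ?_, fun u hu => ?_, ?_⟩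
  · rw [SimpleGraph.Walk.cons_isCycle_iff, SimpleGraph.Walk.cons_isPath_iff]
    refine ⟨⟨hq', hn⟩, ?_⟩
    rw [SimpleGraph.Walk.edges_cons, List.mem_cons]
    rintro (h | h)
    · rcases Sym2.eq_iff.1 h with h | h
      · simp at h
      · exact hxy (by simpa using h.1)
    · exact hn (q'.snd_mem_support_of_mem_edges h)
  · simp only [SimpleGraph.Walk.support_cons, hs, List.mem_cons, List.mem_map] at hu
    rcases hu with h | h | ⟨v, hv, h⟩
    · obtain rfl : u = x := by simpa using h
      exact q.end_mem_support
    · simp at h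
    · obtain rfl : v = u := by simpa using h
      exact hv
  · rw [← A.trace_lift hT he]
    ext P
    simp only [PLEmbedding.mem_trace, SimpleGraph.Walk.edges_cons, List.mem_cons, mem_union,
      Sym2.eq_swap (a := none) (b := some x)]
    constructor
    · rintro ⟨e, rfl | rfl | h, hP⟩
      · exact Or.inl (Or.inl hP)
      · exact Or.inl (Or.inr hP)
      · exact Or.inr ⟨e, h, hP⟩
    · rintro ((hP | hP) | ⟨e, h, hP⟩)
      · exact ⟨_, Or.inl rfl, hP⟩
      · exact ⟨_, Or.inr (Or.inl rfl), hP⟩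
      · exact ⟨e, Or.inr (Or.inr h), hP⟩

/-- A separating cycle with exactly one edge in `T`. -/
theorem isSeparating_of_one (A : Agree f g T R) {w : V} {p : G.Walk w w} (hp : p.IsCycle)
    (hd : BoundsDisk (f.trace p)) {u v : V} (hu : u ∉ p.support) (hv : v ∉ p.support)
    (hne : connectedComponentIn (f.trace p)ᶜ (f.point u) ≠
      connectedComponentIn (f.trace p)ᶜ (f.point v)) {x y : V} (hxy : x ≠ y)
    (hx : G'.Adj none (some x)) (hy : G'.Adj none (some y)) (h : s(x, y) ∈ p.edges)
    (hT : ∀ e ∈ p.edges, e ≠ s(x, y) → e ∉ T)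
    (hm : Moves R (f.arcAt s(x, y)) (g.arcAt s(none, some x) ∪ g.arcAt s(none, some y))) :
    g.IsSeparating := by
  obtain ⟨q, hq, hqe, he, hs⟩ := exists_path_of_mem_cycle hp h
  have hqT : ∀ e ∈ q.edges, e ∉ T := fun e h => hT e ((he e).2 (Or.inr h)) fun h' => hqe (h' ▸ h)
  obtain ⟨p', hp', hs', ht⟩ := A.exists_cycle hxy hx hy hq hqT
  refine A.isSeparating_of_moves hd hu hv hne hp' (fun h => hu (hs _ (hs' _ h)))
    (fun h => hv (hs _ (hs' _ h))) (F := R) ?_ (A.point_mem u) (A.point_mem v)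
  refine hm.frame (union_subset Subset.rfl (A.trace_subset hqT)) ?_ ht
  ext P
  simp only [PLEmbedding.mem_trace, mem_union, he]
  constructor
  · rintro ⟨e, rfl | h, hP⟩
    · exact Or.inl hP
    · exact Or.inr ⟨e, h, hP⟩
  · rintro (hP | ⟨e, h, hP⟩)
    · exact ⟨_, Or.inl rfl, hP⟩
    · exact ⟨e, Or.inr h, hP⟩

/-- A separating cycle with exactly two edges in `T`, which meet in `y`. -/
theorem isSeparating_of_two (A : Agree f g T R) {w : V} {p : G.Walk w w} (hp : p.IsCycle)
    (hd : BoundsDisk (f.trace p)) {u v : V} (hu : u ∉ p.support) (hv : v ∉ p.support)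
    (hne : connectedComponentIn (f.trace p)ᶜ (f.point u) ≠
      connectedComponentIn (f.trace p)ᶜ (f.point v)) {x y z : V} (hxz : x ≠ z)
    (hx : G'.Adj none (some x)) (hz : G'.Adj none (some z)) (h : s(x, y) ∈ p.edges)
    (h' : s(y, z) ∈ p.edges) (hT : ∀ e ∈ p.edges, e ≠ s(x, y) → e ≠ s(y, z) → e ∉ T)
    (hm : ∀ F, Poly F → F ⊆ R → g.point (some y) ∉ F →
      Moves F (f.arcAt s(x, y) ∪ f.arcAt s(y, z))
        (g.arcAt s(none, some x) ∪ g.arcAt s(none, some z))) :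
    g.IsSeparating := by
  obtain ⟨q, hq, hy, he, hs⟩ := exists_path_of_mem_cycle₂ hp hxz h h'
  have hqT : ∀ e ∈ q.edges, e ∉ T := fun e h => hT e ((he e).2 (Or.inr (Or.inr h)))
    (fun h' => hy (q.snd_mem_support_of_mem_edges (h' ▸ h)))
    (fun h' => hy (q.fst_mem_support_of_mem_edges (h' ▸ h)))
  obtain ⟨p', hp', hs', ht⟩ := A.exists_cycle hxz hx hz hq hqT
  have hyu : ∀ u, u ∉ p.support → g.point (some y) ≠ g.point (some u) := fun u hu e =>
    hu (hs u (Or.inl (by simpa using (g.point_injective e).symm)))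
  refine A.isSeparating_of_moves hd hu hv hne hp' (fun h => hu (hs _ (Or.inr (hs' _ h))))
    (fun h => hv (hs _ (Or.inr (hs' _ h))))
    (F := {g.point (some u)} ∪ {g.point (some v)}) ?_ (Or.inl rfl) (Or.inr rfl)
  refine (hm ({g.point (some u)} ∪ {g.point (some v)} ∪ f.trace q)
    (Poly.union _ _ (Poly.union _ _ (poly_singleton _) (poly_singleton _)) (f.poly_trace q))
    (union_subset (union_subset (singleton_subset_iff.2 (A.point_mem u))
      (singleton_subset_iff.2 (A.point_mem v))) (A.trace_subset hqT)) ?_).frame Subset.rfl ?_ ht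
  · rintro ((h | h) | h)
    · exact hyu u hu h
    · exact hyu v hv h
    · rw [← A.point] at h
      exact f.point_notMem_trace hy h
  ext P
  simp only [PLEmbedding.mem_trace, mem_union, he]
  constructor
  · rintro ⟨e, rfl | rfl | h, hP⟩
    · exact Or.inl (Or.inl hP)
    · exact Or.inl (Or.inr hP)
    · exact Or.inr ⟨e, h, hP⟩
  · rintro ((hP | hP) | ⟨e, h, hP⟩)
    · exact ⟨_, Or.inl rfl, hP⟩
    · exact ⟨_, Or.inr (Or.inl rfl), hP⟩
    · exact ⟨e, Or.inr (Or.inr h), hP⟩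

end Agree

/-- A set that can be moved into a triangle away from two fixed points does not separate them. -/
theorem connectedComponentIn_eq_of_moves {S T : Set RP2} {P Q : RP2} {p q r : E3}
    (h : Indep3 p q r) (hT : T ⊆ tri p q r) (hP : P ∉ tri p q r) (hQ : Q ∉ tri p q r)
    (hm : Moves ({P} ∪ {Q}) S T) :
    connectedComponentIn Sᶜ P = connectedComponentIn Sᶜ Q := by
  by_contra hne
  have hTc : (tri p q r)ᶜ ⊆ Tᶜ := compl_subset_compl.2 hT
  have hfix : ∀ R ∈ ({P} ∪ {Q} : Set RP2), R ∉ T → R ∉ S := by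
    obtain ⟨H, rfl, hH⟩ := hm
    intro R hR hRT hRS
    exact hRT ⟨R, hRS, hH R hR⟩
  refine hm.connectedComponentIn_ne (Or.inl rfl) (Or.inr rfl)
    (hfix P (Or.inl rfl) (hTc hP)) (hfix Q (Or.inr rfl) (hTc hQ)) hne ?_
  exact connectedComponentIn_eq
    (h.isPreconnected_compl_tri.subset_connectedComponentIn hP hTc hQ)

end Exchange

/-! ### The exchange -/

section

variable {V : Type*} {G : SimpleGraph V} {a b c : V}

theorem Arc.isPLArc_of_eq {A : Set RP2} {x y : E3} {pos : V → RP2} (hpos : Function.Injective pos)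
    (h : Arc A x y) {u v u' v' : V} (hx : Reps x (pos u)) (hy : Reps y (pos v)) (huv : u ≠ v)
    (e : s(u', v') = s(u, v)) : IsPLArc A (pos u') (pos v') := by
  rcases Sym2.eq_iff.1 e with ⟨rfl, rfl⟩ | ⟨rfl, rfl⟩
  · exact h.isPLArc hx hy (hpos.ne huv)
  · exact h.reverse.isPLArc hy hx (hpos.ne huv.symm)

/-- The part of a drawing of the exchanged graph that does not belong to the star of the new
vertex. -/
def restOf (g : PLEmbedding (deltaY G a b c)) : Set RP2 :=
  (⋃ e ∈ ({s(a, b), s(b, c), s(a, c)} : Set (Sym2 V))ᶜ, g.arcAt (e.map some)) ∪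
    ⋃ v ∈ (univ : Set V), {g.point (some v)}

theorem poly_restOf [Finite V] (g : PLEmbedding (deltaY G a b c)) : Poly (restOf g) :=
  Poly.union _ _ (poly_biUnion (toFinite _) fun _ _ => g.poly_arcAt _)
    (poly_biUnion (toFinite _) fun _ _ => poly_singleton _)

theorem mem_edge_of_mem_restOf {g : PLEmbedding (deltaY G a b c)} {x : V} {P : RP2}
    (hP : P ∈ restOf g) (hx : P ∈ g.arcAt s(none, some x)) : P = g.point (some x) := by
  rcases hP with hP | hP
  · simp only [mem_iUnion] at hP
    obtain ⟨e, _, hP⟩ := hP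
    have hne : (s(none, some x) : Sym2 (Option V)) ≠ e.map some := fun h => by
      have : none ∈ e.map some := h ▸ Sym2.mem_mk_left _ _
      simp at this
    obtain ⟨w, hw, hw', rfl⟩ := g.exists_of_mem_arcAt hne hx hP
    rcases Sym2.mem_iff.1 hw with rfl | rfl
    · simp at hw'
    · rfl
  · simp only [mem_iUnion] at hP
    obtain ⟨v, _, rfl⟩ := hP
    rcases Sym2.mem_iff.1 (g.mem_of_point_mem_arcAt hx) with h | h
    · simp at h
    · rw [h]

theorem inter_star {g : PLEmbedding (deltaY G a b c)} {x y : V} (hxy : x ≠ y) {P : RP2}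
    (hx : P ∈ g.arcAt s(none, some x)) (hy : P ∈ g.arcAt s(none, some y)) : P = g.point none := by
  have hne : (s(none, some x) : Sym2 (Option V)) ≠ s(none, some y) := fun h => by
    rcases Sym2.eq_iff.1 h with h | h
    · exact hxy (by simpa using h.2)
    · simp at h
  obtain ⟨w, hw, hw', rfl⟩ := g.exists_of_mem_arcAt hne hx hy
  rcases Sym2.mem_iff.1 hw with rfl | rfl
  · rfl
  · rcases Sym2.mem_iff.1 hw' with h | h
    · simp at h
    · exact absurd (by simpa using h) hxy

/-- A drawing of the exchanged graph can be turned into a drawing of the original graph, by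
replacing the star of the new vertex by a triangle. -/
theorem exists_embedding [Finite V] (hab : G.Adj a b) (hbc : G.Adj b c) (hac : G.Adj a c)
    (g : PLEmbedding (deltaY G a b c)) :
    ∃ (f : PLEmbedding G) (qa qb qc : E3), Reps qa (g.point (some a)) ∧
      Reps qb (g.point (some b)) ∧ Reps qc (g.point (some c)) ∧
      Agree f g {s(a, b), s(b, c), s(a, c)} (restOf g) ∧
      Replaces (restOf g) qa qb qc (g.arcAt s(none, some a)) (g.arcAt s(none, some b))
        (g.arcAt s(none, some c)) (f.arcAt s(a, b)) (f.arcAt s(b, c)) (f.arcAt s(a, c)) := by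
  classical
  set T : Set (Sym2 V) := {s(a, b), s(b, c), s(a, c)} with hT
  obtain ⟨o, ho⟩ := exists_reps (g.point none)
  obtain ⟨qa, ha, La⟩ := g.exists_arc (deltaY_adj_none (G := G) (a := a) (b := b) (c := c)
    (Or.inl rfl)) ho
  obtain ⟨qb, hb, Lb⟩ := g.exists_arc (deltaY_adj_none (G := G) (a := a) (b := b) (c := c)
    (Or.inr (Or.inl rfl))) ho
  obtain ⟨qc, hc, Lc⟩ := g.exists_arc (deltaY_adj_none (G := G) (a := a) (b := b) (c := c)
    (Or.inr (Or.inr rfl))) ho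
  have dis : ∀ {x q}, Reps q (g.point (some x)) → Disjoint (pnt o) (pnt q) := fun {x q} hq => by
    rw [ho.pnt_eq, hq.pnt_eq, disjoint_singleton]
    exact fun h => by simpa using g.point_injective h
  have star : ∀ {x y : V}, x ≠ y → g.arcAt s(none, some x) ∩ g.arcAt s(none, some y) ⊆ pnt o :=
    fun hxy P hP => by rw [ho.pnt_eq]; exact inter_star hxy hP.1 hP.2
  have rest : ∀ {x q}, Reps q (g.point (some x)) → restOf g ∩ g.arcAt s(none, some x) ⊆ pnt q :=
    fun hq P hP => by rw [hq.pnt_eq]; exact mem_edge_of_mem_restOf hP.1 hP.2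
  obtain ⟨AB, BC, AC, H⟩ := exists_replaces (poly_restOf g) La Lb Lc (dis ha) (dis hb) (dis hc)
    (star hab.ne) (star hac.ne) (star hbc.ne) (rest ha) (rest hb) (rest hc)
  have n1 : s(a, b) ≠ s(b, c) := fun h => by
    rcases Sym2.eq_iff.1 h with h | h
    · exact hab.ne h.1
    · exact hac.ne h.1
  have n2 : s(a, b) ≠ s(a, c) := fun h => by
    rcases Sym2.eq_iff.1 h with h | h
    · exact hbc.ne h.2
    · exact hac.ne h.1
  have n3 : s(b, c) ≠ s(a, c) := fun h => by
    rcases Sym2.eq_iff.1 h with h | h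
    · exact hab.ne h.1.symm
    · exact hbc.ne h.1
  let D : Sym2 V → Set RP2 := fun e =>
    if e = s(a, b) then AB else if e = s(b, c) then BC else if e = s(a, c) then AC
    else g.arcAt (e.map some)
  have D1 : D s(a, b) = AB := by simp [D]
  have D2 : D s(b, c) = BC := by simp [D, n1.symm]
  have D3 : D s(a, c) = AC := by simp [D, n2.symm, n3.symm]
  have D4 : ∀ e ∉ T, D e = g.arcAt (e.map some) := fun e he => by
    simp only [hT, mem_insert_iff, mem_singleton_iff, not_or] at he
    simp [D, he]
  have hsub : ∀ e ∉ T, g.arcAt (e.map some) ⊆ restOf g := fun e he P hP =>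
    Or.inl (mem_biUnion (show e ∈ Tᶜ from he) hP)
  have hpos : Function.Injective fun v => g.point (some v) :=
    g.point_injective.comp (Option.some_injective V)
  have hpm : ∀ v, g.point (some v) ∈ restOf g := fun v =>
    Or.inr (mem_biUnion (mem_univ v) rfl)
  have old : ∀ e ∉ T, ∀ v, g.point (some v) ∈ D e → v ∈ e := fun e he v hv => by
    rw [D4 e he] at hv
    simpa using g.mem_of_point_mem_arcAt hv
  -- a new edge meets the rest of the drawing only in its end points
  have new : ∀ {X : Set RP2} {x y : V} {p q : E3}, Reps p (g.point (some x)) →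
      Reps q (g.point (some y)) → X ∩ restOf g ⊆ pnt p ∪ pnt q →
      (∀ v, g.point (some v) ∈ X → v ∈ s(x, y)) ∧ ∀ e ∉ T, ∀ P ∈ X, P ∈ D e →
        ∃ w, w ∈ s(x, y) ∧ w ∈ e ∧ P = g.point (some w) := by
    intro X x y p q hp hq hX
    rw [hp.pnt_eq, hq.pnt_eq] at hX
    refine ⟨fun v hv => ?_, fun e he P hP hPe => ?_⟩
    · rcases hX ⟨hv, hpm v⟩ with h | h
      · rw [hpos h]; exact Sym2.mem_mk_left _ _
      · rw [hpos h]; exact Sym2.mem_mk_right _ _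
    · have hPR : P ∈ restOf g := hsub e he (by rwa [D4 e he] at hPe)
      rcases hX ⟨hP, hPR⟩ with h | h
      · obtain rfl : P = _ := h
        exact ⟨x, Sym2.mem_mk_left _ _, old e he x hPe, rfl⟩
      · obtain rfl : P = _ := h
        exact ⟨y, Sym2.mem_mk_right _ _, old e he y hPe, rfl⟩
  obtain ⟨v1, w1⟩ := new ha hb H.ab_R
  obtain ⟨v2, w2⟩ := new hb hc H.bc_R
  obtain ⟨v3, w3⟩ := new ha hc H.ac_R
  have cases : ∀ e : Sym2 V, e = s(a, b) ∨ e = s(b, c) ∨ e = s(a, c) ∨ e ∉ T := fun e => by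
    simp only [hT, mem_insert_iff, mem_singleton_iff]; tauto
  have i12 : ∀ P ∈ AB, P ∈ BC → P = g.point (some b) := fun P h h' => by
    have := H.ab_bc ⟨h, h'⟩
    rwa [hb.pnt_eq] at this
  have i13 : ∀ P ∈ AB, P ∈ AC → P = g.point (some a) := fun P h h' => by
    have := H.ab_ac ⟨h, h'⟩
    rwa [ha.pnt_eq] at this
  have i32 : ∀ P ∈ AC, P ∈ BC → P = g.point (some c) := fun P h h' => by
    have := H.ac_bc ⟨h, h'⟩
    rwa [hc.pnt_eq] at this
  let f : PLEmbedding G :=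
    { point := fun v => g.point (some v)
      arc := fun e => D e
      point_injective := hpos
      isPLArc := by
        intro u v h
        change IsPLArc (D s(u, v)) _ _
        rcases cases s(u, v) with e | e | e | e
        · rw [e, D1]; exact H.arc_ab.isPLArc_of_eq hpos ha hb hab.ne e
        · rw [e, D2]; exact H.arc_bc.isPLArc_of_eq hpos hb hc hbc.ne e
        · rw [e, D3]; exact H.arc_ac.isPLArc_of_eq hpos ha hc hac.ne e
        · rw [D4 _ e]
          change IsPLArc (g.arcAt s(some u, some v)) _ _
          rw [g.arcAt_eq (deltaY_adj_some h e)]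
          exact g.isPLArc _ _ (deltaY_adj_some h e)
      mem_of_point_mem := by
        rintro ⟨e, he⟩ w hw
        change w ∈ e
        change g.point (some w) ∈ D e at hw
        rcases cases e with rfl | rfl | rfl | h
        · exact v1 w (by rwa [D1] at hw)
        · exact v2 w (by rwa [D2] at hw)
        · exact v3 w (by rwa [D3] at hw)
        · exact old e h w hw
      inter := by
        rintro ⟨e, he⟩ ⟨e', he'⟩ hne P hP hP'
        have hne : e ≠ e' := fun h => hne (Subtype.ext h)
        change P ∈ D e at hP
        change P ∈ D e' at hP'
        change ∃ w : V, w ∈ e ∧ w ∈ e' ∧ P = g.point (some w)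
        have flip : (∃ w : V, w ∈ e' ∧ w ∈ e ∧ P = g.point (some w)) →
            ∃ w : V, w ∈ e ∧ w ∈ e' ∧ P = g.point (some w) := fun ⟨w, h, h', h''⟩ => ⟨w, h', h, h''⟩
        rcases cases e with rfl | rfl | rfl | h <;> rcases cases e' with rfl | rfl | rfl | h' <;>
          try rw [D1] at hP
        all_goals try rw [D2] at hP
        all_goals try rw [D3] at hP
        all_goals try rw [D1] at hP'
        all_goals try rw [D2] at hP'
        all_goals try rw [D3] at hP'
        · exact absurd rfl hne
        · exact ⟨b, by simp, by simp, i12 P hP hP'⟩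
        · exact ⟨a, by simp, by simp, i13 P hP hP'⟩
        · exact w1 e' h' P hP hP'
        · exact ⟨b, by simp, by simp, i12 P hP' hP⟩
        · exact absurd rfl hne
        · exact ⟨c, by simp, by simp, i32 P hP' hP⟩
        · exact w2 e' h' P hP hP'
        · exact ⟨a, by simp, by simp, i13 P hP' hP⟩
        · exact ⟨c, by simp, by simp, i32 P hP hP'⟩
        · exact absurd rfl hne
        · exact w3 e' h' P hP hP'
        · exact flip (w1 e h P hP' hP)
        · exact flip (w2 e h P hP' hP)
        · exact flip (w3 e h P hP' hP)
        · rw [D4 e h] at hP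
          rw [D4 e' h'] at hP'
          obtain ⟨w, hw, hw', hPw⟩ := g.exists_of_mem_arcAt
            (fun h => hne (Sym2.map.injective (Option.some_injective V) h)) hP hP'
          obtain ⟨v, hv, rfl⟩ := Sym2.mem_map.1 hw
          exact ⟨v, hv, by simpa using hw', hPw⟩ }
  have hf : ∀ e ∈ G.edgeSet, f.arcAt e = D e := fun e he => f.arcAt_eq he
  refine ⟨f, qa, qb, qc, ha, hb, hc, ⟨fun u v h h' => deltaY_adj_some h h', fun v => rfl,
    fun e he h => by rw [hf e he, D4 e h], hsub, hpm⟩, ?_⟩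
  rw [hf _ hab, hf _ hbc, hf _ hac, D1, D2, D3]
  exact H

end

end ProjPlanar

theorem mainTheorem8 {V : Type*} [Finite V] (G : SimpleGraph V) (a b c : V)
    (hab : G.Adj a b) (hbc : G.Adj b c) (hac : G.Adj a c)
    (hG : ProjPlanar.IsSeparatingProjectivePlanar G)
    (hG' : ProjPlanar.IsProjectivePlanar (ProjPlanar.deltaY G a b c)) :
    ProjPlanar.IsSeparatingProjectivePlanar (ProjPlanar.deltaY G a b c) := by
  refine ⟨hG', fun g => ?_⟩
  obtain ⟨f, qa, qb, qc, ha, hb, hc, A, H⟩ := ProjPlanar.exists_embedding hab hbc hac g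
  obtain ⟨w, p, hp, hd, u, v, hu, hv, hne⟩ := hG.2 f
  have na := ProjPlanar.deltaY_adj_none (G := G) (a := a) (b := b) (c := c) (Or.inl rfl)
  have nb := ProjPlanar.deltaY_adj_none (G := G) (a := a) (b := b) (c := c) (Or.inr (Or.inl rfl))
  have nc := ProjPlanar.deltaY_adj_none (G := G) (a := a) (b := b) (c := c) (Or.inr (Or.inr rfl))
  have hTri : ∀ e : Sym2 V, e ∈ ({s(a, b), s(b, c), s(a, c)} : Set (Sym2 V)) ↔
      e = s(a, b) ∨ e = s(b, c) ∨ e = s(a, c) := fun e => by simp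
  have dis : ∀ {q : ProjPlanar.E3} {P : ProjPlanar.RP2} {F : Set ProjPlanar.RP2},
      ProjPlanar.Reps q P → P ∉ F → Disjoint F (ProjPlanar.pnt q) := fun hq h => by
    rwa [hq.pnt_eq, Set.disjoint_singleton_right]
  by_cases h1 : s(a, b) ∈ p.edges <;> by_cases h2 : s(b, c) ∈ p.edges <;>
    by_cases h3 : s(a, c) ∈ p.edges
  · -- the cycle is the triangle itself, which does not separate any two vertices
    exfalso
    have htr : f.trace p = f.arcAt s(a, b) ∪ f.arcAt s(b, c) ∪ f.arcAt s(a, c) := by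
      ext P
      rw [ProjPlanar.PLEmbedding.mem_trace]
      constructor
      · rintro ⟨e, he, hP⟩
        rcases ProjPlanar.mem_edges_of_triangle hp hac.ne h1 h2 h3 hab.ne hbc.ne he
          with rfl | rfl | rfl
        · exact Or.inl (Or.inl hP)
        · exact Or.inl (Or.inr hP)
        · exact Or.inr hP
      · rintro ((hP | hP) | hP)
        exacts [⟨_, h1, hP⟩, ⟨_, h2, hP⟩, ⟨_, h3, hP⟩]
    have hn : ∀ {x : V}, x ∈ p.support →
        g.point (some x) ∉ ({g.point (some u)} ∪ {g.point (some v)} : Set ProjPlanar.RP2) := by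
      rintro x hx (h | h)
      · obtain rfl : x = u := by simpa using g.point_injective h
        exact hu hx
      · obtain rfl : x = v := by simpa using g.point_injective h
        exact hv hx
    obtain ⟨x, y, z, hxyz, hF, T, hT, hm⟩ := H.shrink _
      (ProjPlanar.Poly.union _ _ (ProjPlanar.poly_singleton (g.point (some u)))
        (ProjPlanar.poly_singleton (g.point (some v))))
      (Set.union_subset (Set.singleton_subset_iff.2 (A.point_mem u))
        (Set.singleton_subset_iff.2 (A.point_mem v)))
      (dis ha (hn (p.fst_mem_support_of_mem_edges h1)))
      (dis hb (hn (p.fst_mem_support_of_mem_edges h2)))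
      (dis hc (hn (p.snd_mem_support_of_mem_edges h2)))
    rw [Set.disjoint_left] at hF
    refine hne ?_
    rw [htr, A.point, A.point]
    exact ProjPlanar.connectedComponentIn_eq_of_moves hxyz hT (hF (Or.inl rfl)) (hF (Or.inr rfl)) hm
  · refine A.isSeparating_of_two hp hd hu hv hne hac.ne na nc h1 h2 ?_
      fun F hF hFR hy => H.move_ab_bc F hF hFR (dis hb hy)
    intro e he e1 e2 h
    rcases (hTri e).1 h with rfl | rfl | rfl <;> contradiction
  · rw [Sym2.eq_swap] at h1
    refine A.isSeparating_of_two hp hd hu hv hne hbc.ne nb nc h1 h3 ?_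
      fun F hF hFR hy => by
        rw [Sym2.eq_swap]; exact H.move_ab_ac F hF hFR (dis ha hy)
    intro e he e1 e2 h
    rw [Sym2.eq_swap] at e1
    rcases (hTri e).1 h with rfl | rfl | rfl <;> contradiction
  · refine A.isSeparating_of_one hp hd hu hv hne hab.ne na nb h1 ?_ H.move_ab
    intro e he e1 h
    rcases (hTri e).1 h with rfl | rfl | rfl <;> contradiction
  · rw [Sym2.eq_swap] at h2
    refine A.isSeparating_of_two hp hd hu hv hne hab.ne na nb h3 h2 ?_
      fun F hF hFR hy => by
        rw [Sym2.eq_swap (a := c)]; exact H.move_ac_bc F hF hFR (dis hc hy)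
    intro e he e1 e2 h
    rw [Sym2.eq_swap] at e2
    rcases (hTri e).1 h with rfl | rfl | rfl <;> contradiction
  · refine A.isSeparating_of_one hp hd hu hv hne hbc.ne nb nc h2 ?_ H.move_bc
    intro e he e1 h
    rcases (hTri e).1 h with rfl | rfl | rfl <;> contradiction
  · refine A.isSeparating_of_one hp hd hu hv hne hac.ne na nc h3 ?_ H.move_ac
    intro e he e1 h
    rcases (hTri e).1 h with rfl | rfl | rfl <;> contradiction
  · refine A.isSeparating_of_disjoint hp hd hu hv hne ?_
    intro e he h
    rcases (hTri e).1 h with rfl | rfl | rfl <;> contradiction
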